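/- Setting. Let $n\ge 2$ agents be linked by an undirected connected graph with a nonnegative, symmetric, stochastic matrix $W$ such that, for $i\ne j$, $w_{ij}>0$ if and only if $i,j$ are linked; let $\lambda_1\ge\lambda_2\ge\dots\ge\lambda_n$ be its eigenvalues. Let $f_i:\mathbb R^p\to\mathbb R$ have $L$-Lipschitz gradients, let $f=\frac1n\sum_i f_i$ be $\mu$-strongly convex ($\mu,L>0$), and let $x^*$ be its minimizer. The stochastic gradients $\nabla f_i(x;\xi_{i,k})$, $k\ge-1$, use independent samples $\xi_{i,k}$, are unbiased, and have variance at most $\sigma^2$ at every $x$ ($\sigma>0$). Compressor. Let $\mathcal C_1$ be a random map of $\mathbb R^p$ with $\mathbb E\|\mathcal C_1(x)-x\|^2\le(1-\delta)\|x\|^2$, $\delta\in(0,1]$, and let $\mathcal C_2$ satisfy $\mathbb E\,\mathcal C_2(x)=x$ and $\mathbb E\|\mathcal C_2(x)-x\|^2\le C\|x\|^2$, $C>0$. Put $\mathcal C(x)=\mathcal C_1(x)+\mathcal C_2(x-\mathcal C_1(x))$, with independent randomness in $\mathcal C_1$ and $\mathcal C_2$. The compression randomness is fresh at every iteration and independent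 of the samples. Write $c=C(1-\delta)$ and assume $c\ge 1/12$. Algorithm (CEDAS). Start from deterministic $x_{i,-1}$, put $h_{i,0}=x_{i,-1}$, $d_{i,0}=0$, $(h_w)_{i,0}=\sum_j w_{ij}h_{j,0}$, $x_{i,0}=x_{i,-1}-\eta_{-1}\nabla f_i(x_{i,-1};\xi_{i,-1})$. For $k\ge0$ put $g_{i,k}=\nabla f_i(x_{i,k};\xi_{i,k})$, $y_{i,k}=x_{i,k}-\eta_kg_{i,k}-d_{i,k}$, $q_{i,k}=\mathcal C(y_{i,k}-h_{i,k})$, $\hat y_{i,k}=h_{i,k}+q_{i,k}$, $(\hat y_w)_{i,k}=(h_w)_{i,k}+\sum_jw_{ij}q_{j,k}$, $h_{i,k+1}=(1-\alpha)h_{i,k}+\alpha\hat y_{i,k}$, $(h_w)_{i,k+1}=(1-\alpha)(h_w)_{i,k}+\alpha(\hat y_w)_{i,k}$, $d_{i,k+1}=d_{i,k}+\frac\gamma2(\hat y_{i,k}-(\hat y_w)_{i,k})$, $x_{i,k+1}=x_{i,k}-\eta_kg_{i,k}-d_{i,k+1}$. Parameters. Let $\alpha=\frac1{12C(1-\delta)}$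 (so $\alpha\le1$), $\theta>18$, $\eta_k=\frac{\theta}{\mu(k+m)}$, let $\gamma$ satisfy $c_0\gamma_{\max}\le\gamma\le\gamma_{\max}$ for a constant $c_0>0$ (for instance $\gamma=\gamma_{\max}$, with $c_0=1$), where $$\gamma_{\max}=\min\Big\{\tfrac{\sqrt\alpha}{2\sqrt c},\tfrac12,\tfrac{(1-\lambda_2)\alpha^2}{1296c},\tfrac{\alpha}{1-\lambda_2}\Big\},\qquad m=\max\Big\{\tfrac{32\theta}{\gamma(1-\lambda_2)},\tfrac{8\sqrt2L}{\mu\gamma(1-\lambda_2)},\tfrac{3\theta L\sqrt6}{2\sqrt\alpha\,\mu},\tfrac{8\theta}{\alpha}\Big\}.$$ Growth conditions. For constants $c_1,\dots,c_4$, $q>0$, $r\ge0$ with $2q+3r\le\frac43\theta-1$ assume $$\sum_i\|\nabla f_i(x^*)\|^2\le c_1n^3,\quad \sum_i\|x_{i,-1}-x^*\|^2\le c_2n^2,\quad \frac1{1-\lambda_2}\le c_3n^q,\quad C(1-\delta)\le c_4n^r.$$ Claim. The transient time of the algorithm is $\mathcal O\big(nC^3(1-\delta)^3/(1-\lambda_2)^2\big)$.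 That is, there are constants $A,K>0$ that depend only on $\mu,L,\sigma,\theta,c_0,\dots,c_4,q,r$ (not on $n$, $p$, the network, $f$, the compressors, $C$, $\delta$ or the initial values) such that $$K_T:=\inf\Big\{T:\ \frac1n\sum_{i=1}^n\mathbb E\|x_{i,k}-x^*\|^2\le\frac{K}{nk}\ \text{ for all } k\ge T\Big\}\ \le\ A\,\frac{nC^3(1-\delta)^3}{(1-\lambda_2)^2}.$$ -/

import Mathlib

open MeasureTheory ProbabilityTheory
open scoped ENNReal

universe u

namespace CEDAS

noncomputable section

/-- The decision space `ℝ^p` with its Euclidean norm. -/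
abbrev Vec (p : ℕ) : Type := EuclideanSpace ℝ (Fin p)

/-! ### The network -/

/-- An undirected connected network on `n` agents with a compliant mixing matrix: `W` is
nonnegative, symmetric and stochastic, and `i ≠ j` are linked if and only if `w i j > 0`. -/
structure Network (n : ℕ) where
  graph : SimpleGraph (Fin n)
  W : Matrix (Fin n) (Fin n) ℝ
  connected : graph.Connected
  nonneg : ∀ i j, 0 ≤ W i j
  symm : W.IsSymm
  stochastic : ∀ i, ∑ j, W i j = 1
  adj_iff : ∀ i j, i ≠ j → (graph.Adj i j ↔ 0 < W i j)

theorem Network.isHermitian {n : ℕ} (N : Network n) : N.W.IsHermitian := by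
  ext i j
  simpa using N.symm.apply i j

/-- `λ₂`, the second entry of the list `λ₁ ≥ λ₂ ≥ ⋯ ≥ λₙ` of the eigenvalues of `W`
(with multiplicity). -/
def Network.lambda2 {n : ℕ} (N : Network n) (hn : 2 ≤ n) : ℝ :=
  N.isHermitian.eigenvalues₀ ⟨1, by rw [Fintype.card_fin]; omega⟩

/-! ### The objective functions -/

/-- The average `f = (1/n) ∑ f_i`. -/
def average {n p : ℕ} (f : Fin n → Vec p → ℝ) (x : Vec p) : ℝ := (1 / (n : ℝ)) * ∑ i, f i x

/-- Each `f_i` has an `L`-Lipschitz gradient and the average is `μ`-strongly convex. -/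
structure SmoothStronglyConvex {n p : ℕ} (f : Fin n → Vec p → ℝ) (μ L : ℝ) : Prop where
  differentiable : ∀ i, Differentiable ℝ (f i)
  lipschitz : ∀ i x x', ‖gradient (f i) x - gradient (f i) x'‖ ≤ L * ‖x - x'‖
  strongly_convex : ∀ x x', μ * ‖x - x'‖ ^ 2 ≤
    inner ℝ (gradient (average f) x - gradient (average f) x') (x - x')

/-! ### Compression operators -/

/-- A random map `ℝ^p → ℝ^p`: a seed with a given law is drawn and the map `x ↦ map s x` is
used. -/
structure Compressor (p : ℕ) where
  Seed : Type u
  [measurableSpace : MeasurableSpace Seed]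
  law : Measure Seed
  [isProbabilityMeasure : IsProbabilityMeasure law]
  map : Seed → Vec p → Vec p
  measurable_map : Measurable (Function.uncurry map)

attribute [instance] Compressor.measurableSpace Compressor.isProbabilityMeasure

/-- `𝒞 ∈ 𝕌(C)`: unbiased with `E‖𝒞(x) - x‖² ≤ C ‖x‖²`. -/
structure Compressor.IsUnbiased {p : ℕ} (𝒞 : Compressor.{u} p) (C : ℝ) : Prop where
  pos : 0 < C
  integrable : ∀ x, Integrable (fun s => 𝒞.map s x) 𝒞.law
  mean : ∀ x, ∫ s, 𝒞.map s x ∂𝒞.law = x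
  variance : ∀ x, ∫⁻ s, ‖𝒞.map s x - x‖ₑ ^ 2 ∂𝒞.law ≤ ENNReal.ofReal (C * ‖x‖ ^ 2)

/-- `𝒞 ∈ 𝔹(δ)`: `E‖𝒞(x) - x‖² ≤ (1 - δ) ‖x‖²`, where `δ ∈ (0, 1]`. -/
structure Compressor.IsBiased {p : ℕ} (𝒞 : Compressor.{u} p) (δ : ℝ) : Prop where
  pos : 0 < δ
  le_one : δ ≤ 1
  error : ∀ x, ∫⁻ s, ‖𝒞.map s x - x‖ₑ ^ 2 ∂𝒞.law ≤ ENNReal.ofReal ((1 - δ) * ‖x‖ ^ 2)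

/-- The compressor `x ↦ 𝒞₁(x) + 𝒞₂(x - 𝒞₁(x))`, the seeds of `𝒞₁` and `𝒞₂` being drawn
independently. -/
def Compressor.induced {p : ℕ} (𝒞₁ 𝒞₂ : Compressor.{u} p) : Compressor.{u} p where
  Seed := 𝒞₁.Seed × 𝒞₂.Seed
  law := 𝒞₁.law.prod 𝒞₂.law
  map s x := 𝒞₁.map s.1 x + 𝒞₂.map s.2 (x - 𝒞₁.map s.1 x)
  measurable_map := by
    have h1 : Measurable fun a : (𝒞₁.Seed × 𝒞₂.Seed) × Vec p => 𝒞₁.map a.1.1 a.2 :=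
      𝒞₁.measurable_map.comp ((measurable_fst.comp measurable_fst).prodMk measurable_snd)
    have h2 : Measurable fun a : (𝒞₁.Seed × 𝒞₂.Seed) × Vec p =>
        𝒞₂.map a.1.2 (a.2 - 𝒞₁.map a.1.1 a.2) :=
      𝒞₂.measurable_map.comp
        ((measurable_snd.comp measurable_fst).prodMk (measurable_snd.sub h1))
    exact h1.add h2

/-! ### The algorithm -/

/-- The variables `x_i`, `d_i`, `h_i`, `(h_w)_i` that the agents hold between two iterations. -/
structure State (n p : ℕ) where
  x : Fin n → Vec p
  d : Fin n → Vec p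
  h : Fin n → Vec p
  hw : Fin n → Vec p

/-- One iteration with stepsize `η`, sampled gradients `g` and realized compression maps `Q`.
As `w i j = 0` when `j` is neither `i` nor a neighbour of `i`, the sum over the neighbourhood of
`i` is written as a sum over all agents. -/
def step {n p : ℕ} (W : Matrix (Fin n) (Fin n) ℝ) (γ α η : ℝ) (g : Fin n → Vec p)
    (Q : Fin n → Vec p → Vec p) (S : State n p) : State n p :=
  let y : Fin n → Vec p := fun i => S.x i - η • g i - S.d i
  let q : Fin n → Vec p := fun i => Q i (y i - S.h i)
  let yhat : Fin n → Vec p := fun i => S.h i + q i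
  let yhatw : Fin n → Vec p := fun i => S.hw i + ∑ j, W i j • q j
  let d' : Fin n → Vec p := fun i => S.d i + (γ / 2) • (yhat i - yhatw i)
  { x := fun i => S.x i - η • g i - d' i
    d := d'
    h := fun i => (1 - α) • S.h i + α • yhat i
    hw := fun i => (1 - α) • S.hw i + α • yhatw i }

/-- The state at time `0`: `d_{i,0} = 0`, `(h_w)_{i,0} = ∑_j w_{ij} h_{j,0}` and
`x_{i,0} = x_{i,-1} - η_{-1} g_{i,-1}`, with `η = η_{-1}` and `g = g_{·,-1}` here. -/
def init {n p : ℕ} (W : Matrix (Fin n) (Fin n) ℝ) (η : ℝ) (g : Fin n → Vec p)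
    (xm1 h0 : Fin n → Vec p) : State n p where
  x := fun i => xm1 i - η • g i
  d := fun _ => 0
  h := h0
  hw := fun i => ∑ j, W i j • h0 j

/-- The state of the algorithm at time `k` for given realizations. `grad i x z` is the stochastic
gradient `∇f_i(x; z)`. The sample used at iteration `k ≥ -1` is `ξ i (k + 1)` (so `ξ i 0` is the
one used at iteration `-1`), and `s i k` is the compression seed of agent `i` at iteration `k`. -/
def run {n p : ℕ} {Ξ : Type u} (W : Matrix (Fin n) (Fin n) ℝ) (γ α : ℝ) (η : ℤ → ℝ)
    (grad : Fin n → Vec p → Ξ → Vec p) (𝒞 : Compressor.{u} p) (xm1 h0 : Fin n → Vec p)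
    (ξ : Fin n → ℕ → Ξ) (s : Fin n → ℕ → 𝒞.Seed) : ℕ → State n p
  | 0 => init W (η (-1)) (fun i => grad i (xm1 i) (ξ i 0)) xm1 h0
  | k + 1 =>
    let S := run W γ α η grad 𝒞 xm1 h0 ξ s k
    step W γ α (η k) (fun i => grad i (S.x i) (ξ i (k + 1))) (fun i => 𝒞.map (s i k)) S

/-- The stepsize `η_k = θ / (μ (k + m))`, `k ≥ -1`. -/
def stepsize (θ μ m : ℝ) (k : ℤ) : ℝ := θ / (μ * (k + m))

/-- The upper bound for `γ`; `c` is the parameter of the unbiased compressor in use and `gap` is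
`1 - λ₂`. -/
def gammaMax (c α gap : ℝ) : ℝ :=
  min (min (Real.sqrt α / (2 * Real.sqrt c)) (1 / 2))
    (min (gap * α ^ 2 / (1296 * c)) (α / gap))

/-- The shift `m` in the stepsize. -/
def shift (θ μ L γ α gap : ℝ) : ℝ :=
  max (max (32 * θ / (γ * gap)) (8 * Real.sqrt 2 * L / (μ * γ * gap)))
    (max (3 * θ * L * Real.sqrt 6 / (2 * Real.sqrt α * μ)) (8 * θ / α))

/-! ### The randomness -/

/-- Unbiased stochastic gradients with variance at most `σ²`: the samples `ξ i t` are independent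
and, at every query point, their stochastic gradient has mean `∇f_i` and variance at most `σ²`. -/
structure StochasticGradient {n p : ℕ} {Ω Ξ : Type u} [MeasurableSpace Ω] [MeasurableSpace Ξ]
    (P : Measure Ω) (f : Fin n → Vec p → ℝ) (grad : Fin n → Vec p → Ξ → Vec p)
    (ξ : Fin n → ℕ → Ω → Ξ) (σ : ℝ) : Prop where
  measurable_grad : ∀ i, Measurable (Function.uncurry (grad i))
  measurable_sample : ∀ i t, Measurable (ξ i t)
  indep : iIndepFun (fun a : Fin n × ℕ => ξ a.1 a.2) P
  integrable : ∀ i t x, Integrable (fun ω => grad i x (ξ i t ω)) P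
  mean : ∀ i t x, ∫ ω, grad i x (ξ i t ω) ∂P = gradient (f i) x
  variance : ∀ i t x,
    ∫⁻ ω, ‖grad i x (ξ i t ω) - gradient (f i) x‖ₑ ^ 2 ∂P ≤ ENNReal.ofReal (σ ^ 2)

/-- Compression seeds with the law of the compressor, fresh at every iteration: the families
`(s i k)_i` are independent over `k`. Independence between different agents is not required. -/
structure FreshSeeds {n p : ℕ} {Ω : Type u} [MeasurableSpace Ω] (P : Measure Ω)
    (𝒞 : Compressor.{u} p) (s : Fin n → ℕ → Ω → 𝒞.Seed) : Prop where
  measurable : ∀ i k, Measurable (s i k)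
  law_eq : ∀ i k, P.map (s i k) = 𝒞.law
  indep : iIndepFun (fun (k : ℕ) (ω : Ω) (i : Fin n) => s i k ω) P

/-! ### Transient time -/

/-- The total expected error `(1/n) ∑ E‖x_i - x*‖²` of random vectors `x_i`. -/
def meanSqError {n p : ℕ} {Ω : Type u} [MeasurableSpace Ω] (P : Measure Ω)
    (x : Ω → Fin n → Vec p) (xstar : Vec p) : ℝ≥0∞ :=
  (n : ℝ≥0∞)⁻¹ * ∑ i, ∫⁻ ω, ‖x ω i - xstar‖ₑ ^ 2 ∂P

/-- The transient time `inf {T : err k ≤ K / (n k) for all k ≥ T}` (with `1 / 0 = ∞`, so that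
`k = 0` imposes nothing), where `K` is the constant hidden in `O(1 / (n k))`. It is `∞` if there
is no such `T`. -/
def transientTime (n : ℕ) (K : ℝ) (err : ℕ → ℝ≥0∞) : ℝ≥0∞ :=
  ⨅ (T : ℕ) (_ : ∀ k : ℕ, T ≤ k → 1 ≤ k → err k ≤ ENNReal.ofReal (K / (n * k))), (T : ℝ≥0∞)

end

end CEDAS

namespace CEDAS

/-! ### Scalar recursions -/

/-! Collect the agents into one vector of square integrable random variables. Unbiasedness and fresh
randomness then become orthogonality: the gradient noise `ε` is orthogonal to whatever the current
state determines, the compression error `e` to whatever is known before compression. The convergence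
proof is thus deterministic geometry in a Hilbert space; `Iteration` lists the relations it needs
and `Model.process` derives them from the algorithm.

Write `Y = X - η(G + ε) - D` and `M = (γ/2)(1 - W)`. Then `X' = Y - M(Y + e)` and `D' = D + M(Y +
e)`, and the ideal dual variable is `-η Gs`, with `Gs` the gradients at the minimizer. Two errors
are followed: `a = ‖J(X - xs)‖²` for the network average, and a Lyapunov function `Φ` that adds the
consensus error, the dual error and the distance from `Y` to the reference point `h`. Measuring the
dual error in the pseudo-inverse `B` of `M` makes the primal and dual cross terms cancel
(`MixingOps.energy_eq`). With `t = k + m`, the lemmas `Iteration.mean_succ_le` and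
`Iteration.lyapunov_succ_le` lead to `a' ≤ (1 - 15θ/(8t) + Q/t²) a + (Q/t) Φ + Q/t²`, `Φ' ≤ (1 -
1/(32m)) Φ + (Qm/t²)(Φ + a) + Qn/t² + Qn³m²/t⁴`. The source in the first line carries no factor `n`,
because the noises of different agents are orthogonal; this is the linear speedup.

In the second line the sources balance the contraction at the level `nm/t² + n³m³/t⁴`, which is at
most of order `1/t` once `t ≥ nm`. The initial error, of order `n³`, decays like `n³(m/t)^(3θ/2)`;
for `t ≥ nm` this too is `O(1/t)`, because `m` grows at most like `n^(2q+3r)` and `θ > 18`. Hence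
the transient time is of order `nm` (`exists_transient_bound`, `exists_process_bound`). Finally `m`
is at most a constant times `1/(γ(1 - λ₂))`, and the largest admissible `γ` is of order `(1 -
λ₂)/c³` with `c = C(1 - δ)`, which gives the claimed bound. -/

theorem one_sub_div_mul_inv_rpow_le {j t : ℝ} (hj : 1 ≤ j) (ht : 0 < t) :
    (1 - j / t) * t⁻¹ ^ j ≤ (t + 1)⁻¹ ^ j := by
  have h1 : (t + 1)⁻¹ = (1 + -(1 / (t + 1))) * t⁻¹ := by field_simp; ring
  -- Bernoulli's inequality for the power `j` of `t/(t + 1)`.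
  have h2 : 1 + j * -(1 / (t + 1)) ≤ (1 + -(1 / (t + 1))) ^ j := by
    apply one_add_mul_self_le_rpow_one_add _ hj
    have : 1 / (t + 1) ≤ 1 := by rw [div_le_one (by positivity)]; linarith
    linarith
  have h3 : 0 ≤ 1 + -(1 / (t + 1)) := by
    have : 1 / (t + 1) ≤ 1 := by rw [div_le_one (by positivity)]; linarith
    linarith
  rw [h1, Real.mul_rpow h3 (by positivity)]
  apply mul_le_mul_of_nonneg_right _ (by positivity)
  refine le_trans ?_ h2
  have : j / (t + 1) ≤ j / t := by gcongr; linarith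
  have e : j * -(1 / (t + 1)) = - (j / (t + 1)) := by ring
  rw [e]; linarith

/-- The comparison function that dominates both error sequences at shifted time `t`. -/
noncomputable def envelope (n m s t : ℝ) : ℝ :=
  t⁻¹ ^ (1 : ℝ) + n * m * t⁻¹ ^ (2 : ℝ) + n ^ 3 * m ^ 3 * t⁻¹ ^ (4 : ℝ) + n ^ 3 * m ^ s * t⁻¹ ^ s

/-- A power `t⁻ʲ` with `j ≤ s` loses at most the fraction `s/t` in one step. A recursion that
contracts faster than `1 - s/t` therefore stays below the envelope. -/
theorem envelope_succ {n m s t : ℝ} (hn : 0 ≤ n) (hm : 0 ≤ m) (hs : 4 ≤ s) (ht : 0 < t) :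
    (1 - s / t) * envelope n m s t ≤ envelope n m s (t + 1) := by
  have key : ∀ j, 1 ≤ j → j ≤ s → (1 - s / t) * t⁻¹ ^ j ≤ (t + 1)⁻¹ ^ j := fun j hj hjs => by
    refine le_trans ?_ (one_sub_div_mul_inv_rpow_le hj ht)
    gcongr
  have h1 := key 1 le_rfl (by linarith)
  have h2 := mul_le_mul_of_nonneg_left (key 2 (by norm_num) (by linarith)) (mul_nonneg hn hm)
  have h4 := mul_le_mul_of_nonneg_left (key 4 (by norm_num) (by linarith))
    (mul_nonneg (pow_nonneg hn 3) (pow_nonneg hm 3))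
  have hs' := mul_le_mul_of_nonneg_left (key s (by linarith) le_rfl)
    (mul_nonneg (pow_nonneg hn 3) (Real.rpow_nonneg hm s))
  unfold envelope
  linarith

/-- The growth of the two error sequences while the stepsize is not yet small. -/
theorem growth_bound {Q n m : ℝ} (hQ : 0 ≤ Q) (hn : 1 ≤ n) (hm : 1 ≤ m) {θ : ℝ} (hθ : 0 ≤ θ)
    {a Φ : ℕ → ℝ} (ha : ∀ k, 0 ≤ a k) (hΦ : ∀ k, 0 ≤ Φ k)
    (h1 : ∀ k : ℕ, a (k + 1) ≤ (1 - 15 / 8 * θ / (k + m) + Q / (k + m) ^ 2) * a k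
      + Q / (k + m) * Φ k + Q / (k + m) ^ 2)
    (h2 : ∀ k : ℕ, Φ (k + 1) ≤ (1 - 1 / (32 * m)) * Φ k + Q * m / (k + m) ^ 2 * (Φ k + a k)
      + Q * n / (k + m) ^ 2 + Q * n ^ 3 * m ^ 2 / (k + m) ^ 4)
    (h0 : a 0 + Φ 0 ≤ Q * n ^ 3) (k : ℕ) :
    a k + Φ k ≤ Real.exp (2 * Q / m * k) * ((Q + 2) * n ^ 3) := by
  have hm0 : 0 < m := by linarith
  -- As `t ≥ m ≥ 1`, every positive coefficient beyond the identity is at most `Q/m`. The added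
  -- `2n³` absorbs the three sources, each at most `(Q/m) n³`.
  have step : ∀ k : ℕ, a (k + 1) + Φ (k + 1) + 2 * n ^ 3
      ≤ (1 + 2 * Q / m) * (a k + Φ k + 2 * n ^ 3) := fun k => by
    have hk : (0 : ℝ) ≤ k := k.cast_nonneg
    have ht : m ≤ k + m := by linarith
    have ht0 : (0 : ℝ) < k + m := by linarith
    have e1 : Q / (k + m) ≤ Q / m := by gcongr
    have e2 : Q / (k + m) ^ 2 ≤ Q / m := by
      gcongr; nlinarith
    have e3 : Q * m / (k + m) ^ 2 ≤ Q / m := by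
      rw [div_le_div_iff₀ (by positivity) hm0]
      have : m * m ≤ (k + m) ^ 2 := by nlinarith
      nlinarith
    have e4 : Q * n ^ 3 * m ^ 2 / (k + m) ^ 4 ≤ Q / m * n ^ 3 := by
      rw [div_mul_eq_mul_div, div_le_div_iff₀ (by positivity) hm0]
      have : m ^ 2 * m ≤ (k + m) ^ 4 := by
        calc m ^ 2 * m = m ^ 3 * 1 := by ring
          _ ≤ (k + m) ^ 3 * (k + m) := by gcongr; linarith
          _ = _ := by ring
      have := mul_le_mul_of_nonneg_left this (show 0 ≤ Q * n ^ 3 by positivity)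
      linarith
    have e5 : Q * n / (k + m) ^ 2 ≤ Q / m * n ^ 3 := by
      have : n ≤ n ^ 3 := le_self_pow₀ hn (by norm_num)
      calc Q * n / (k + m) ^ 2 = Q / (k + m) ^ 2 * n := by ring
        _ ≤ Q / m * n ^ 3 := by gcongr
    have e6 : 0 ≤ 15 / 8 * θ / (k + m) := by positivity
    have e7 : 0 ≤ 1 / (32 * m) := by positivity
    have e8 : (1:ℝ) ≤ n ^ 3 := one_le_pow₀ hn
    have e9 : 0 ≤ Q / m := by positivity
    have i1 := h1 k
    have i2 := h2 k
    have j1 := mul_le_mul_of_nonneg_right e2 (ha k)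
    have j2 := mul_le_mul_of_nonneg_right e1 (hΦ k)
    have j3 := mul_le_mul_of_nonneg_right e3 (add_nonneg (hΦ k) (ha k))
    have j4 := mul_nonneg e6 (ha k)
    have j5 := mul_nonneg e7 (hΦ k)
    have j6 := mul_le_mul_of_nonneg_left e8 e9
    rw [show 2 * Q / m = 2 * (Q / m) by ring]
    linarith
  have ind : ∀ k : ℕ, a k + Φ k + 2 * n ^ 3 ≤ (1 + 2 * Q / m) ^ k * ((Q + 2) * n ^ 3) := by
    intro k
    induction k with
    | zero => simp only [pow_zero, one_mul]; linarith
    | succ k ih =>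
      refine (step k).trans ?_
      have := mul_le_mul_of_nonneg_left ih (show 0 ≤ 1 + 2 * Q / m by positivity)
      rw [pow_succ' _ k, mul_assoc]
      exact this
  have h3 : (1 + 2 * Q / m) ^ k ≤ Real.exp (2 * Q / m * k) := by
    rw [mul_comm (2 * Q / m) (k : ℝ), Real.exp_nat_mul]
    gcongr
    rw [add_comm]; exact Real.add_one_le_exp _
  have h4 : 0 ≤ n ^ 3 := by positivity
  have := mul_le_mul_of_nonneg_right h3 (show 0 ≤ (Q + 2) * n ^ 3 by positivity)
  linarith [ind k]

set_option maxHeartbeats 1600000 in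
-- For `a`: the coupling `(Q/t)Φ` and the source `Q/t²` together give `Q(A + 1)E/t`, which dictates
-- the constant in front of its envelope. For `Φ`: the contraction `1/(32m) = 3/(96m)` pays for the
-- sources (`1/(96m)`), the feedback of `a` and `Φ` (`1/(96m)`) and the decay of the envelope itself
-- (`1/(192m)`). The last two are this small because `t ≥ Cm`.
theorem envelope_induction {Q n m θ C A : ℝ} (hQ : 1 ≤ Q) (hn : 1 ≤ n) (hm : 1 ≤ m)
    (hθ : 18 < θ) (hC1 : 192 * (3 / 2 * θ) ≤ C) (hC2 : 96 * Q * (1 + 2 * Q) ≤ C)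
    (hA : 96 * Q ≤ A)
    {a Φ : ℕ → ℝ}
    (h1 : ∀ k : ℕ, a (k + 1) ≤ (1 - 15 / 8 * θ / (k + m) + Q / (k + m) ^ 2) * a k
      + Q / (k + m) * Φ k + Q / (k + m) ^ 2)
    (h2 : ∀ k : ℕ, Φ (k + 1) ≤ (1 - 1 / (32 * m)) * Φ k + Q * m / (k + m) ^ 2 * (Φ k + a k)
      + Q * n / (k + m) ^ 2 + Q * n ^ 3 * m ^ 2 / (k + m) ^ 4)
    {k : ℕ} (hk : C * m ≤ k + m) (ha : a k ≤ Q * (A + 1) * envelope n m (3 / 2 * θ) (k + m))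
    (hΦ : Φ k ≤ A * envelope n m (3 / 2 * θ) (k + m)) :
    a (k + 1) ≤ Q * (A + 1) * envelope n m (3 / 2 * θ) ((k + 1 : ℕ) + m) ∧
      Φ (k + 1) ≤ A * envelope n m (3 / 2 * θ) ((k + 1 : ℕ) + m) := by
  set t : ℝ := k + m with ht
  have hCpos : 0 < C := by linarith
  have hm0 : 0 < m := by linarith
  have htC : C ≤ t := by nlinarith
  have ht0 : 0 < t := by linarith
  have hcast : ((k + 1 : ℕ) : ℝ) + m = t + 1 := by push_cast; rw [ht]; ring
  rw [hcast]
  have hsucc := envelope_succ (n := n) (m := m) (s := 3 / 2 * θ) (t := t) (by linarith)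
    (by linarith) (by linarith) ht0
  set E := envelope n m (3 / 2 * θ) t with hE
  have hE1 : 1 / t ≤ E := by
    have : 0 ≤ n * m * t⁻¹ ^ (2 : ℝ) + n ^ 3 * m ^ 3 * t⁻¹ ^ (4 : ℝ)
      + n ^ 3 * m ^ (3 / 2 * θ) * t⁻¹ ^ (3 / 2 * θ) := by positivity
    have e : t⁻¹ ^ (1 : ℝ) = 1 / t := by simp
    rw [hE, envelope, e]; linarith
  have hE2 : n * m / t ^ 2 + n ^ 3 * m ^ 3 / t ^ 4 ≤ E := by
    have : 0 ≤ t⁻¹ ^ (1 : ℝ) + n ^ 3 * m ^ (3 / 2 * θ) * t⁻¹ ^ (3 / 2 * θ) := by positivity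
    have e2 : t⁻¹ ^ (2 : ℝ) = 1 / t ^ 2 := by
      rw [show (2 : ℝ) = ((2 : ℕ) : ℝ) by norm_num, Real.rpow_natCast]; simp
    have e4 : t⁻¹ ^ (4 : ℝ) = 1 / t ^ 4 := by
      rw [show (4 : ℝ) = ((4 : ℕ) : ℝ) by norm_num, Real.rpow_natCast]; simp
    rw [hE, envelope, e2, e4]
    have : n * m / t ^ 2 = n * m * (1 / t ^ 2) := by ring
    have : n ^ 3 * m ^ 3 / t ^ 4 = n ^ 3 * m ^ 3 * (1 / t ^ 4) := by ring
    linarith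
  have hE0 : 0 < E := lt_of_lt_of_le (by positivity) hE1
  have hA0 : 0 ≤ A := by linarith
  have hQC : Q ≤ C := by nlinarith
  have hmt : m / t ≤ 1 / C := by
    rw [div_le_div_iff₀ ht0 hCpos]; linarith
  refine ⟨?_, ?_⟩
  · have c1 : 0 ≤ 1 - 15 / 8 * θ / t + Q / t ^ 2 := by
      have : 15 / 8 * θ / t ≤ 1 := by rw [div_le_one ht0]; linarith
      have : 0 ≤ Q / t ^ 2 := by positivity
      linarith
    have s1 := mul_le_mul_of_nonneg_left ha c1
    have s2 := mul_le_mul_of_nonneg_left hΦ (show 0 ≤ Q / t by positivity)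
    have s3 : Q / t ^ 2 ≤ 1 / t * (Q * E) := by
      have := mul_le_mul_of_nonneg_left hE1 (show 0 ≤ Q / t by positivity)
      calc Q / t ^ 2 = Q / t * (1 / t) := by field_simp
        _ ≤ _ := this
        _ = _ := by ring
    have s4 : Q / t ^ 2 ≤ 1 / t := by
      rw [div_le_div_iff₀ (by positivity) ht0]; nlinarith
    have s5 := mul_le_mul_of_nonneg_right s4 (show 0 ≤ Q * (A + 1) * E by positivity)
    have s6 := mul_le_mul_of_nonneg_left hsucc (show 0 ≤ Q * (A + 1) by positivity)
    have i1 := h1 k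
    rw [← ht] at i1
    refine i1.trans (le_trans ?_ s6)
    have e1 : 15 / 8 * θ / t = 15 / 8 * θ * (1 / t) := by ring
    have e2 : Q / t = Q * (1 / t) := by ring
    have e3 : 3 / 2 * θ / t = 3 / 2 * θ * (1 / t) := by ring
    rw [e1] at s1
    rw [e2] at s2
    rw [e1, e2, e3]
    -- The rate `15θ/8` exceeds the envelope rate `3θ/2` by `3θ/8`; two units of it cover the `Q/t²`
    -- correction and the coupling with the source.
    have s7 : 0 ≤ 1 / t * (Q * (A + 1) * E) * (3 / 8 * θ - 2) :=
      mul_nonneg (by positivity) (by linarith)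
    linarith
  · have hs0 : 0 ≤ 1 - 1 / (32 * m) + Q * m / t ^ 2 := by
      have : 1 / (32 * m) ≤ 1 := by rw [div_le_one (by positivity)]; linarith
      have : 0 ≤ Q * m / t ^ 2 := by positivity
      linarith
    have s1 := mul_le_mul_of_nonneg_left hΦ hs0
    have s2 := mul_le_mul_of_nonneg_left ha (show 0 ≤ Q * m / t ^ 2 by positivity)
    have s3 : Q * n / t ^ 2 + Q * n ^ 3 * m ^ 2 / t ^ 4 ≤ 1 / m * (A / 96 * E) := by
      have := mul_le_mul_of_nonneg_left hE2 (show 0 ≤ Q / m by positivity)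
      calc Q * n / t ^ 2 + Q * n ^ 3 * m ^ 2 / t ^ 4
          = Q / m * (n * m / t ^ 2 + n ^ 3 * m ^ 3 / t ^ 4) := by field_simp
        _ ≤ _ := this
        _ = 1 / m * (Q * E) := by ring
        _ ≤ _ := by gcongr; linarith
    have s4 : Q * m / t ^ 2 * (A + Q * (A + 1)) ≤ 1 / m * (A / 96) := by
      have b1 : A + Q * (A + 1) ≤ A * (1 + 2 * Q) := by nlinarith
      have b2 : m / t * (m / t) ≤ 1 / C * 1 := by
        have : 1 / C ≤ 1 := by rw [div_le_one hCpos]; linarith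
        gcongr; linarith
      calc Q * m / t ^ 2 * (A + Q * (A + 1)) ≤ Q * m / t ^ 2 * (A * (1 + 2 * Q)) := by gcongr
        _ = 1 / m * (Q * (A * (1 + 2 * Q)) * (m / t * (m / t))) := by field_simp
        _ ≤ 1 / m * (Q * (A * (1 + 2 * Q)) * (1 / C * 1)) := by gcongr
        _ ≤ 1 / m * (A / 96) := by
          gcongr
          rw [mul_one, mul_one_div, div_le_div_iff₀ hCpos (by norm_num)]
          nlinarith
    have s5 : 3 / 2 * θ / t ≤ 1 / m * (1 / 192) := by
      calc 3 / 2 * θ / t = 1 / m * (3 / 2 * θ * (m / t)) := by field_simp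
        _ ≤ 1 / m * (3 / 2 * θ * (1 / C)) := by gcongr
        _ ≤ _ := by
          gcongr
          rw [mul_one_div, div_le_div_iff₀ hCpos (by norm_num)]; linarith
    have s6 := mul_le_mul_of_nonneg_left hsucc hA0
    have s7 := mul_le_mul_of_nonneg_right s4 hE0.le
    have s8 := mul_le_mul_of_nonneg_right s5 (show 0 ≤ A * E by positivity)
    have i2 := h2 k
    rw [← ht] at i2
    refine i2.trans (le_trans ?_ s6)
    have e1 : 1 / (32 * m) = 1 / 32 * (1 / m) := by ring
    rw [e1] at s1
    rw [e1]
    have s9 : 0 ≤ 1 / m * (A * E) := by positivity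
    generalize Q * m / t ^ 2 = y1 at *
    generalize 1 / m = y2 at *
    generalize 3 / 2 * θ / t = y3 at *
    linarith

set_option maxHeartbeats 800000 in
-- Up to time `Cm` the errors grow by a constant factor only, so they fit under the term `n³(m/t)^s`
-- of the envelope. From there the envelope is propagated, and beyond a multiple of `nm` each of its
-- four terms is `O(1/k)`.
theorem exists_transient_bound (θ Q ρ : ℝ) (hθ : 18 < θ) (hQ : 1 ≤ Q) (hρ : ρ ≤ 4 * θ / 3 - 1) :
    ∃ A K : ℝ, 0 < A ∧ 0 < K ∧ ∀ (n m : ℝ), 1 ≤ n → 1 ≤ m → m ≤ Q * n ^ ρ →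
      ∀ (a Φ : ℕ → ℝ), (∀ k, 0 ≤ a k) → (∀ k, 0 ≤ Φ k) →
      (∀ k : ℕ, a (k + 1) ≤ (1 - 15 / 8 * θ / (k + m) + Q / (k + m) ^ 2) * a k
        + Q / (k + m) * Φ k + Q / (k + m) ^ 2) →
      (∀ k : ℕ, Φ (k + 1) ≤ (1 - 1 / (32 * m)) * Φ k + Q * m / (k + m) ^ 2 * (Φ k + a k)
        + Q * n / (k + m) ^ 2 + Q * n ^ 3 * m ^ 2 / (k + m) ^ 4) →
      a 0 + Φ 0 ≤ Q * n ^ 3 → ∀ k : ℕ, A * (n * m) ≤ k → a k + Φ k ≤ K / k := by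
  set s : ℝ := 3 / 2 * θ with hs
  obtain ⟨C, hC1, hC2⟩ : ∃ C, 192 * s ≤ C ∧ 96 * Q * (1 + 2 * Q) ≤ C :=
    ⟨_, le_max_left _ _, le_max_right _ _⟩
  -- The first bound dominates the sources, the second the value of the errors at the time `k₁`
  -- where the induction starts.
  obtain ⟨A, hA1, hA2⟩ : ∃ A, 96 * Q ≤ A ∧
      (C + 2) ^ s * (Real.exp (2 * Q * (C + 1)) * (Q + 2)) ≤ A :=
    ⟨_, le_max_left _ _, le_max_right _ _⟩
  have hCpos : 0 < C := by linarith
  have hApos : 0 < A := by linarith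
  refine ⟨C + 1, (Q * (A + 1) + A) * (3 + Q), by linarith, by positivity, ?_⟩
  intro n m hn hm hmn a Φ ha hΦ h1 h2 h0
  have hm0 : 0 < m := by linarith
  have hn0 : 0 < n := by linarith
  set k₁ := ⌈C * m⌉₊ with hk₁
  have hk₁l : C * m ≤ k₁ := Nat.le_ceil _
  have hk₁u : (k₁ : ℝ) ≤ (C + 1) * m := by
    have := (Nat.ceil_lt_add_one (show 0 ≤ C * m by positivity)).le
    linarith
  have base : a k₁ + Φ k₁ ≤ A * envelope n m s (k₁ + m) := by
    have hb := growth_bound (by linarith) hn hm (by linarith) ha hΦ h1 h2 h0 k₁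
    have e1 : Real.exp (2 * Q / m * k₁) ≤ Real.exp (2 * Q * (C + 1)) := by
      apply Real.exp_le_exp.2
      rw [div_mul_eq_mul_div, div_le_iff₀ hm0]
      have := mul_le_mul_of_nonneg_left hk₁u (show 0 ≤ 2 * Q by linarith)
      linarith
    -- Here `k₁ + m ≤ (C + 2) m`, so `(m/(k₁ + m))^s` is bounded below by a constant.
    have e2 : 1 ≤ (C + 2) ^ s * (m ^ s * ((k₁ : ℝ) + m)⁻¹ ^ s) := by
      rw [← Real.mul_rpow hm0.le (by positivity), ← Real.mul_rpow (by linarith) (by positivity)]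
      apply Real.one_le_rpow _ (by linarith)
      rw [← mul_assoc, ← div_eq_mul_inv, one_le_div (by positivity)]
      linarith
    have e3 : n ^ 3 * m ^ s * ((k₁ : ℝ) + m)⁻¹ ^ s ≤ envelope n m s (k₁ + m) := by
      unfold envelope
      have : 0 ≤ ((k₁ : ℝ) + m)⁻¹ ^ (1 : ℝ) + n * m * ((k₁ : ℝ) + m)⁻¹ ^ (2 : ℝ)
        + n ^ 3 * m ^ 3 * ((k₁ : ℝ) + m)⁻¹ ^ (4 : ℝ) := by positivity
      linarith
    set w := m ^ s * ((k₁ : ℝ) + m)⁻¹ ^ s with hw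
    have hw0 : 0 ≤ w := by positivity
    calc a k₁ + Φ k₁ ≤ Real.exp (2 * Q * (C + 1)) * ((Q + 2) * n ^ 3) * 1 := by
          rw [mul_one]; exact hb.trans (by gcongr)
      _ ≤ Real.exp (2 * Q * (C + 1)) * ((Q + 2) * n ^ 3) * ((C + 2) ^ s * w) := by gcongr
      _ = (C + 2) ^ s * (Real.exp (2 * Q * (C + 1)) * (Q + 2)) * (n ^ 3 * w) := by ring
      _ ≤ A * (n ^ 3 * w) := by gcongr
      _ ≤ A * envelope n m s (k₁ + m) := by
          gcongr; rw [hw, ← mul_assoc]; exact e3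
  have envpos : ∀ t : ℝ, 0 < t → 0 ≤ envelope n m s t := fun t ht => by
    unfold envelope; positivity
  have ind : ∀ k, k₁ ≤ k → a k ≤ Q * (A + 1) * envelope n m s (k + m) ∧
      Φ k ≤ A * envelope n m s (k + m) := by
    intro k hk
    induction k, hk using Nat.le_induction with
    | base =>
      have := envpos (k₁ + m) (by positivity)
      constructor
      · have : A * envelope n m s (k₁ + m) ≤ Q * (A + 1) * envelope n m s (k₁ + m) := by
          gcongr; nlinarith
        linarith [hΦ k₁]
      · linarith [ha k₁]
    | succ k hk ih =>
      have : (k₁ : ℝ) ≤ k := by exact_mod_cast hk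
      exact envelope_induction hQ hn hm hθ hC1 hC2 hA1 h1 h2 (by linarith) ih.1 ih.2
  intro k hk
  have hnm : m ≤ n * m := by nlinarith
  have hk' : n * m ≤ k := by nlinarith
  have hk0 : (0 : ℝ) < k := by nlinarith
  have hkk : k₁ ≤ k := by
    have : (k₁ : ℝ) ≤ k := by nlinarith
    exact_mod_cast this
  obtain ⟨i1, i2⟩ := ind k hkk
  have hinv : ((k : ℝ) + m)⁻¹ ≤ (k : ℝ)⁻¹ := by gcongr; linarith
  have hnk : n * m * (k : ℝ)⁻¹ ≤ 1 := by
    rw [← div_eq_mul_inv, div_le_one hk0]; exact hk'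
  have env : envelope n m s (k + m) ≤ (3 + Q) * (k : ℝ)⁻¹ := by
    have hx : 0 ≤ (k : ℝ)⁻¹ := by positivity
    have mono : ∀ j : ℝ, 0 ≤ j → ((k : ℝ) + m)⁻¹ ^ j ≤ (k : ℝ)⁻¹ ^ j := fun j hj => by gcongr
    have q1 := mono 1 (by norm_num)
    have q2 := mul_le_mul_of_nonneg_left (mono 2 (by norm_num)) (show 0 ≤ n * m by positivity)
    have q4 := mul_le_mul_of_nonneg_left (mono 4 (by norm_num))
      (show 0 ≤ n ^ 3 * m ^ 3 by positivity)
    have qs := mul_le_mul_of_nonneg_left (mono s (by linarith))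
      (show 0 ≤ n ^ 3 * m ^ s by positivity)
    set x := (k : ℝ)⁻¹ with hxd
    have r1 : x ^ (1 : ℝ) = x := Real.rpow_one x
    have r2 : n * m * x ^ (2 : ℝ) ≤ x := by
      rw [show (2 : ℝ) = ((2 : ℕ) : ℝ) by norm_num, Real.rpow_natCast]
      nlinarith
    have r4 : n ^ 3 * m ^ 3 * x ^ (4 : ℝ) ≤ x := by
      rw [show (4 : ℝ) = ((4 : ℕ) : ℝ) by norm_num, Real.rpow_natCast]
      calc n ^ 3 * m ^ 3 * x ^ 4 = (n * m * x) ^ 3 * x := by ring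
        _ ≤ 1 ^ 3 * x := by gcongr
        _ = x := by ring
    have rs : n ^ 3 * m ^ s * x ^ s ≤ Q * x := by
      have hmx : m * x ≤ n⁻¹ := by
        rw [le_inv_comm₀ (by positivity) hn0]
        rw [← one_div, le_div_iff₀ (by positivity)]; linarith
      have e1 : (m * x) ^ s = (m * x) * (m * x) ^ (s - 1) := by
        rw [← Real.rpow_one_add' (by positivity) (by linarith)]; congr 1; ring
      have e2 : (m * x) ^ (s - 1) ≤ n⁻¹ ^ (s - 1) := by gcongr; linarith
      -- One factor `m` of `m^s` is bounded by `Q n^ρ`, the other `s - 1` factors use `m/k ≤ 1/n`.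
      -- The remaining exponent `3 + ρ - (s - 1)` is nonpositive because `4θ/3 - 1 ≤ 3θ/2 - 4` holds
      -- exactly for `θ ≥ 18`.
      have e3 : n ^ 3 * (n ^ ρ * n⁻¹ ^ (s - 1)) ≤ 1 := by
        rw [Real.inv_rpow hn0.le, ← Real.rpow_neg hn0.le, ← Real.rpow_add hn0,
          ← Real.rpow_natCast, ← Real.rpow_add hn0]
        apply Real.rpow_le_one_of_one_le_of_nonpos hn
        push_cast
        linarith
      calc n ^ 3 * m ^ s * x ^ s = n ^ 3 * (m * x) ^ s := by
            rw [Real.mul_rpow hm0.le hx]; ring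
        _ = n ^ 3 * ((m * x) * (m * x) ^ (s - 1)) := by rw [e1]
        _ ≤ n ^ 3 * ((Q * n ^ ρ * x) * n⁻¹ ^ (s - 1)) := by gcongr
        _ = Q * x * (n ^ 3 * (n ^ ρ * n⁻¹ ^ (s - 1))) := by ring
        _ ≤ Q * x * 1 := by gcongr
        _ = Q * x := by ring
    refine (add_le_add (add_le_add (add_le_add q1 q2) q4) qs).trans ?_
    rw [r1]
    linarith
  have := mul_le_mul_of_nonneg_left env (show 0 ≤ Q * (A + 1) + A by positivity)
  rw [div_eq_mul_inv]
  linarith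

/-! ### One iteration in a Hilbert space -/

theorem norm_add_sq_le_young {E : Type*} [NormedAddCommGroup E] (x y : E) {τ : ℝ} (hτ : 0 < τ) :
    ‖x + y‖ ^ 2 ≤ (1 + τ) * ‖x‖ ^ 2 + (1 + 1 / τ) * ‖y‖ ^ 2 := by
  have h1 : ‖x + y‖ ≤ ‖x‖ + ‖y‖ := norm_add_le x y
  have h2 : ‖x + y‖ ^ 2 ≤ (‖x‖ + ‖y‖) ^ 2 := by gcongr
  have h3 : 0 ≤ (τ * ‖x‖ - ‖y‖) ^ 2 / τ := by positivity
  have h4 : (τ * ‖x‖ - ‖y‖) ^ 2 / τ = τ * ‖x‖ ^ 2 + 1 / τ * ‖y‖ ^ 2 - 2 * ‖x‖ * ‖y‖ := by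
    field_simp; ring
  nlinarith

theorem norm_add₃_sq_le {E : Type*} [NormedAddCommGroup E] (x y z : E) :
    ‖x + y + z‖ ^ 2 ≤ 3 * (‖x‖ ^ 2 + ‖y‖ ^ 2 + ‖z‖ ^ 2) := by
  have h1 : ‖x + y + z‖ ≤ ‖x‖ + ‖y‖ + ‖z‖ := norm_add₃_le
  have h2 : ‖x + y + z‖ ^ 2 ≤ (‖x‖ + ‖y‖ + ‖z‖) ^ 2 := by gcongr
  nlinarith [sq_nonneg (‖x‖ - ‖y‖), sq_nonneg (‖y‖ - ‖z‖), sq_nonneg (‖x‖ - ‖z‖)]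

section Hilbert

variable {E : Type*} [NormedAddCommGroup E] [InnerProductSpace ℝ E]

local notation "⟪" x ", " y "⟫" => inner ℝ x y

/-- The averaging projection `J`, the scaled Laplacian `M = (γ/2)(1 - W)` and a symmetric
pseudo-inverse `B` of `M`. -/
structure MixingOps (J M B : E →L[ℝ] E) (lam γ : ℝ) : Prop where
  J_symm : ∀ x y, ⟪J x, y⟫ = ⟪x, J y⟫
  J_idem : ∀ x, J (J x) = J x
  M_symm : ∀ x y, ⟪M x, y⟫ = ⟪x, M y⟫
  B_symm : ∀ x y, ⟪B x, y⟫ = ⟪x, B y⟫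
  JM : ∀ x, J (M x) = 0
  MJ : ∀ x, M (J x) = 0
  BM : ∀ x, B (M x) = x - J x
  MB : ∀ x, M (B x) = x - J x
  gap : ∀ x, lam * ‖x - J x‖ ^ 2 ≤ ⟪x, M x⟫
  M_sq : ∀ x, ‖M x‖ ^ 2 ≤ γ * ⟪x, M x⟫
  M_le : ∀ x, ⟪x, M x⟫ ≤ γ * ‖x‖ ^ 2

namespace MixingOps

variable {J M B : E →L[ℝ] E} {lam γ : ℝ}

theorem inner_J_left (h : MixingOps J M B lam γ) (x y : E) : ⟪J x, J y⟫ = ⟪x, J y⟫ := by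
  rw [h.J_symm, h.J_idem]

theorem norm_sq_eq (h : MixingOps J M B lam γ) (x : E) :
    ‖x‖ ^ 2 = ‖J x‖ ^ 2 + ‖x - J x‖ ^ 2 := by
  rw [norm_sub_sq_real, ← real_inner_self_eq_norm_sq (J x), h.inner_J_left]; ring

theorem norm_J_sq_le (h : MixingOps J M B lam γ) (x : E) : ‖J x‖ ^ 2 ≤ ‖x‖ ^ 2 := by
  rw [h.norm_sq_eq x]; linarith [sq_nonneg ‖x - J x‖]

theorem norm_compl_sq_le (h : MixingOps J M B lam γ) (x : E) : ‖x - J x‖ ^ 2 ≤ ‖x‖ ^ 2 := by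
  rw [h.norm_sq_eq x]; linarith [sq_nonneg ‖J x‖]

theorem M_nonneg (h : MixingOps J M B lam γ) (hlam : 0 ≤ lam) (x : E) : 0 ≤ ⟪x, M x⟫ :=
  le_trans (by positivity) (h.gap x)

/-- Apply the gap inequality to `B v`, for which `M (B v) = v`, and Cauchy–Schwarz to the part of `B
v` without mean. -/
theorem B_lower (h : MixingOps J M B lam γ) (hlam : 0 < lam) {v : E} (hv : J v = 0) :
    lam * ⟪v, B v⟫ ≤ ‖v‖ ^ 2 := by
  have e : M (B v) = v := by rw [h.MB, hv, sub_zero]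
  have g := h.gap (B v)
  rw [e, real_inner_comm] at g
  have i : ⟪v, B v⟫ = ⟪v, B v - J (B v)⟫ := by
    rw [inner_sub_right, ← h.J_symm, hv, inner_zero_left, sub_zero]
  have cs : ⟪v, B v - J (B v)⟫ ≤ ‖v‖ * ‖B v - J (B v)‖ := real_inner_le_norm _ _
  rw [← i] at cs
  have : 0 ≤ (‖v‖ - lam * ‖B v - J (B v)‖) ^ 2 := sq_nonneg _
  nlinarith

theorem B_upper (h : MixingOps J M B lam γ) {v : E} (hv : J v = 0) :
    ‖v‖ ^ 2 ≤ γ * ⟪v, B v⟫ := by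
  have e : M (B v) = v := by rw [h.MB, hv, sub_zero]
  have g := h.M_sq (B v)
  rwa [e, real_inner_comm] at g

theorem B_nonneg (h : MixingOps J M B lam γ) (hγ : 0 < γ) {v : E} (hv : J v = 0) :
    0 ≤ ⟪v, B v⟫ := by
  have := h.B_upper hv
  have h2 := sq_nonneg ‖v‖
  by_contra hc
  push Not at hc
  nlinarith

/-- The form of `B` is nonnegative on vectors of zero mean; evaluate it at `τ v - w`. -/
theorem B_young (h : MixingOps J M B lam γ) (hγ : 0 < γ) {v w : E} (hv : J v = 0)
    (hw : J w = 0) {τ : ℝ} (hτ : 0 < τ) :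
    ⟪v + w, B (v + w)⟫ ≤ (1 + τ) * ⟪v, B v⟫ + (1 + 1 / τ) * ⟪w, B w⟫ := by
  have k := h.B_nonneg hγ (v := τ • v - w) (by simp [hv, hw])
  have s : ⟪w, B v⟫ = ⟪v, B w⟫ := by rw [← h.B_symm, real_inner_comm]
  have k' : 0 ≤ τ ^ 2 * ⟪v, B v⟫ - 2 * τ * ⟪v, B w⟫ + ⟪w, B w⟫ := by
    have : ⟪τ • v - w, B (τ • v - w)⟫ = τ ^ 2 * ⟪v, B v⟫ - 2 * τ * ⟪v, B w⟫ + ⟪w, B w⟫ := by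
      simp only [map_sub, map_smul, inner_sub_left, inner_sub_right, inner_smul_left,
        inner_smul_right, s, conj_trivial]
      ring
    rwa [this] at k
  have e : ⟪v + w, B (v + w)⟫ = ⟪v, B v⟫ + 2 * ⟪v, B w⟫ + ⟪w, B w⟫ := by
    simp only [map_add, inner_add_left, inner_add_right, s]; ring
  have k2 : 0 ≤ (τ ^ 2 * ⟪v, B v⟫ - 2 * τ * ⟪v, B w⟫ + ⟪w, B w⟫) / τ := by positivity
  have k3 : (τ ^ 2 * ⟪v, B v⟫ - 2 * τ * ⟪v, B w⟫ + ⟪w, B w⟫) / τ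
      = τ * ⟪v, B v⟫ - 2 * ⟪v, B w⟫ + 1 / τ * ⟪w, B w⟫ := by field_simp
  rw [e]
  linarith

/-- The energy identity for one primal-dual mixing step with perturbation `e`. -/
theorem energy_eq (h : MixingOps J M B lam γ) {v : E} (hv : J v = 0) (z e : E) :
    ‖(z - M (z + e)) - J (z - M (z + e))‖ ^ 2 + ⟪v + M (z + e), B (v + M (z + e))⟫
      = ‖(z + v) - J (z + v)‖ ^ 2 + ⟪v, B v⟫ - ‖v‖ ^ 2 - ⟪z, M z⟫ + ‖M z‖ ^ 2
        + ‖M e‖ ^ 2 + ⟪e, M e⟫ + 2 * ⟪e, v⟫ + 2 * ⟪e, M (M z)⟫ := by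
  have e1 : (z - M (z + e)) - J (z - M (z + e)) = (z - J z) - M z - M e := by
    simp only [map_sub, map_add, h.JM]; abel
  have e2 : (z + v) - J (z + v) = (z - J z) + v := by
    simp only [map_add, hv]; abel
  have jm : ∀ x, ⟪J z, M x⟫ = 0 := fun x => by rw [h.J_symm, h.JM, inner_zero_right]
  have jv : ⟪J z, v⟫ = 0 := by rw [h.J_symm, hv, inner_zero_right]
  have bv : ∀ x, ⟪M x, B v⟫ = ⟪x, v⟫ := fun x => by
    rw [h.M_symm, h.MB, hv, sub_zero]
  have n1 : ‖(z - J z) - M z - M e‖ ^ 2 = ‖z - J z‖ ^ 2 - 2 * ⟪z, M z⟫ - 2 * ⟪z, M e⟫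
      + ‖M z‖ ^ 2 + ‖M e‖ ^ 2 + 2 * ⟪M z, M e⟫ := by
    rw [sub_sub, norm_sub_sq_real, norm_add_sq_real, inner_add_right, inner_sub_left,
      inner_sub_left, jm, jm]
    ring
  have n2 : ‖(z - J z) + v‖ ^ 2 = ‖z - J z‖ ^ 2 + 2 * ⟪z, v⟫ + ‖v‖ ^ 2 := by
    rw [norm_add_sq_real, inner_sub_left, jv, sub_zero]
  have mm : ∀ x y, ⟪M x, y - J y⟫ = ⟪x, M y⟫ := fun x y => by
    rw [h.M_symm, map_sub, h.MJ, sub_zero]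
  -- Since `B M = 1 - J`, the cross term here is `2⟪z, v⟫`, the same as in `n2`. It cancels from the
  -- identity, which is the reason for measuring the dual error with `B`.
  have n3 : ⟪v + M (z + e), B (v + M (z + e))⟫ = ⟪v, B v⟫ + 2 * ⟪z, v⟫ + 2 * ⟪e, v⟫
      + ⟪z, M z⟫ + 2 * ⟪z, M e⟫ + ⟪e, M e⟫ := by
    have c1 : ⟪v, B (M (z + e))⟫ = ⟪z, v⟫ + ⟪e, v⟫ := by
      rw [← h.B_symm, real_inner_comm, bv, inner_add_left]
    have c2 : ⟪M (z + e), B (M (z + e))⟫ = ⟪z, M z⟫ + 2 * ⟪z, M e⟫ + ⟪e, M e⟫ := by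
      rw [h.BM, mm, map_add, inner_add_left, inner_add_right, inner_add_right, ← h.M_symm e z,
        real_inner_comm z (M e)]
      ring
    have c3 : ⟪M (z + e), B v⟫ = ⟪z, v⟫ + ⟪e, v⟫ := by rw [bv, inner_add_left]
    rw [map_add B, inner_add_left, inner_add_right, inner_add_right, c1, c2, c3]
    ring
  have n4 : ⟪M z, M e⟫ = ⟪e, M (M z)⟫ := by rw [← h.M_symm, real_inner_comm]
  rw [e1, e2, n1, n2, n3, n4]
  ring

/-- The loss `-‖v‖²` is split: a part `lam/4` serves, with the spectral gap, to contract the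
consensus term, the rest contracts the dual term through `B_lower`. Of `-⟪z, M z⟫` one quarter is
deliberately left over; it pays later for the motion of the reference point. -/
theorem energy_le (h : MixingOps J M B lam γ) (hlam : 0 < lam) (hlam1 : lam ≤ 1) (hγ : 0 < γ)
    (hγ1 : γ ≤ 1 / 2) {v z e : E} (hv : J v = 0) (hev : ⟪e, v⟫ = 0)
    (hez : ⟪e, M (M z)⟫ = 0) :
    ‖(z - M (z + e)) - J (z - M (z + e))‖ ^ 2 + ⟪v + M (z + e), B (v + M (z + e))⟫
      ≤ (1 - lam / 8) * ‖(z + v) - J (z + v)‖ ^ 2 + (1 - lam / 2) * ⟪v, B v⟫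
        - 1 / 4 * ⟪z, M z⟫ + 2 * γ * ‖e‖ ^ 2 := by
  rw [h.energy_eq hv, hev, hez]
  have z0 := h.M_nonneg hlam.le z
  have e0 := h.M_nonneg hlam.le e
  have m1 := h.M_sq z
  have m2 := h.M_sq e
  have m3 := h.M_le e
  have g := h.gap z
  have b := h.B_lower hlam hv
  have b0 := h.B_nonneg hγ hv
  have s : ‖(z + v) - J (z + v)‖ ^ 2 ≤ 2 * ‖z - J z‖ ^ 2 + 2 * ‖v‖ ^ 2 := by
    have e2 : (z + v) - J (z + v) = (z - J z) + v := by simp only [map_add, hv]; abel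
    rw [e2]
    have := norm_add_sq_le_young (z - J z) v one_pos
    norm_num at this
    linarith
  have p1 : ‖M z‖ ^ 2 ≤ 1 / 2 * ⟪z, M z⟫ := m1.trans (by gcongr)
  have p2 : ‖M e‖ ^ 2 ≤ ⟪e, M e⟫ := m2.trans (by nlinarith)
  have p3 := mul_le_mul_of_nonneg_left s hlam.le
  have p4 := mul_le_mul_of_nonneg_left b (show 0 ≤ 1 - lam / 4 by linarith)
  have p5 : lam * lam * ⟪v, B v⟫ ≤ lam * 1 * ⟪v, B v⟫ := by gcongr
  nlinarith

/-- The local gradient step, seen from the consensus error. -/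
theorem gradient_step_le (h : MixingOps J M B lam γ) (hlam : 0 < lam) (hlam1 : lam ≤ 1)
    {u G ε : E} {L η : ℝ} (hG : ‖G‖ ≤ L * ‖u‖)
    (h1 : ⟪ε, u⟫ = 0) (h2 : ⟪ε, J u⟫ = 0) (h3 : ⟪ε, G⟫ = 0) (h4 : ⟪ε, J G⟫ = 0) :
    ‖(u - η • (G + ε)) - J (u - η • (G + ε))‖ ^ 2
      ≤ (1 + lam / 16) * ‖u - J u‖ ^ 2 + 17 / lam * (η ^ 2 * L ^ 2 * ‖u‖ ^ 2)
        + η ^ 2 * ‖ε‖ ^ 2 := by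
  set w := (u - J u) + -(η • (G - J G)) with hw
  have e1 : (u - η • (G + ε)) - J (u - η • (G + ε)) = w - η • (ε - J ε) := by
    simp only [hw, map_sub, map_smul, map_add, smul_add, smul_sub]; abel
  have jw : J w = 0 := by
    simp only [hw, map_add, map_sub, map_neg, map_smul, h.J_idem, sub_self, smul_zero, neg_zero,
      add_zero]
  have o : ⟪w, ε - J ε⟫ = 0 := by
    rw [inner_sub_right, ← h.J_symm, jw, inner_zero_left, sub_zero, real_inner_comm, hw]
    simp only [inner_add_right, inner_sub_right, inner_neg_right, inner_smul_right, h1, h2, h3, h4]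
    ring
  have n1 : ‖w - η • (ε - J ε)‖ ^ 2 = ‖w‖ ^ 2 + η ^ 2 * ‖ε - J ε‖ ^ 2 := by
    rw [norm_sub_sq_real, inner_smul_right, o, norm_smul, mul_pow, Real.norm_eq_abs, sq_abs]
    ring
  -- The weight `lam/16` is half of the contraction `lam/8` of `energy_le`, so half of that
  -- contraction survives.
  have n2 := norm_add_sq_le_young (u - J u) (-(η • (G - J G))) (show 0 < lam / 16 by positivity)
  have n3 : ‖-(η • (G - J G))‖ ^ 2 ≤ η ^ 2 * L ^ 2 * ‖u‖ ^ 2 := by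
    rw [norm_neg, norm_smul, mul_pow, Real.norm_eq_abs, sq_abs, mul_assoc]
    gcongr
    refine (h.norm_compl_sq_le G).trans ?_
    rw [← mul_pow]; gcongr
  have n4 : η ^ 2 * ‖ε - J ε‖ ^ 2 ≤ η ^ 2 * ‖ε‖ ^ 2 := by
    gcongr 1; exact h.norm_compl_sq_le ε
  have n5 : 1 + 1 / (lam / 16) ≤ 17 / lam := by
    rw [le_div_iff₀ hlam]; field_simp; linarith
  have n6 : (1 + 1 / (lam / 16)) * ‖-(η • (G - J G))‖ ^ 2
      ≤ 17 / lam * (η ^ 2 * L ^ 2 * ‖u‖ ^ 2) := by gcongr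
  rw [e1, n1]
  rw [← hw] at n2
  linarith

/-- The gradient step of the network average. -/
theorem mean_step_le (h : MixingOps J M B lam γ) {x xs G Gb ε : E} {L μ η : ℝ} (hμ : 0 < μ)
    (hη : 0 < η) (hημ : η * μ ≤ 1) (hxs : J xs = xs)
    (hGb : ‖G - Gb‖ ≤ L * ‖x - J x‖) (hGbs : ‖J Gb‖ ≤ L * ‖J x - xs‖)
    (hmono : μ * ‖J x - xs‖ ^ 2 ≤ ⟪J Gb, J x - xs⟫)
    (h2 : ⟪ε, J (x - xs)⟫ = 0) (h4 : ⟪ε, J G⟫ = 0) :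
    ‖J (x - xs) - η • J (G + ε)‖ ^ 2
      ≤ (1 - 15 / 8 * (η * μ) + 2 * (η ^ 2 * L ^ 2)) * ‖J (x - xs)‖ ^ 2
        + 9 * (η * L ^ 2 / μ) * ‖x - J x‖ ^ 2 + η ^ 2 * ‖J ε‖ ^ 2 := by
  have jx : J (x - xs) = J x - xs := by rw [map_sub, hxs]
  rw [jx] at h2 ⊢
  set w := (J x - xs) - η • J G with hw
  have e1 : J x - xs - η • J (G + ε) = w - η • J ε := by
    simp only [hw, map_add, smul_add]; abel
  have jj : J (J x - xs) = J x - xs := by rw [map_sub, h.J_idem, hxs]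
  have o : ⟪w, J ε⟫ = 0 := by
    rw [← h.J_symm, real_inner_comm, hw, map_sub, jj, map_smul, h.J_idem, inner_sub_right,
      inner_smul_right, h2, h4]
    ring
  have n1 : ‖w - η • J ε‖ ^ 2 = ‖w‖ ^ 2 + η ^ 2 * ‖J ε‖ ^ 2 := by
    rw [norm_sub_sq_real, inner_smul_right, o, norm_smul, mul_pow, Real.norm_eq_abs, sq_abs]
    ring
  have e2 : w = ((J x - xs) - η • J Gb) + -(η • J (G - Gb)) := by
    simp only [hw, map_sub, smul_sub]; abel
  -- Strong monotonicity contracts by `2ημ`; this Young weight spends `ημ/8` on the disagreement of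
  -- the agents and leaves `15/8 ημ`.
  have hτ : 0 < η * μ / 8 := by positivity
  have n2 := norm_add_sq_le_young ((J x - xs) - η • J Gb) (-(η • J (G - Gb))) hτ
  have n3 : ‖(J x - xs) - η • J Gb‖ ^ 2
      ≤ (1 - 2 * (η * μ) + η ^ 2 * L ^ 2) * ‖J x - xs‖ ^ 2 := by
    rw [norm_sub_sq_real, inner_smul_right, norm_smul, mul_pow, Real.norm_eq_abs, sq_abs,
      real_inner_comm]
    have k1 : ‖J Gb‖ ^ 2 ≤ L ^ 2 * ‖J x - xs‖ ^ 2 := by rw [← mul_pow]; gcongr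
    have k2 := mul_le_mul_of_nonneg_left k1 (sq_nonneg η)
    have k3 := mul_le_mul_of_nonneg_left hmono hη.le
    linarith
  have n4 : ‖-(η • J (G - Gb))‖ ^ 2 ≤ η ^ 2 * (L ^ 2 * ‖x - J x‖ ^ 2) := by
    rw [norm_neg, norm_smul, mul_pow, Real.norm_eq_abs, sq_abs]
    gcongr
    refine (h.norm_J_sq_le _).trans ?_
    rw [← mul_pow]; gcongr
  have n5 : (1 + 1 / (η * μ / 8)) * ‖-(η • J (G - Gb))‖ ^ 2
      ≤ 9 * (η * L ^ 2 / μ) * ‖x - J x‖ ^ 2 := by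
    calc (1 + 1 / (η * μ / 8)) * ‖-(η • J (G - Gb))‖ ^ 2
        ≤ (1 + 1 / (η * μ / 8)) * (η ^ 2 * (L ^ 2 * ‖x - J x‖ ^ 2)) := by gcongr
      _ = (η * μ + 8) * (η * L ^ 2 / μ * ‖x - J x‖ ^ 2) := by field_simp
      _ ≤ (1 + 8) * (η * L ^ 2 / μ * ‖x - J x‖ ^ 2) := by gcongr
      _ = _ := by ring
  have n6 : (1 + η * μ / 8) * ‖(J x - xs) - η • J Gb‖ ^ 2
      ≤ (1 - 15 / 8 * (η * μ) + 2 * (η ^ 2 * L ^ 2)) * ‖J x - xs‖ ^ 2 := by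
    refine (mul_le_mul_of_nonneg_left n3 (by positivity)).trans ?_
    rw [← mul_assoc]
    apply mul_le_mul_of_nonneg_right _ (sq_nonneg _)
    have : 0 ≤ η * μ := by positivity
    have : η * μ * (η ^ 2 * L ^ 2) ≤ 1 * (η ^ 2 * L ^ 2) := by gcongr
    nlinarith [sq_nonneg (η * μ), sq_nonneg (η * L)]
  rw [e1, n1]
  rw [← e2] at n2
  linarith

/-- One step of the compression reference point `h`, where `r = Y - h`, `s = Y' - Y`. -/
theorem reference_step_le {r e s : E} {α c : ℝ} (hα : 0 < α) (hα1 : α ≤ 1)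
    (hc : 12 * c * α = 1) (he : ‖e‖ ^ 2 ≤ c * ‖r‖ ^ 2) (her : ⟪e, r⟫ = 0) :
    ‖((1 - α) • r - α • e) + s‖ ^ 2 ≤ (1 - 5 / 12 * α) * ‖r‖ ^ 2 + 3 / α * ‖s‖ ^ 2 := by
  have n1 := norm_add_sq_le_young ((1 - α) • r - α • e) s (show 0 < α / 2 by positivity)
  have n2 : ‖(1 - α) • r - α • e‖ ^ 2 = (1 - α) ^ 2 * ‖r‖ ^ 2 + α ^ 2 * ‖e‖ ^ 2 := by
    rw [norm_sub_sq_real, inner_smul_left, inner_smul_right, real_inner_comm, her, norm_smul,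
      norm_smul, mul_pow, mul_pow, Real.norm_eq_abs, Real.norm_eq_abs, sq_abs, sq_abs]
    ring
  -- The choice `12cα = 1` reduces the compression error `α²c‖r‖²` to `α/12 ‖r‖²`, a small part of
  -- what the relaxation by `α` gains.
  have n3 : ‖(1 - α) • r - α • e‖ ^ 2 ≤ (1 - 11 / 12 * α) * ‖r‖ ^ 2 := by
    rw [n2]
    have k1 := mul_le_mul_of_nonneg_left he (sq_nonneg α)
    have k2 : α ^ 2 * (c * ‖r‖ ^ 2) = α / 12 * ‖r‖ ^ 2 := by
      calc α ^ 2 * (c * ‖r‖ ^ 2) = α / 12 * (12 * c * α) * ‖r‖ ^ 2 := by ring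
        _ = _ := by rw [hc]; ring
    have k3 : (1 - α) ^ 2 * ‖r‖ ^ 2 ≤ (1 - α) * ‖r‖ ^ 2 := by
      apply mul_le_mul_of_nonneg_right _ (sq_nonneg _); nlinarith
    linarith
  have n4 := mul_le_mul_of_nonneg_left n3 (show 0 ≤ 1 + α / 2 by positivity)
  have n5 : (1 + 1 / (α / 2)) * ‖s‖ ^ 2 ≤ 3 / α * ‖s‖ ^ 2 := by
    apply mul_le_mul_of_nonneg_right _ (sq_nonneg _)
    rw [le_div_iff₀ hα]; field_simp; linarith
  have n6 : (1 + α / 2) * (1 - 11 / 12 * α) ≤ 1 - 5 / 12 * α := by nlinarith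
  have n7 := mul_le_mul_of_nonneg_right n6 (sq_nonneg ‖r‖)
  linarith

end MixingOps

end Hilbert

/-! ### The algorithm in a Hilbert space and its Lyapunov function -/

section Hilbert

variable {E : Type*} [NormedAddCommGroup E] [InnerProductSpace ℝ E]

local notation "⟪" x ", " y "⟫" => inner ℝ x y

/-- The vectors `y = x - η g - d` that are compressed, with `g = G + ε` the sampled gradients. -/
def target (X D G ε : ℕ → E) (η : ℕ → ℝ) (k : ℕ) : E := X k - η k • (G k + ε k) - D k

/-- The iteration in the Hilbert space of square integrable network states, with gradients `G`,
gradients at the average `Gb`, gradient noise `ε` and compression errors `e`. -/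
structure Iteration (J M : E →L[ℝ] E) (α c L μ σ N : ℝ) (η : ℕ → ℝ)
    (X D h G Gb ε e : ℕ → E) (xs Gs : E) : Prop where
  X_succ : ∀ k, X (k + 1) = target X D G ε η k - M (target X D G ε η k + e k)
  D_succ : ∀ k, D (k + 1) = D k + M (target X D G ε η k + e k)
  h_succ : ∀ k, h (k + 1) = h k + α • (target X D G ε η k - h k + e k)
  D_zero : D 0 = 0
  J_xs : J xs = xs
  J_Gs : J Gs = 0
  lip : ∀ k, ‖G k - Gs‖ ≤ L * ‖X k - xs‖
  lip_mean : ∀ k, ‖G k - Gb k‖ ≤ L * ‖X k - J (X k)‖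
  lip_average : ∀ k, ‖J (Gb k)‖ ≤ L * ‖J (X k) - xs‖
  mono : ∀ k, μ * ‖J (X k) - xs‖ ^ 2 ≤ ⟪J (Gb k), J (X k) - xs⟫
  noise : ∀ k, ‖ε k‖ ^ 2 ≤ N * σ ^ 2
  noise_mean : ∀ k, ‖J (ε k)‖ ^ 2 ≤ σ ^ 2
  compression : ∀ k, ‖e k‖ ^ 2 ≤ c * ‖target X D G ε η k - h k‖ ^ 2
  noise_X : ∀ k, ⟪ε k, X k - xs⟫ = 0
  noise_JX : ∀ k, ⟪ε k, J (X k - xs)⟫ = 0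
  noise_G : ∀ k, ⟪ε k, G k - Gs⟫ = 0
  noise_JG : ∀ k, ⟪ε k, J (G k - Gs)⟫ = 0
  comp_D : ∀ k, ⟪e k, D k⟫ = 0
  comp_Gs : ∀ k, ⟪e k, Gs⟫ = 0
  comp_MM : ∀ k, ⟪e k, M (M (target X D G ε η k - xs))⟫ = 0
  comp_self : ∀ k, ⟪e k, target X D G ε η k - h k⟫ = 0

/-- The Lyapunov function of the consensus, dual and compression errors. -/
noncomputable def lyapunov (J B : E →L[ℝ] E) (γ α : ℝ) (η : ℕ → ℝ) (X D h G ε : ℕ → E)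
    (Gs : E) (k : ℕ) : ℝ :=
  ‖X k - J (X k)‖ ^ 2 + (1 - 9 * γ ^ 2 / α ^ 3) * ⟪D k + η k • Gs, B (D k + η k • Gs)⟫
    + γ / α ^ 2 * ‖target X D G ε η k - h k‖ ^ 2

namespace Iteration

variable {J M B : E →L[ℝ] E} {lam γ α c L μ σ N : ℝ} {η : ℕ → ℝ} {X D h G Gb ε e : ℕ → E}
  {xs Gs : E}

theorem J_D (o : MixingOps J M B lam γ) (p : Iteration J M α c L μ σ N η X D h G Gb ε e xs Gs)
    (k : ℕ) : J (D k) = 0 := by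
  induction k with
  | zero => rw [p.D_zero, map_zero]
  | succ k ih => rw [p.D_succ, map_add, ih, o.JM, add_zero]

theorem J_dual (o : MixingOps J M B lam γ) (p : Iteration J M α c L μ σ N η X D h G Gb ε e xs Gs)
    (k : ℕ) (t : ℝ) : J (D k + t • Gs) = 0 := by
  rw [map_add, p.J_D o, map_smul, p.J_Gs, smul_zero, add_zero]

/-- Averaging annihilates the range of `M` and the dual variable, so neither compression nor the
dual step is visible in the mean: it performs a gradient step with inexact gradients. -/
theorem mean_succ_le (o : MixingOps J M B lam γ)
    (p : Iteration J M α c L μ σ N η X D h G Gb ε e xs Gs) (hμ : 0 < μ) {k : ℕ} (hη : 0 < η k)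
    (hημ : η k * μ ≤ 1) :
    ‖J (X (k + 1) - xs)‖ ^ 2 ≤
      (1 - 15 / 8 * (η k * μ) + 2 * (η k ^ 2 * L ^ 2)) * ‖J (X k - xs)‖ ^ 2
        + 9 * (η k * L ^ 2 / μ) * ‖X k - J (X k)‖ ^ 2 + η k ^ 2 * σ ^ 2 := by
  have h4 : ⟪ε k, J (G k)⟫ = 0 := by
    have := p.noise_JG k
    rwa [map_sub, p.J_Gs, sub_zero] at this
  have key := o.mean_step_le (x := X k) (xs := xs) (G := G k) (Gb := Gb k) (ε := ε k) (L := L)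
    (η := η k) hμ hη hημ p.J_xs (p.lip_mean k) (p.lip_average k) (p.mono k) (p.noise_JX k) h4
  have e1 : J (X (k + 1) - xs) = J (X k - xs) - η k • J (G k + ε k) := by
    rw [p.X_succ, target]
    simp only [map_sub, o.JM, map_smul, p.J_D o]
    abel
  rw [e1]
  have := mul_le_mul_of_nonneg_left (p.noise_mean k) (sq_nonneg (η k))
  linarith

/-- Three estimates are added: the energy of the mixing step, the drift of the dual optimum `-η Gs`
with the stepsize, and the motion of `h` towards `Y`. The weight `γ/α²` lets the gain of the
reference point cover the compression error in the energy. The factor `1 - 9γ²/α³` in the Lyapunov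
function reserves the share of the new dual error that the motion of `Y` produces. The next iterate
occurs on the right because `Y` at time `k + 1` already contains its gradient and noise. -/
theorem lyapunov_succ_le (o : MixingOps J M B lam γ)
    (p : Iteration J M α c L μ σ N η X D h G Gb ε e xs Gs) (hlam : 0 < lam) (hlam1 : lam ≤ 1)
    (hα : 0 < α) (hα1 : α ≤ 1) (hγ : 0 < γ) (hc : 12 * c * α = 1)
    (hγ1 : γ ≤ α ^ 3 / 54) (hγ2 : 54 * γ ^ 2 ≤ lam * α ^ 3) (hlamα : lam ≤ α) (k : ℕ) :
    lyapunov J B γ α η X D h G ε Gs (k + 1) ≤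
      (1 - lam / 32) * lyapunov J B γ α η X D h G ε Gs k
        + 18 / lam * (η k ^ 2 * L ^ 2 * ‖X k - xs‖ ^ 2) + 2 * (η k ^ 2 * (N * σ ^ 2))
        + 1 / 3 * (η (k + 1) ^ 2 * (L ^ 2 * ‖X (k + 1) - xs‖ ^ 2 + N * σ ^ 2))
        + 33 / lam ^ 2 * ((η (k + 1) - η k) ^ 2 * ‖Gs‖ ^ 2) := by
  have hα3 : α ^ 3 ≤ 1 := pow_le_one₀ hα.le hα1
  have hγh : γ ≤ 1 / 54 := by linarith
  set Y := target X D G ε η k with hY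
  set v := D k + η k • Gs with hv
  set z := Y - xs with hz
  set v' := D (k + 1) + η (k + 1) • Gs with hv'
  set vp := v + M (z + e k) with hvp
  set H := ‖Y - h k‖ ^ 2 with hH
  set χ := 9 * γ ^ 2 / α ^ 3 with hχ
  set κ := γ / α ^ 2 with hκ
  have jv : J v = 0 := p.J_dual o k _
  have jv' : J v' = 0 := p.J_dual o (k + 1) _
  have Mxs : M xs = 0 := by rw [← p.J_xs, o.MJ]
  have MY : M (Y + e k) = M (z + e k) := by
    rw [hz]; simp only [map_add, map_sub, Mxs, sub_zero]
  have jvp : J vp = 0 := by rw [hvp, map_add, jv, o.JM, add_zero]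
  have ev : ⟪e k, v⟫ = 0 := by
    rw [hv, inner_add_right, inner_smul_right, p.comp_D, p.comp_Gs]; ring
  have emm : ⟪e k, M (M z)⟫ = 0 := p.comp_MM k
  have en := o.energy_le hlam hlam1 hγ (by linarith) (z := z) jv ev emm
  have ex : z - M (z + e k) - J (z - M (z + e k)) = X (k + 1) - J (X (k + 1)) := by
    rw [p.X_succ, ← hY, MY, hz]; simp only [map_sub, p.J_xs]; abel
  have ez : z + v = (X k - xs) - η k • ((G k - Gs) + ε k) := by
    rw [hz, hv, hY, target]; simp only [smul_add, smul_sub]; abel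
  have gs := o.gradient_step_le hlam hlam1 (u := X k - xs) (G := G k - Gs) (ε := ε k)
    (η := η k) (p.lip k) (p.noise_X k) (p.noise_JX k) (p.noise_G k) (p.noise_JG k)
  have eu : X k - xs - J (X k - xs) = X k - J (X k) := by
    simp only [map_sub, p.J_xs]; abel
  rw [ex, ez] at en
  rw [eu] at gs
  set U := ‖X k - J (X k)‖ ^ 2 with hU
  set U' := ‖X (k + 1) - J (X (k + 1))‖ ^ 2 with hU'
  set S := η k ^ 2 * L ^ 2 * ‖X k - xs‖ ^ 2 with hS
  set V := ⟪v, B v⟫ with hV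
  set V' := ⟪v', B v'⟫ with hV'
  set Z := ⟪z, M z⟫ with hZ
  have hU0 : 0 ≤ U := sq_nonneg _
  have hU'0 : 0 ≤ U' := sq_nonneg _
  have hS0 : 0 ≤ S := by positivity
  have hV0 : 0 ≤ V := o.B_nonneg hγ jv
  have hV'0 : 0 ≤ V' := o.B_nonneg hγ jv'
  have hZ0 : 0 ≤ Z := o.M_nonneg hlam.le z
  have hH0 : 0 ≤ H := sq_nonneg _
  have hNσ : 0 ≤ N * σ ^ 2 := (sq_nonneg _).trans (p.noise k)
  have hκ0 : 0 < κ := by positivity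
  have hχ0 : 0 < χ := by positivity
  -- The dual reserve must cost less than the dual contraction `lam/2`; this is where `54γ² ≤ lam
  -- α³` enters.
  have hχl : χ ≤ lam / 6 := by
    rw [hχ, div_le_div_iff₀ (by positivity) (by norm_num)]; linarith
  have he : ‖e k‖ ^ 2 ≤ c * H := p.compression k
  have hγc : γ * c = κ * (α / 12) := by
    rw [hκ]; field_simp; linarith
  -- the perturbed energy
  have en2 : U' + ⟪vp, B vp⟫ ≤ (1 - lam / 16) * U + (1 - lam / 2) * V + 17 / lam * S
      + η k ^ 2 * (N * σ ^ 2) - 1 / 4 * Z + κ * (α / 6) * H := by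
    have n1 := mul_le_mul_of_nonneg_left gs (show 0 ≤ 1 - lam / 8 by linarith)
    have n2 := mul_le_mul_of_nonneg_left (p.noise k) (sq_nonneg (η k))
    have n3 := mul_le_mul_of_nonneg_left he hγ.le
    have n4 : 0 ≤ 17 / lam * S := by positivity
    have n5 : 0 ≤ η k ^ 2 * ‖ε k‖ ^ 2 := by positivity
    have n6 : γ * (c * H) = κ * (α / 12) * H := by rw [← mul_assoc, hγc]
    have n7 : 0 ≤ lam * (17 / lam * S) := by positivity
    have n8 : 0 ≤ lam * (η k ^ 2 * ‖ε k‖ ^ 2) := by positivity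
    have n9 : 0 ≤ lam * lam * U := by positivity
    linarith
  -- drift of the dual optimum
  have dr : V' ≤ (1 + lam / 32) * ⟪vp, B vp⟫
      + 33 / lam ^ 2 * ((η (k + 1) - η k) ^ 2 * ‖Gs‖ ^ 2) := by
    have jw : J ((η (k + 1) - η k) • Gs) = 0 := by rw [map_smul, p.J_Gs, smul_zero]
    have e1 : v' = vp + (η (k + 1) - η k) • Gs := by
      rw [hv', hvp, hv, p.D_succ, ← hY, MY, sub_smul]; abel
    have y := o.B_young hγ jvp jw (show 0 < lam / 32 by positivity)
    rw [← e1] at y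
    have b := o.B_lower hlam jw
    rw [norm_smul, mul_pow, Real.norm_eq_abs, sq_abs] at b
    have b0 := o.B_nonneg hγ jw
    set w := ⟪(η (k + 1) - η k) • Gs, B ((η (k + 1) - η k) • Gs)⟫ with hw
    have y2 : (1 + 1 / (lam / 32)) * w
        ≤ 33 / lam ^ 2 * ((η (k + 1) - η k) ^ 2 * ‖Gs‖ ^ 2) := by
      calc (1 + 1 / (lam / 32)) * w = (lam + 32) / lam ^ 2 * (lam * w) := by field_simp
        _ ≤ 33 / lam ^ 2 * ((η (k + 1) - η k) ^ 2 * ‖Gs‖ ^ 2) := by gcongr; linarith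
    linarith
  set T := 33 / lam ^ 2 * ((η (k + 1) - η k) ^ 2 * ‖Gs‖ ^ 2) with hT
  have en3 : U' + V' ≤ (1 - lam / 32) * U + (1 - lam / 2 + lam / 32) * V + 18 / lam * S
      + 2 * (η k ^ 2 * (N * σ ^ 2)) - 1 / 4 * Z + κ * (α / 4) * H + T := by
    have n1 := mul_le_mul_of_nonneg_left en2 (show 0 ≤ 1 + lam / 32 by linarith)
    have n2 : 0 ≤ lam * U' := by positivity
    have n3 : lam * (17 / lam * S) = 17 * S := by field_simp
    have n4 : lam * (η k ^ 2 * (N * σ ^ 2)) ≤ 1 * (η k ^ 2 * (N * σ ^ 2)) := by gcongr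
    have n5 : 0 ≤ η k ^ 2 * (N * σ ^ 2) := by positivity
    have n6 : lam * (κ * (α / 6) * H) ≤ 1 * (κ * (α / 6) * H) := by gcongr
    have n7 : 0 ≤ κ * (α / 6) * H := by positivity
    have n8 : 0 ≤ lam * lam * U := by positivity
    have n9 : 0 ≤ lam * lam * V := by positivity
    have n10 : S ≤ 1 / lam * S := by
      apply le_mul_of_one_le_left hS0
      rw [one_le_div hlam]; exact hlam1
    have n11 : 17 / lam * S = 17 * (1 / lam * S) := by ring
    have n12 : 18 / lam * S = 18 * (1 / lam * S) := by ring
    have n13 : 0 ≤ lam * Z := by positivity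
    linarith
  -- the reference point
  have rs : ‖target X D G ε η (k + 1) - h (k + 1)‖ ^ 2 ≤ (1 - 5 / 12 * α) * H
      + 9 / α * (γ * Z + γ ^ 2 * c * H
        + 2 * (η (k + 1) ^ 2 * (L ^ 2 * ‖X (k + 1) - xs‖ ^ 2 + N * σ ^ 2)) + γ * V') := by
    -- `s` is the displacement of `Y` from time `k` to `k + 1`. Written with `v'`, the dual variable
    -- and `Gs` combine, so only quantities that vanish at the optimum remain.
    set s := -(M (z + e k)) + -(η (k + 1) • ((G (k + 1) - Gs) + ε (k + 1))) + -v' with hs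
    have e1 : target X D G ε η (k + 1) - h (k + 1)
        = ((1 - α) • (Y - h k) - α • e k) + s := by
      rw [hs, target, p.X_succ, p.h_succ, ← hY, MY, hv']
      simp only [smul_add, smul_sub, sub_smul, one_smul]
      abel
    have r1 := MixingOps.reference_step_le (s := s) hα hα1 hc he (p.comp_self k)
    have r2 := norm_add₃_sq_le (-(M (z + e k)))
      (-(η (k + 1) • ((G (k + 1) - Gs) + ε (k + 1)))) (-v')
    rw [← hs, norm_neg, norm_neg, norm_neg] at r2
    have r3 : ‖M (z + e k)‖ ^ 2 ≤ γ * Z + γ ^ 2 * c * H := by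
      have i0 : ⟪M z, M (e k)⟫ = 0 := by rw [← o.M_symm, real_inner_comm]; exact emm
      rw [map_add, norm_add_sq_real, i0]
      have i1 := o.M_sq z
      have i2 := o.M_sq (e k)
      have i3 := mul_le_mul_of_nonneg_left (o.M_le (e k)) hγ.le
      have i4 := mul_le_mul_of_nonneg_left he (sq_nonneg γ)
      linarith
    have r4 : ‖η (k + 1) • ((G (k + 1) - Gs) + ε (k + 1))‖ ^ 2
        ≤ 2 * (η (k + 1) ^ 2 * (L ^ 2 * ‖X (k + 1) - xs‖ ^ 2 + N * σ ^ 2)) := by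
      rw [norm_smul, mul_pow, Real.norm_eq_abs, sq_abs]
      have i1 := norm_add_sq_le_young (G (k + 1) - Gs) (ε (k + 1)) one_pos
      norm_num at i1
      have i2 : ‖G (k + 1) - Gs‖ ^ 2 ≤ L ^ 2 * ‖X (k + 1) - xs‖ ^ 2 := by
        rw [← mul_pow]; have := p.lip (k + 1); gcongr
      have i3 := p.noise (k + 1)
      have := mul_le_mul_of_nonneg_left (show ‖G (k + 1) - Gs + ε (k + 1)‖ ^ 2 ≤
        2 * (L ^ 2 * ‖X (k + 1) - xs‖ ^ 2 + N * σ ^ 2) by linarith) (sq_nonneg (η (k + 1)))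
      linarith
    have r5 : ‖v'‖ ^ 2 ≤ γ * V' := o.B_upper jv'
    rw [e1]
    refine r1.trans ?_
    refine add_le_add le_rfl ?_
    calc 3 / α * ‖s‖ ^ 2 ≤ 3 / α * (3 * (γ * Z + γ ^ 2 * c * H
        + 2 * (η (k + 1) ^ 2 * (L ^ 2 * ‖X (k + 1) - xs‖ ^ 2 + N * σ ^ 2)) + γ * V')) := by
          gcongr; linarith
      _ = _ := by ring
  set R := η (k + 1) ^ 2 * (L ^ 2 * ‖X (k + 1) - xs‖ ^ 2 + N * σ ^ 2) with hR
  have hR0 : 0 ≤ R := by positivity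
  set H' := ‖target X D G ε η (k + 1) - h (k + 1)‖ ^ 2 with hH'
  -- After weighting, `κ (9/α) γ` equals `χ`: the term in `Z` is covered by the quarter kept in
  -- `energy_le`, the term in `V'` by the reserve in the Lyapunov function.
  have rs2 : κ * H' ≤ κ * (1 - α / 3) * H + χ * Z + χ * V' + 1 / 3 * R := by
    have n1 := mul_le_mul_of_nonneg_left rs hκ0.le
    have n2 : κ * (9 / α) * γ = χ := by rw [hκ, hχ]; field_simp
    have n3 : κ * (9 / α) * (γ ^ 2 * c) ≤ κ * (α / 12) := by
      have : κ * (9 / α) * (γ ^ 2 * c) = χ * (κ * (α / 12)) := by rw [← hγc, ← n2]; ring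
      rw [this]
      have : χ ≤ 1 := by linarith
      exact mul_le_of_le_one_left (by positivity) this
    have n4 : κ * (9 / α) * 2 ≤ 1 / 3 := by
      rw [hκ]
      have : γ / α ^ 2 * (9 / α) * 2 = 18 * (γ / α ^ 3) := by field_simp; norm_num
      rw [this]
      have : γ / α ^ 3 ≤ 1 / 54 := by
        rw [div_le_div_iff₀ (by positivity) (by norm_num)]; linarith
      linarith
    have n5 := mul_le_mul_of_nonneg_right n3 hH0
    have n6 := mul_le_mul_of_nonneg_right n4 hR0
    have n7 : κ * (9 / α * (γ * Z + γ ^ 2 * c * H + 2 * R + γ * V'))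
        = χ * Z + κ * (9 / α) * (γ ^ 2 * c) * H + κ * (9 / α) * 2 * R + χ * V' := by
      rw [← n2]; ring
    rw [mul_add, n7] at n1
    linarith
  have n1 : χ * Z ≤ 1 / 4 * Z := by gcongr; linarith
  have n2 : lam * (κ * H) ≤ α * (κ * H) := by gcongr
  have n3 : χ * V * (1 - lam / 32) ≤ lam / 6 * V := by
    have : χ * V ≤ lam / 6 * V := by gcongr
    have : 0 ≤ χ * V * lam := by positivity
    linarith
  have n4 : 0 ≤ lam * V := by positivity
  have n5 : 0 ≤ α * (κ * H) := by positivity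
  simp only [lyapunov, ← hY, ← hv, ← hv', ← hχ, ← hκ, ← hU, ← hU', ← hH, ← hH', ← hV, ← hV']
  linarith

theorem lyapunov_ge (o : MixingOps J M B lam γ)
    (p : Iteration J M α c L μ σ N η X D h G Gb ε e xs Gs) (hlam1 : lam ≤ 1)
    (hα : 0 < α) (hγ : 0 < γ) (hγ2 : 54 * γ ^ 2 ≤ lam * α ^ 3) (k : ℕ) :
    ‖X k - J (X k)‖ ^ 2 ≤ lyapunov J B γ α η X D h G ε Gs k := by
  have h1 := o.B_nonneg hγ (p.J_dual o k (η k))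
  have h2 : 9 * γ ^ 2 / α ^ 3 ≤ 1 := by
    rw [div_le_one (by positivity)]
    have : lam * α ^ 3 ≤ 1 * α ^ 3 := by gcongr
    nlinarith [sq_nonneg γ]
  have h3 := mul_nonneg (sub_nonneg.2 h2) h1
  have h4 : 0 ≤ γ / α ^ 2 * ‖target X D G ε η k - h k‖ ^ 2 := by positivity
  unfold lyapunov
  linarith

end Iteration

end Hilbert

/-! ### From the Hilbert space recursions to the rate -/

/-- The Lyapunov recursion with the errors of the next iterate eliminated from its right-hand
side; `x` stands for `(η L)²`. -/
theorem eliminate_next {a a' Φ Φ' x y lam s S T : ℝ} (ha : 0 ≤ a) (hΦ : 0 ≤ Φ) (hΦ' : 0 ≤ Φ')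
    (hs : 0 ≤ s) (hx : 0 ≤ x) (hx1 : x ≤ 1) (hy : 0 ≤ y) (hlam : 0 < lam) (hsS : s ≤ S)
    (hT : 0 ≤ T)
    (h1 : a' ≤ 3 * a + y * Φ + s)
    (h2 : Φ' ≤ (1 - lam / 32) * Φ + 18 / lam * (x * (Φ + a)) + 2 * S
      + 1 / 3 * (x * (Φ' + a') + S) + T) :
    Φ' ≤ (1 - lam / 32) * Φ + (36 / lam + 3 + y) * (x * (Φ + a)) + 6 * S + 2 * T := by
  have k0 : 0 ≤ x * Φ := by positivity
  have k1 : 0 ≤ x * a := by positivity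
  have hS : 0 ≤ S := hs.trans hsS
  set R := 18 / lam * (x * (Φ + a)) + 7 / 3 * S + 1 / 3 * (x * (3 * a + y * Φ + s)) + T with hR
  have hR0 : 0 ≤ R := by positivity
  have k2 := mul_le_mul_of_nonneg_left h1 hx
  have k3 : (1 - x / 3) * Φ' ≤ (1 - lam / 32) * Φ + R := by rw [hR]; linarith
  have k4 : Φ' ≤ (1 + x / 2) * ((1 - lam / 32) * Φ + R) := by
    have h5 : 0 < 1 - x / 3 := by linarith
    -- The unknown `Φ'` stands on both sides with coefficient `x/3` on the right. Instead of
    -- dividing by `1 - x/3`, multiply by `1 + x/2`, which is enough for `x ≤ 1`.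
    have h6 : 1 ≤ (1 + x / 2) * (1 - x / 3) := by nlinarith
    calc Φ' ≤ ((1 + x / 2) * (1 - x / 3)) * Φ' := le_mul_of_one_le_left hΦ' h6
      _ = (1 + x / 2) * ((1 - x / 3) * Φ') := by ring
      _ ≤ _ := by gcongr
  have k5 : x * R ≤ 1 * R := by gcongr
  have k6 : 0 ≤ x * (lam * Φ) := by positivity
  have k7 : x * s ≤ 1 * S := by gcongr
  have k8 : 0 ≤ 1 / lam * (x * (Φ + a)) := by positivity
  have k9 : 0 ≤ y * (x * a) := by positivity
  have k10 : 0 ≤ y * (x * Φ) := by positivity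
  have e1 : 18 / lam * (x * (Φ + a)) = 18 * (1 / lam * (x * (Φ + a))) := by ring
  have e2 : (36 / lam + 3 + y) * (x * (Φ + a))
      = 36 * (1 / lam * (x * (Φ + a))) + (3 + y) * (x * (Φ + a)) := by ring
  have k11 : Φ' ≤ (1 - lam / 32) * Φ + x / 2 * Φ + 3 / 2 * R := by linarith
  rw [hR, e1] at k11
  rw [e2]
  linarith

theorem norm_gradient_sq_le {E : Type*} [NormedAddCommGroup E] {G Gs ε u : E} {L S : ℝ} (h : ‖G - Gs‖ ≤ L * ‖u‖)
    (hε : ‖ε‖ ^ 2 ≤ S) : ‖G + ε‖ ^ 2 ≤ 3 * (L ^ 2 * ‖u‖ ^ 2 + S + ‖Gs‖ ^ 2) := by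
  have h1 := norm_add₃_sq_le (G - Gs) ε Gs
  have h2 : ‖G - Gs‖ ^ 2 ≤ L ^ 2 * ‖u‖ ^ 2 := by rw [← mul_pow]; gcongr
  have e : G - Gs + ε + Gs = G + ε := by abel
  rw [e] at h1
  linarith

section Hilbert

variable {E : Type*} [NormedAddCommGroup E] [InnerProductSpace ℝ E]

local notation "⟪" x ", " y "⟫" => inner ℝ x y

namespace Iteration

variable {J M B : E →L[ℝ] E} {lam γ α c L μ σ n : ℝ} {η : ℕ → ℝ} {X D h G Gb ε e : ℕ → E}
  {xs Gs : E}

/-- The errors at time `0`. -/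
theorem initial_le (o : MixingOps J M B lam γ)
    (p : Iteration J M α c L μ σ n η X D h G Gb ε e xs Gs) (hlam : 0 < lam)
    (hα : 0 < α) (hα1 : α ≤ 1) (hγ : 0 < γ) (hγ1 : γ ≤ α ^ 3 / 54) {c₁ c₂ ν ηm : ℝ}
    (hn : 1 ≤ n) (hGs : ‖Gs‖ ^ 2 ≤ c₁ * n ^ 3) {xm Gm εm : E}
    (hxm : ‖xm - xs‖ ^ 2 ≤ c₂ * n ^ 2) (hGm : ‖Gm - Gs‖ ≤ L * ‖xm - xs‖)
    (hεm : ‖εm‖ ^ 2 ≤ n * σ ^ 2) (hX : X 0 = xm - ηm • (Gm + εm)) (hh : h 0 = xm)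
    (hν : 0 < ν) (h0ν : η 0 ^ 2 ≤ ν) (hmν : ηm ^ 2 ≤ ν) (h0lam : η 0 ^ 2 ≤ lam * ν) :
    ‖J (X 0 - xs)‖ ^ 2 + lyapunov J B γ α η X D h G ε Gs 0 ≤
      ((2 * c₂ + 6 * ν * (L ^ 2 * c₂ + σ ^ 2 + c₁)) + ν * c₁
        + 3 * ((2 * c₂ + 6 * ν * (L ^ 2 * c₂ + σ ^ 2 + c₁)) + c₂
        + 3 * ν * (L ^ 2 * (2 * c₂ + 6 * ν * (L ^ 2 * c₂ + σ ^ 2 + c₁)) + σ ^ 2 + c₁)))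
        * n ^ 3 := by
  have hn2 : n ^ 2 ≤ n ^ 3 := pow_le_pow_right₀ hn (by norm_num)
  have hn1 : n ≤ n ^ 3 := le_self_pow₀ hn (by norm_num)
  have hn0 : 0 < n := by linarith
  have hc₂ : 0 ≤ c₂ := by
    by_contra hc
    push Not at hc
    have : c₂ * n ^ 2 < 0 := mul_neg_of_neg_of_pos hc (by positivity)
    linarith [sq_nonneg ‖xm - xs‖]
  have hc₁ : 0 ≤ c₁ := by
    by_contra hc
    push Not at hc
    have : c₁ * n ^ 3 < 0 := mul_neg_of_neg_of_pos hc (by positivity)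
    linarith [sq_nonneg ‖Gs‖]
  have hxm' : ‖xm - xs‖ ^ 2 ≤ c₂ * n ^ 3 := hxm.trans (by gcongr)
  have hs : n * σ ^ 2 ≤ σ ^ 2 * n ^ 3 := by rw [mul_comm]; gcongr
  set R := 2 * c₂ + 6 * ν * (L ^ 2 * c₂ + σ ^ 2 + c₁) with hR
  have hR0 : 0 ≤ R := by positivity
  have b0 : ‖X 0 - xs‖ ^ 2 ≤ R * n ^ 3 := by
    have e1 : X 0 - xs = (xm - xs) + -(ηm • (Gm + εm)) := by rw [hX]; abel
    have y := norm_add_sq_le_young (xm - xs) (-(ηm • (Gm + εm))) one_pos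
    rw [← e1, norm_neg, norm_smul, mul_pow, Real.norm_eq_abs, sq_abs] at y
    have g := norm_gradient_sq_le hGm hεm
    have g2 : ηm ^ 2 * ‖Gm + εm‖ ^ 2
        ≤ ν * (3 * (L ^ 2 * (c₂ * n ^ 3) + σ ^ 2 * n ^ 3 + c₁ * n ^ 3)) := by
      gcongr
      exact g.trans (by gcongr)
    rw [hR]
    norm_num at y
    linarith
  have bV : ⟪D 0 + η 0 • Gs, B (D 0 + η 0 • Gs)⟫ ≤ ν * c₁ * n ^ 3 := by
    have j := p.J_dual o 0 (η 0)
    have b := o.B_lower hlam j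
    rw [p.D_zero, zero_add] at b ⊢
    rw [norm_smul, mul_pow, Real.norm_eq_abs, sq_abs] at b
    have : η 0 ^ 2 * ‖Gs‖ ^ 2 ≤ lam * ν * (c₁ * n ^ 3) := by gcongr
    have h2 : lam * ⟪η 0 • Gs, B (η 0 • Gs)⟫ ≤ lam * (ν * c₁ * n ^ 3) := by linarith
    exact le_of_mul_le_mul_left h2 hlam
  have bH : ‖target X D G ε η 0 - h 0‖ ^ 2
      ≤ 3 * (R + c₂ + 3 * ν * (L ^ 2 * R + σ ^ 2 + c₁)) * n ^ 3 := by
    have e1 : target X D G ε η 0 - h 0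
        = (X 0 - xs) + -(xm - xs) + -(η 0 • (G 0 + ε 0)) := by
      rw [target, p.D_zero, hh]; abel
    have y := norm_add₃_sq_le (X 0 - xs) (-(xm - xs)) (-(η 0 • (G 0 + ε 0)))
    rw [← e1, norm_neg, norm_neg, norm_smul, mul_pow, Real.norm_eq_abs, sq_abs] at y
    have g := norm_gradient_sq_le (p.lip 0) (p.noise 0)
    have g2 : η 0 ^ 2 * ‖G 0 + ε 0‖ ^ 2
        ≤ ν * (3 * (L ^ 2 * (R * n ^ 3) + σ ^ 2 * n ^ 3 + c₁ * n ^ 3)) := by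
      gcongr
      exact g.trans (by gcongr)
    linarith
  have hV0 := o.B_nonneg hγ (p.J_dual o 0 (η 0))
  have hV1 : (1 - 9 * γ ^ 2 / α ^ 3) * ⟪D 0 + η 0 • Gs, B (D 0 + η 0 • Gs)⟫
      ≤ 1 * ⟪D 0 + η 0 • Gs, B (D 0 + η 0 • Gs)⟫ := by
    have : 0 ≤ 9 * γ ^ 2 / α ^ 3 := by positivity
    gcongr; linarith
  have hH1 : γ / α ^ 2 * ‖target X D G ε η 0 - h 0‖ ^ 2
      ≤ 1 * ‖target X D G ε η 0 - h 0‖ ^ 2 := by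
    gcongr
    rw [div_le_one (by positivity)]
    have : α ^ 3 ≤ α ^ 2 := pow_le_pow_of_le_one hα.le hα1 (by norm_num)
    have : 0 ≤ α ^ 3 := by positivity
    linarith
  have py := o.norm_sq_eq (X 0 - xs)
  have eu : X 0 - xs - J (X 0 - xs) = X 0 - J (X 0) := by
    simp only [map_sub, p.J_xs]; abel
  rw [eu] at py
  unfold lyapunov
  linarith

end Iteration

end Hilbert

set_option maxHeartbeats 1000000 in
/-- The convergence rate of the process after the transient time. -/
theorem exists_process_bound (μ L σ θ ρ c₁ c₂ Q₀ : ℝ) (hμ : 0 < μ) (hL : 0 < L) (hθ : 18 < θ)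
    (hρ : ρ ≤ 4 * θ / 3 - 1) :
    ∃ A K : ℝ, 0 < A ∧ 0 < K ∧ ∀ (E : Type u) [NormedAddCommGroup E] [InnerProductSpace ℝ E]
      (J M B : E →L[ℝ] E) (lam γ α c n m ηm : ℝ) (η : ℕ → ℝ) (X D h G Gb ε e : ℕ → E)
      (xs Gs xm Gm εm : E),
      MixingOps J M B lam γ → Iteration J M α c L μ σ n η X D h G Gb ε e xs Gs →
      0 < lam → lam ≤ 1 → 0 < α → α ≤ 1 → 0 < γ → 12 * c * α = 1 → γ ≤ α ^ 3 / 54 →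
      54 * γ ^ 2 ≤ lam * α ^ 3 → lam ≤ α → 1 ≤ n → 2 ≤ m → 1 ≤ lam * m → θ * L ≤ μ * m →
      θ ≤ m → m ≤ Q₀ * n ^ ρ →
      (∀ k : ℕ, η k = θ / (μ * (k + m))) → ηm = θ / (μ * (m - 1)) →
      ‖Gs‖ ^ 2 ≤ c₁ * n ^ 3 → ‖xm - xs‖ ^ 2 ≤ c₂ * n ^ 2 → ‖Gm - Gs‖ ≤ L * ‖xm - xs‖ →
      ‖εm‖ ^ 2 ≤ n * σ ^ 2 → X 0 = xm - ηm • (Gm + εm) → h 0 = xm →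
      ∀ k : ℕ, A * (n * m) ≤ k → ‖X k - xs‖ ^ 2 ≤ K / k := by
  have hθ0 : 0 < θ := by linarith
  -- With this `P` the squared stepsize is `P/(k + m)²`, and `4P` bounds all squared stepsizes,
  -- including the one at time `-1`.
  obtain ⟨P, hPdef⟩ : ∃ P, P = θ ^ 2 / μ ^ 2 := ⟨_, rfl⟩
  have hP0 : 0 < P := by rw [hPdef]; positivity
  obtain ⟨ν, hν⟩ : ∃ ν, ν = 4 * P := ⟨_, rfl⟩
  have hν0 : 0 < ν := by linarith
  obtain ⟨R, hR⟩ : ∃ R, R = ((2 * c₂ + 6 * ν * (L ^ 2 * c₂ + σ ^ 2 + c₁)) + ν * c₁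
        + 3 * ((2 * c₂ + 6 * ν * (L ^ 2 * c₂ + σ ^ 2 + c₁)) + c₂
        + 3 * ν * (L ^ 2 * (2 * c₂ + 6 * ν * (L ^ 2 * c₂ + σ ^ 2 + c₁)) + σ ^ 2 + c₁))) := ⟨_, rfl⟩
  -- The sum of all constants that occur in the two scalar recursions and in the initial error, so
  -- that each of them is at most `Q`.
  obtain ⟨Q, hQ⟩ : ∃ Q, Q = 1 + |Q₀| + 2 * (P * L ^ 2) + 9 * (θ * L ^ 2 / μ ^ 2) + 6 * (P * σ ^ 2)
    + (39 + 9 * (L / μ)) * (P * L ^ 2) + 66 * (P * |c₁|)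
    + |R| := ⟨_, rfl⟩
  have q1 := abs_nonneg Q₀
  have q2 : 0 ≤ P * L ^ 2 := by positivity
  have q3 : 0 ≤ θ * L ^ 2 / μ ^ 2 := by positivity
  have q4 : 0 ≤ P * σ ^ 2 := by positivity
  have q5 : 0 ≤ L / μ * (P * L ^ 2) := by positivity
  have q6 : 0 ≤ P * |c₁| := by positivity
  have q7 := abs_nonneg R
  obtain ⟨A, K, hA, hK, key⟩ := exists_transient_bound θ Q ρ hθ (by rw [hQ]; linarith) hρ
  refine ⟨A, K, hA, hK, ?_⟩
  intro E _ _ J M B lam γ α c n m ηm η X D h G Gb ε e xs Gs xm Gm εm o p hlam hlam1 hα hα1 hγ hc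
    hγ1 hγ2 hlamα hn hm hlm hLm hθm hmn hη hηm hGs hxm hGm hεm hX hh k hk
  have hm0 : 0 < m := by linarith
  have hn0 : 0 < n := by linarith
  have ht : ∀ k : ℕ, m ≤ k + m := fun k => by have : (0 : ℝ) ≤ k := k.cast_nonneg; linarith
  have hηpos : ∀ k, 0 < η k := fun k => by
    have := ht k
    rw [hη]; have : 0 < (k : ℝ) + m := by linarith
    positivity
  have hηsq : ∀ k, η k ^ 2 = P / (k + m) ^ 2 := fun k => by
    rw [hη, hPdef, div_pow, mul_pow, div_div]
  have hηL : ∀ k, η k * L ≤ 1 := fun k => by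
    have := ht k
    have h0 : 0 < (k : ℝ) + m := by linarith
    rw [hη, div_mul_eq_mul_div, div_le_one (by positivity)]
    exact hLm.trans (by gcongr)
  have hημ : ∀ k, η k * μ = θ / (k + m) := fun k => by
    have := ht k
    have h0 : 0 < (k : ℝ) + m := by linarith
    rw [hη]; field_simp
  have hημ1 : ∀ k, η k * μ ≤ 1 := fun k => by
    have := ht k
    have h0 : 0 < (k : ℝ) + m := by linarith
    rw [hημ, div_le_one h0]; linarith
  have hmono : ∀ k, η (k + 1) ≤ η k := fun k => by
    have := ht k
    have h0 : 0 < (k : ℝ) + m := by linarith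
    rw [hη, hη]; gcongr; linarith
  have hdiff : ∀ k, (η (k + 1) - η k) ^ 2 ≤ P / (k + m) ^ 4 := fun k => by
    have := ht k
    have h0 : 0 < (k : ℝ) + m := by linarith
    -- Consecutive stepsizes differ by order `t⁻²`, so the drift of the dual optimum contributes
    -- only order `t⁻⁴`.
    have e : η (k + 1) - η k = -(θ / (μ * ((k + m) * (k + m + 1)))) := by
      rw [hη, hη]; push_cast
      have : (k : ℝ) + 1 + m ≠ 0 := by linarith
      have : (k : ℝ) + m + 1 ≠ 0 := by linarith
      field_simp; ring
    rw [e, neg_sq, hPdef, div_pow, mul_pow, mul_pow, div_div]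
    have h9 : ((k : ℝ) + m) ^ 2 ≤ (k + m + 1) ^ 2 := by
      apply pow_le_pow_left₀ h0.le; linarith
    rw [show ((k : ℝ) + m) ^ 4 = (k + m) ^ 2 * (k + m) ^ 2 by ring]
    apply div_le_div_of_nonneg_left (by positivity) (by positivity)
    gcongr _ * (_ * ?_)
  set a : ℕ → ℝ := fun k => ‖J (X k - xs)‖ ^ 2 with ha
  set Φ : ℕ → ℝ := lyapunov J B γ α η X D h G ε Gs with hΦ
  have ha0 : ∀ k, 0 ≤ a k := fun k => sq_nonneg _
  have hUΦ : ∀ k, ‖X k - J (X k)‖ ^ 2 ≤ Φ k := fun k => p.lyapunov_ge o hlam1 hα hγ hγ2 k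
  have hΦ0 : ∀ k, 0 ≤ Φ k := fun k => (sq_nonneg _).trans (hUΦ k)
  have hsum : ∀ k, ‖X k - xs‖ ^ 2 ≤ Φ k + a k := fun k => by
    have eu : X k - xs - J (X k - xs) = X k - J (X k) := by
      simp only [map_sub, p.J_xs]; abel
    have := o.norm_sq_eq (X k - xs)
    rw [eu] at this
    linarith [hUΦ k]
  have hlm' : 1 / lam ≤ m := by rw [div_le_iff₀ hlam]; linarith
  have F1 : ∀ k : ℕ, a (k + 1) ≤ (1 - 15 / 8 * (η k * μ) + 2 * (η k ^ 2 * L ^ 2)) * a k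
      + 9 * (η k * L ^ 2 / μ) * Φ k + η k ^ 2 * σ ^ 2 := fun k => by
    refine (p.mean_succ_le o hμ (hηpos k) (hημ1 k)).trans ?_
    have := hηpos k
    have h2 := hUΦ k
    gcongr
  have hnσ : ∀ k, η k ^ 2 * σ ^ 2 ≤ η k ^ 2 * (n * σ ^ 2) := fun k => by
    gcongr; exact le_mul_of_one_le_left (sq_nonneg _) hn
  have hx1 : ∀ k, η k ^ 2 * L ^ 2 ≤ 1 := fun k => by
    rw [← mul_pow]; exact pow_le_one₀ (mul_nonneg (hηpos k).le hL.le) (hηL k)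
  have hyl : ∀ k, 9 * (η k * L ^ 2 / μ) ≤ 9 * (L / μ) := fun k => by
    have := hηL k
    gcongr
    nlinarith
  have F2 : ∀ k : ℕ, Φ (k + 1) ≤ (1 - lam / 32) * Φ k
      + (36 / lam + 3 + 9 * (η k * L ^ 2 / μ)) * (η k ^ 2 * L ^ 2 * (Φ k + a k))
      + 6 * (η k ^ 2 * (n * σ ^ 2))
      + 2 * (33 / lam ^ 2 * ((η (k + 1) - η k) ^ 2 * ‖Gs‖ ^ 2)) := fun k => by
    have hpos := hηpos k
    refine eliminate_next (a' := a (k + 1)) (s := η k ^ 2 * σ ^ 2) (ha0 k) (hΦ0 k) (hΦ0 (k + 1))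
      (by positivity) (by positivity)
      (hx1 k) (by positivity) hlam (hnσ k) (by positivity) ?_ ?_
    · refine (F1 k).trans ?_
      have h1 : 1 - 15 / 8 * (η k * μ) + 2 * (η k ^ 2 * L ^ 2) ≤ 3 := by
        have := hx1 k
        have : 0 ≤ η k * μ := by positivity
        linarith
      have := mul_le_mul_of_nonneg_right h1 (ha0 k)
      linarith
    · refine (p.lyapunov_succ_le o hlam hlam1 hα hα1 hγ hc hγ1 hγ2 hlamα k).trans ?_
      have h1 := hsum k
      have h2 := hsum (k + 1)
      have h3 : η (k + 1) ^ 2 ≤ η k ^ 2 := by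
        have := hmono k
        have := (hηpos (k + 1)).le
        gcongr
      have hnn : 0 ≤ n * σ ^ 2 := by positivity
      have h4 : η (k + 1) ^ 2 * (L ^ 2 * ‖X (k + 1) - xs‖ ^ 2 + n * σ ^ 2)
          ≤ η k ^ 2 * (L ^ 2 * (Φ (k + 1) + a (k + 1)) + n * σ ^ 2) := by gcongr
      have h5 : η k ^ 2 * L ^ 2 * ‖X k - xs‖ ^ 2 ≤ η k ^ 2 * L ^ 2 * (Φ k + a k) := by gcongr
      have h6 : 18 / lam * (η k ^ 2 * L ^ 2 * ‖X k - xs‖ ^ 2)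
          ≤ 18 / lam * (η k ^ 2 * L ^ 2 * (Φ k + a k)) := by gcongr
      linarith
  have hc₁n : c₁ * n ^ 3 ≤ |c₁| * n ^ 3 := by gcongr; exact le_abs_self _
  have main := key n m hn (by linarith) (hmn.trans (by
      gcongr
      rw [hQ]
      have := le_abs_self Q₀
      linarith)) a Φ ha0 hΦ0 ?_ ?_ ?_ k hk
  · exact (hsum k).trans (by linarith)
  · intro k
    have h0 : 0 < (k : ℝ) + m := by have := ht k; linarith
    refine (F1 k).trans ?_
    have e1 : 9 * (η k * L ^ 2 / μ) ≤ Q / (k + m) := by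
      have : 9 * (η k * L ^ 2 / μ) = 9 * (θ * L ^ 2 / μ ^ 2) / (k + m) := by
        rw [hη]; field_simp
      rw [this]; gcongr; rw [hQ]; linarith
    have e2 : 2 * (η k ^ 2 * L ^ 2) ≤ Q / (k + m) ^ 2 := by
      have : 2 * (η k ^ 2 * L ^ 2) = 2 * (P * L ^ 2) / (k + m) ^ 2 := by rw [hηsq]; ring
      rw [this]; gcongr; rw [hQ]; linarith
    have e3 : η k ^ 2 * σ ^ 2 ≤ Q / (k + m) ^ 2 := by
      have : η k ^ 2 * σ ^ 2 = P * σ ^ 2 / (k + m) ^ 2 := by rw [hηsq]; ring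
      rw [this]; gcongr; rw [hQ]; linarith
    have e4 : 15 / 8 * (η k * μ) = 15 / 8 * θ / (k + m) := by rw [hημ]; ring
    rw [e4]
    have := ha0 k
    have := hΦ0 k
    gcongr
  · intro k
    have h0 : 0 < (k : ℝ) + m := by have := ht k; linarith
    refine (F2 k).trans ?_
    have e0 : 1 - lam / 32 ≤ 1 - 1 / (32 * m) := by
      have : 1 / (32 * m) ≤ lam / 32 := by
        rw [div_le_div_iff₀ (by positivity) (by norm_num)]; linarith
      linarith
    have e1 : (36 / lam + 3 + 9 * (η k * L ^ 2 / μ)) * (η k ^ 2 * L ^ 2 * (Φ k + a k))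
        ≤ Q * m / (k + m) ^ 2 * (Φ k + a k) := by
      have i1 : 36 / lam + 3 + 9 * (η k * L ^ 2 / μ) ≤ (39 + 9 * (L / μ)) * m := by
        have : 36 / lam = 36 * (1 / lam) := by ring
        have := hyl k
        have : 9 * (L / μ) ≤ 9 * (L / μ) * m := le_mul_of_one_le_right (by positivity)
          (by linarith)
        linarith
      have i2 : η k ^ 2 * L ^ 2 = P * L ^ 2 / (k + m) ^ 2 := by rw [hηsq]; ring
      have i3 := add_nonneg (hΦ0 k) (ha0 k)
      rw [← mul_assoc, i2]
      apply mul_le_mul_of_nonneg_right _ i3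
      calc (36 / lam + 3 + 9 * (η k * L ^ 2 / μ)) * (P * L ^ 2 / (k + m) ^ 2)
          ≤ (39 + 9 * (L / μ)) * m * (P * L ^ 2 / (k + m) ^ 2) := by gcongr
        _ = ((39 + 9 * (L / μ)) * (P * L ^ 2)) * m / (k + m) ^ 2 := by ring
        _ ≤ _ := by gcongr; rw [hQ]; linarith
    have e2 : 6 * (η k ^ 2 * (n * σ ^ 2)) ≤ Q * n / (k + m) ^ 2 := by
      have : 6 * (η k ^ 2 * (n * σ ^ 2)) = 6 * (P * σ ^ 2) * n / (k + m) ^ 2 := by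
        rw [hηsq]; ring
      rw [this]; gcongr; rw [hQ]; linarith
    have e3 : 2 * (33 / lam ^ 2 * ((η (k + 1) - η k) ^ 2 * ‖Gs‖ ^ 2))
        ≤ Q * n ^ 3 * m ^ 2 / (k + m) ^ 4 := by
      calc 2 * (33 / lam ^ 2 * ((η (k + 1) - η k) ^ 2 * ‖Gs‖ ^ 2))
          = 66 * ((1 / lam) ^ 2 * ((η (k + 1) - η k) ^ 2 * ‖Gs‖ ^ 2)) := by ring
        _ ≤ 66 * (m ^ 2 * (P / (k + m) ^ 4 * (|c₁| * n ^ 3))) := by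
            have := hdiff k
            have := hGs.trans hc₁n
            gcongr
        _ = 66 * (P * |c₁|) * n ^ 3 * m ^ 2 / (k + m) ^ 4 := by ring
        _ ≤ _ := by gcongr; rw [hQ]; linarith
    have := mul_le_mul_of_nonneg_right e0 (hΦ0 k)
    linarith
  · have hsq0 : η 0 ^ 2 = P / m ^ 2 := by
      rw [hηsq]; simp
    refine (p.initial_le o hlam hα hα1 hγ hγ1 hn hGs hxm hGm hεm hX hh (ν := ν) (by positivity)
      ?_ ?_ ?_).trans ?_
    · rw [hsq0, hν]
      have : P / m ^ 2 ≤ P / 1 := by gcongr; exact one_le_pow₀ (by linarith)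
      linarith
    · have hm1 : 1 ≤ (m - 1) ^ 2 := one_le_pow₀ (by linarith)
      rw [hηm, div_pow, mul_pow, ← div_div, ← hPdef, hν, div_le_iff₀ (by linarith)]
      have := mul_le_mul_of_nonneg_left hm1 hP0.le
      linarith
    · rw [hsq0, hν, div_le_iff₀ (by positivity)]
      have h1 : 1 ≤ lam * m * m := by
        have := mul_le_mul hlm (show 1 ≤ m by linarith) zero_le_one (by linarith)
        linarith
      have := mul_le_mul_of_nonneg_left h1 hP0.le
      linarith
    · rw [← hR]
      gcongr
      rw [hQ]
      have := le_abs_self R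
      linarith

/-! ### Spectrum of the mixing matrix -/

namespace Network

open Matrix

variable {n : ℕ} (N : Network n)

theorem W_comm (i j : Fin n) : N.W i j = N.W j i := N.symm.apply j i

theorem col_sum (j : Fin n) : ∑ i, N.W i j = 1 := by
  rw [← N.stochastic j]
  exact Finset.sum_congr rfl fun i _ => N.W_comm i j

theorem sum_mul_sq_left (x : Fin n → ℝ) : ∑ i, ∑ j, N.W i j * x i ^ 2 = x ⬝ᵥ x := by
  simp only [dotProduct, ← Finset.sum_mul, N.stochastic, one_mul, sq]

theorem sum_mul_sq_right (x : Fin n → ℝ) : ∑ i, ∑ j, N.W i j * x j ^ 2 = x ⬝ᵥ x := by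
  rw [Finset.sum_comm]
  simp only [dotProduct, ← Finset.sum_mul, N.col_sum, one_mul, sq]

theorem dotProduct_mulVec_eq (x : Fin n → ℝ) :
    x ⬝ᵥ N.W *ᵥ x = ∑ i, ∑ j, N.W i j * (x i * x j) := by
  simp only [dotProduct, mulVec, Finset.mul_sum]
  exact Finset.sum_congr rfl fun i _ => Finset.sum_congr rfl fun j _ => by ring

theorem sum_mul_sub_sq (x : Fin n → ℝ) :
    ∑ i, ∑ j, N.W i j * (x i - x j) ^ 2 = 2 * (x ⬝ᵥ x) - 2 * (x ⬝ᵥ N.W *ᵥ x) := by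
  have : ∀ i j, N.W i j * (x i - x j) ^ 2
      = N.W i j * x i ^ 2 + N.W i j * x j ^ 2 - 2 * (N.W i j * (x i * x j)) := fun i j => by ring
  simp only [this, Finset.sum_sub_distrib, Finset.sum_add_distrib, ← Finset.mul_sum,
    N.sum_mul_sq_left, N.sum_mul_sq_right, ← N.dotProduct_mulVec_eq]
  ring

theorem sum_mul_add_sq (x : Fin n → ℝ) :
    ∑ i, ∑ j, N.W i j * (x i + x j) ^ 2 = 2 * (x ⬝ᵥ x) + 2 * (x ⬝ᵥ N.W *ᵥ x) := by
  have : ∀ i j, N.W i j * (x i + x j) ^ 2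
      = N.W i j * x i ^ 2 + N.W i j * x j ^ 2 + 2 * (N.W i j * (x i * x j)) := fun i j => by ring
  simp only [this, Finset.sum_add_distrib, ← Finset.mul_sum,
    N.sum_mul_sq_left, N.sum_mul_sq_right, ← N.dotProduct_mulVec_eq]
  ring

theorem dotProduct_mulVec_le (x : Fin n → ℝ) : x ⬝ᵥ N.W *ᵥ x ≤ x ⬝ᵥ x := by
  have h : 0 ≤ ∑ i, ∑ j, N.W i j * (x i - x j) ^ 2 :=
    Finset.sum_nonneg fun i _ => Finset.sum_nonneg fun j _ =>
      mul_nonneg (N.nonneg i j) (sq_nonneg _)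
  rw [N.sum_mul_sub_sq] at h
  linarith

theorem neg_le_dotProduct_mulVec (x : Fin n → ℝ) : -(x ⬝ᵥ x) ≤ x ⬝ᵥ N.W *ᵥ x := by
  have h : 0 ≤ ∑ i, ∑ j, N.W i j * (x i + x j) ^ 2 :=
    Finset.sum_nonneg fun i _ => Finset.sum_nonneg fun j _ =>
      mul_nonneg (N.nonneg i j) (sq_nonneg _)
  rw [N.sum_mul_add_sq] at h
  linarith

/-- The hypothesis makes the Dirichlet form `∑ w_ij (x_i - x_j)²` vanish. Then `x` is constant along
every edge, hence everywhere by connectedness. -/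
theorem eq_of_le_dotProduct_mulVec {x : Fin n → ℝ} (h : x ⬝ᵥ x ≤ x ⬝ᵥ N.W *ᵥ x) (i j : Fin n) :
    x i = x j := by
  have hnn : ∀ i j, 0 ≤ N.W i j * (x i - x j) ^ 2 := fun i j =>
    mul_nonneg (N.nonneg i j) (sq_nonneg _)
  have h0 : ∑ i, ∑ j, N.W i j * (x i - x j) ^ 2 = 0 := by
    apply le_antisymm
    · rw [N.sum_mul_sub_sq]; linarith
    · exact Finset.sum_nonneg fun i _ => Finset.sum_nonneg fun j _ => hnn i j
  have hz : ∀ i j, N.W i j * (x i - x j) ^ 2 = 0 := fun i j => by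
    have h1 := (Finset.sum_eq_zero_iff_of_nonneg
      (fun i _ => Finset.sum_nonneg fun j _ => hnn i j)).1 h0 i (Finset.mem_univ _)
    exact (Finset.sum_eq_zero_iff_of_nonneg (fun j _ => hnn i j)).1 h1 j (Finset.mem_univ _)
  have adj : ∀ i j, N.graph.Adj i j → x i = x j := fun i j hij => by
    have hpos := (N.adj_iff i j hij.ne).1 hij
    have := (mul_eq_zero.1 (hz i j)).resolve_left hpos.ne'
    exact sub_eq_zero.1 (pow_eq_zero_iff (two_ne_zero) |>.1 this)
  obtain ⟨w⟩ := N.connected.preconnected i j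
  induction w with
  | nil => rfl
  | cons hab _ ih => exact (adj _ _ hab).trans ih

/-- The orthonormal eigenvectors of `W` as coordinate vectors. -/
noncomputable def eigvec (i : Fin n) : Fin n → ℝ := ⇑(N.isHermitian.eigenvectorBasis i)

theorem sum_eigvec_mul (x y : Fin n → ℝ) :
    ∑ i, (N.eigvec i ⬝ᵥ x) * (N.eigvec i ⬝ᵥ y) = x ⬝ᵥ y := by
  have h := N.isHermitian.eigenvectorBasis.sum_inner_mul_inner (WithLp.toLp 2 x)
    (WithLp.toLp 2 y)
  simp only [PiLp.inner_apply, RCLike.inner_apply, conj_trivial] at h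
  simp only [dotProduct, eigvec]
  rw [show ∑ i, x i * y i = ∑ i, y i * x i from Finset.sum_congr rfl fun i _ => mul_comm _ _, ← h]
  refine Finset.sum_congr rfl fun i _ => ?_
  congr 1
  exact Finset.sum_congr rfl fun j _ => mul_comm _ _

theorem eigvec_dotProduct (i j : Fin n) :
    N.eigvec i ⬝ᵥ N.eigvec j = if i = j then 1 else 0 := by
  have h := orthonormal_iff_ite.1 N.isHermitian.eigenvectorBasis.orthonormal j i
  simp only [PiLp.inner_apply, RCLike.inner_apply, conj_trivial] at h
  simp only [dotProduct, eigvec, h, eq_comm]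

theorem mulVec_eigvec (i : Fin n) :
    N.W *ᵥ N.eigvec i = N.isHermitian.eigenvalues i • N.eigvec i :=
  N.isHermitian.mulVec_eigenvectorBasis i

theorem dotProduct_mulVec_comm (x y : Fin n → ℝ) : x ⬝ᵥ N.W *ᵥ y = (N.W *ᵥ x) ⬝ᵥ y := by
  rw [dotProduct_mulVec, ← mulVec_transpose, N.symm.eq]

theorem eigvec_dotProduct_mulVec (i : Fin n) (x : Fin n → ℝ) :
    N.eigvec i ⬝ᵥ N.W *ᵥ x = N.isHermitian.eigenvalues i * (N.eigvec i ⬝ᵥ x) := by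
  rw [N.dotProduct_mulVec_comm, N.mulVec_eigvec, smul_dotProduct, smul_eq_mul]

theorem mulVec_one : N.W *ᵥ 1 = 1 := by
  ext i; simp [mulVec, dotProduct, N.stochastic]

/-- The indices of the two largest eigenvalues in the enumeration of `eigvec`. -/
theorem exists_top_index (hn : 2 ≤ n) : ∃ i₀ i₁ : Fin n, i₀ ≠ i₁ ∧
    N.isHermitian.eigenvalues i₁ = N.lambda2 hn ∧
    N.lambda2 hn ≤ N.isHermitian.eigenvalues i₀ ∧
    ∀ i, i ≠ i₀ → N.isHermitian.eigenvalues i ≤ N.lambda2 hn := by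
  set e : Fin (Fintype.card (Fin n)) ≃ Fin n := Fintype.equivOfCardEq (Fintype.card_fin _) with he
  have hc : Fintype.card (Fin n) = n := Fintype.card_fin n
  have hev : ∀ i, N.isHermitian.eigenvalues i = N.isHermitian.eigenvalues₀ (e.symm i) :=
    fun i => rfl
  have anti := N.isHermitian.eigenvalues₀_antitone
  refine ⟨e ⟨0, by omega⟩, e ⟨1, by omega⟩, ?_, ?_, ?_, ?_⟩
  · intro h; have := e.injective h; simp at this
  · rw [hev, e.symm_apply_apply]; rfl
  · rw [hev, e.symm_apply_apply]; exact anti (by simp [Fin.le_def])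
  · intro i hi
    rw [hev]
    apply anti
    have : e.symm i ≠ ⟨0, by omega⟩ := fun h => hi (by rw [← h, e.apply_symm_apply])
    rw [Fin.le_def]
    have h2 : (e.symm i).val ≠ 0 := fun h => this (Fin.ext h)
    show 1 ≤ (e.symm i).val
    omega

theorem dotProduct_mulVec_eigvec (i : Fin n) :
    N.eigvec i ⬝ᵥ N.W *ᵥ N.eigvec i = N.isHermitian.eigenvalues i := by
  rw [N.eigvec_dotProduct_mulVec, N.eigvec_dotProduct, if_pos rfl, mul_one]

/-- Otherwise two orthonormal eigenvectors would belong to eigenvalues at least `1`. Both would be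
constant vectors, and nonzero constant vectors are not orthogonal. -/
theorem lambda2_lt_one (hn : 2 ≤ n) : N.lambda2 hn < 1 := by
  obtain ⟨i₀, i₁, hne, h1, h0, -⟩ := N.exists_top_index hn
  by_contra hcon
  push Not at hcon
  have const : ∀ i, 1 ≤ N.isHermitian.eigenvalues i → ∀ j k, N.eigvec i j = N.eigvec i k :=
    fun i hi => N.eq_of_le_dotProduct_mulVec (by
      rw [N.dotProduct_mulVec_eigvec, N.eigvec_dotProduct, if_pos rfl]; exact hi)
  have c0 := const i₀ (hcon.trans h0)
  have c1 := const i₁ (by rw [h1]; exact hcon)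
  have j : Fin n := ⟨0, by omega⟩
  have o := N.eigvec_dotProduct i₀ i₁
  have n0 := N.eigvec_dotProduct i₀ i₀
  have n1 := N.eigvec_dotProduct i₁ i₁
  rw [if_neg hne] at o
  rw [if_pos rfl] at n0 n1
  have r : ∀ a b : Fin n, (∀ j k, N.eigvec a j = N.eigvec a k) →
      (∀ j k, N.eigvec b j = N.eigvec b k) →
      N.eigvec a ⬝ᵥ N.eigvec b = n * (N.eigvec a j * N.eigvec b j) := fun a b ha hb => by
    rw [dotProduct, Finset.sum_congr rfl fun k _ => by rw [ha k j, hb k j]]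
    simp
  rw [r _ _ c0 c1] at o
  rw [r _ _ c0 c0] at n0
  rw [r _ _ c1 c1] at n1
  have hn' : (n : ℝ) ≠ 0 := by positivity
  rcases mul_eq_zero.1 ((mul_eq_zero.1 o).resolve_left hn') with h | h
  · rw [h] at n0; simp at n0
  · rw [h] at n1; simp at n1

theorem neg_one_le_lambda2 (hn : 2 ≤ n) : -1 ≤ N.lambda2 hn := by
  obtain ⟨i₀, i₁, hne, h1, h0, -⟩ := N.exists_top_index hn
  have := N.neg_le_dotProduct_mulVec (N.eigvec i₁)
  rwa [N.dotProduct_mulVec_eigvec, N.eigvec_dotProduct, if_pos rfl, h1] at this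

/-- An eigenvector with eigenvalue below `1` is orthogonal to the fixed vector `1`. So only the top
eigenvector `i₀` can have a component along `1`, and a vector orthogonal to `1` has no component
along it; the others have eigenvalue at most `λ₂`. -/
theorem dotProduct_mulVec_le_lambda2 (hn : 2 ≤ n) {x : Fin n → ℝ} (hx : x ⬝ᵥ 1 = 0) :
    x ⬝ᵥ N.W *ᵥ x ≤ N.lambda2 hn * (x ⬝ᵥ x) := by
  obtain ⟨i₀, i₁, hne, h1, h0, hle⟩ := N.exists_top_index hn
  have hlt := N.lambda2_lt_one hn
  have one0 : ∀ i, i ≠ i₀ → N.eigvec i ⬝ᵥ 1 = 0 := fun i hi => by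
    have h := N.eigvec_dotProduct_mulVec i 1
    rw [N.mulVec_one] at h
    have h2 : (1 - N.isHermitian.eigenvalues i) * (N.eigvec i ⬝ᵥ 1) = 0 := by linarith
    have h3 := hle i hi
    exact (mul_eq_zero.1 h2).resolve_left (by linarith)
  have e1 : ∀ y, y ⬝ᵥ (1 : Fin n → ℝ) = (N.eigvec i₀ ⬝ᵥ y) * (N.eigvec i₀ ⬝ᵥ 1) := fun y => by
    rw [← N.sum_eigvec_mul, Finset.sum_eq_single i₀]
    · intro i _ hi; rw [one0 i hi, mul_zero]
    · simp
  -- If this product vanished, the expansion of `1` would give `1 ⬝ᵥ 1 = 0`, although this equals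
  -- `n`.
  have ne : N.eigvec i₀ ⬝ᵥ (1 : Fin n → ℝ) ≠ 0 := fun h => by
    have := e1 1
    rw [h] at this
    simp at this
    omega
  have x0 : N.eigvec i₀ ⬝ᵥ x = 0 := by
    have := e1 x
    rw [hx] at this
    exact (mul_eq_zero.1 this.symm).resolve_right ne
  rw [← N.sum_eigvec_mul x (N.W *ᵥ x), ← N.sum_eigvec_mul x x, Finset.mul_sum]
  refine Finset.sum_le_sum fun i _ => ?_
  rw [N.eigvec_dotProduct_mulVec]
  by_cases hi : i = i₀
  · rw [hi, x0]; simp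
  · have := hle i hi
    nlinarith [mul_self_nonneg (N.eigvec i ⬝ᵥ x)]

/-- The averaging matrix. -/
noncomputable def avg (n : ℕ) : Matrix (Fin n) (Fin n) ℝ := of fun _ _ => 1 / (n : ℝ)

theorem avg_mulVec (x : Fin n → ℝ) (i : Fin n) : (avg n *ᵥ x) i = 1 / (n : ℝ) * (x ⬝ᵥ 1) := by
  simp [avg, mulVec, dotProduct, ← Finset.mul_sum]

theorem avg_mul_avg (hn : n ≠ 0) : avg n * avg n = avg n := by
  ext i j
  have : (n : ℝ) ≠ 0 := by exact_mod_cast hn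
  simp [avg, mul_apply]
  field_simp

theorem W_mul_avg : N.W * avg n = avg n := by
  ext i j
  simp [avg, mul_apply, ← Finset.sum_mul, N.stochastic]

theorem avg_mul_W : avg n * N.W = avg n := by
  ext i j
  simp [avg, mul_apply, ← Finset.mul_sum, N.col_sum]

theorem avg_isSymm : (avg n).IsSymm := by ext i j; simp [avg]

theorem posSemidef_of_forall {A : Matrix (Fin n) (Fin n) ℝ} (hA : A.IsSymm)
    (h : ∀ x : Fin n → ℝ, 0 ≤ x ⬝ᵥ A *ᵥ x) : A.PosSemidef := by
  refine Matrix.PosSemidef.of_dotProduct_mulVec_nonneg ?_ fun x => ?_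
  · rw [IsHermitian, conjTranspose_eq_transpose_of_trivial]; exact hA
  · simpa using h x

theorem posSemidef_one_add : (1 + N.W).PosSemidef := by
  refine posSemidef_of_forall (isSymm_one.add N.symm) fun x => ?_
  have := N.neg_le_dotProduct_mulVec x
  rw [add_mulVec, dotProduct_add, one_mulVec]
  linarith

theorem posSemidef_gap (hn : 2 ≤ n) :
    ((1 - N.W) - (1 - N.lambda2 hn) • (1 - avg n)).PosSemidef := by
  refine posSemidef_of_forall ?_ fun x => ?_
  · exact (isSymm_one.sub N.symm).sub ((isSymm_one.sub avg_isSymm).smul _)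
  · set y := x - avg n *ᵥ x with hy
    have hn0 : (n : ℝ) ≠ 0 := by positivity
    have jx : avg n *ᵥ x = (1 / (n : ℝ) * (x ⬝ᵥ 1)) • 1 := by
      ext i; rw [avg_mulVec]; simp
    have o11 : (1 : Fin n → ℝ) ⬝ᵥ 1 = n := by simp
    have y1 : y ⬝ᵥ 1 = 0 := by
      rw [hy, sub_dotProduct, jx, smul_dotProduct, o11, smul_eq_mul]; field_simp; ring
    have h := N.dotProduct_mulVec_le_lambda2 hn y1
    have hx : x = y + (1 / (n : ℝ) * (x ⬝ᵥ 1)) • 1 := by rw [hy, jx]; abel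
    set c := 1 / (n : ℝ) * (x ⬝ᵥ 1) with hc
    have e1 : x ⬝ᵥ x = y ⬝ᵥ y + c * c * n := by
      conv_lhs => rw [hx]
      simp only [add_dotProduct, dotProduct_add, smul_dotProduct, dotProduct_smul, y1,
        dotProduct_comm (1 : Fin n → ℝ) y, o11, smul_eq_mul]
      ring
    have e2 : x ⬝ᵥ N.W *ᵥ x = y ⬝ᵥ N.W *ᵥ y + c * c * n := by
      conv_lhs => rw [hx]
      have e3 : (1 : Fin n → ℝ) ⬝ᵥ N.W *ᵥ y = 0 := by
        rw [N.dotProduct_mulVec_comm, N.mulVec_one, dotProduct_comm, y1]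
      simp only [mulVec_add, mulVec_smul, N.mulVec_one, add_dotProduct, dotProduct_add,
        smul_dotProduct, dotProduct_smul, y1, e3, o11, smul_eq_mul]
      ring
    have e4 : x ⬝ᵥ avg n *ᵥ x = c * c * n := by
      rw [jx, dotProduct_smul, smul_eq_mul, hc]; field_simp
    simp only [sub_mulVec, smul_mulVec, one_mulVec, dotProduct_sub, dotProduct_smul, smul_eq_mul,
      e1, e2, e4]
    linarith

end Network

/-! ### The mixing operators on network states -/

section Ops

open Matrix

variable {n : ℕ} {F : Type*} [NormedAddCommGroup F] [InnerProductSpace ℝ F]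

local notation "⟪" x ", " y "⟫" => inner ℝ x y

/-- Network states with one vector for every agent. -/
abbrev NetVec (n : ℕ) (F : Type*) : Type _ := PiLp 2 (fun _ : Fin n => F)

/-- The action of an `n × n` matrix on network states. -/
noncomputable def mixOp (A : Matrix (Fin n) (Fin n) ℝ) : NetVec n F →L[ℝ] NetVec n F :=
  ((PiLp.continuousLinearEquiv 2 ℝ (fun _ : Fin n => F)).symm : (Fin n → F) →L[ℝ] NetVec n F) ∘L
    (ContinuousLinearMap.pi fun i => ∑ j, A i j • ContinuousLinearMap.proj (R := ℝ) j) ∘L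
    ((PiLp.continuousLinearEquiv 2 ℝ (fun _ : Fin n => F)) : NetVec n F →L[ℝ] (Fin n → F))

theorem mixOp_apply (A : Matrix (Fin n) (Fin n) ℝ) (X : NetVec n F) (i : Fin n) :
    mixOp A X i = ∑ j, A i j • X j := by
  simp [mixOp]

theorem mixOp_mul (A B : Matrix (Fin n) (Fin n) ℝ) (X : NetVec n F) :
    mixOp (A * B) X = mixOp A (mixOp B X) := by
  ext i
  simp only [mixOp_apply, Matrix.mul_apply, Finset.sum_smul, Finset.smul_sum, mul_smul]
  exact Finset.sum_comm

theorem mixOp_one (X : NetVec n F) : mixOp (1 : Matrix (Fin n) (Fin n) ℝ) X = X := by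
  ext i
  simp [mixOp_apply, Matrix.one_apply, ite_smul]

theorem mixOp_add (A B : Matrix (Fin n) (Fin n) ℝ) (X : NetVec n F) :
    mixOp (A + B) X = mixOp A X + mixOp B X := by
  ext i
  simp [mixOp_apply, add_smul, Finset.sum_add_distrib]

theorem mixOp_sub (A B : Matrix (Fin n) (Fin n) ℝ) (X : NetVec n F) :
    mixOp (A - B) X = mixOp A X - mixOp B X := by
  ext i
  simp [mixOp_apply, sub_smul, Finset.sum_sub_distrib]

theorem mixOp_smul (a : ℝ) (A : Matrix (Fin n) (Fin n) ℝ) (X : NetVec n F) :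
    mixOp (a • A) X = a • mixOp A X := by
  ext i
  simp [mixOp_apply, Finset.smul_sum, mul_smul]

theorem mixOp_zero (X : NetVec n F) : mixOp (0 : Matrix (Fin n) (Fin n) ℝ) X = 0 := by
  ext i
  simp [mixOp_apply]

theorem inner_mixOp (A : Matrix (Fin n) (Fin n) ℝ) (X Y : NetVec n F) :
    ⟪mixOp A X, Y⟫ = ⟪X, mixOp Aᵀ Y⟫ := by
  simp only [PiLp.inner_apply, mixOp_apply, sum_inner, inner_sum, inner_smul_left,
    inner_smul_right, conj_trivial, transpose_apply]
  exact Finset.sum_comm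

theorem inner_mixOp_symm {A : Matrix (Fin n) (Fin n) ℝ} (hA : A.IsSymm) (X Y : NetVec n F) :
    ⟪mixOp A X, Y⟫ = ⟪X, mixOp A Y⟫ := by rw [inner_mixOp, hA.eq]

open scoped MatrixOrder Matrix.Norms.L2Operator in
-- A factorization `A = Bᵀ B` turns the form into a squared norm. This transfers positivity from
-- coordinate vectors to any Hilbert space `F` without a basis of `F`.
theorem inner_mixOp_nonneg {A : Matrix (Fin n) (Fin n) ℝ} (hA : A.PosSemidef) (X : NetVec n F) :
    0 ≤ ⟪X, mixOp A X⟫ := by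
  obtain ⟨B, rfl⟩ := CStarAlgebra.nonneg_iff_eq_star_mul_self.mp hA.nonneg
  rw [mixOp_mul, star_eq_conjTranspose, conjTranspose_eq_transpose_of_trivial, ← inner_mixOp]
  exact real_inner_self_nonneg

/-- Positivity of the form at `γ x - M x`, together with the upper bound at `M x`. -/
theorem norm_sq_le_of_bounds {E : Type*} [NormedAddCommGroup E] [InnerProductSpace ℝ E]
    {M : E →L[ℝ] E} {γ : ℝ} (hγ : 0 < γ) (hs : ∀ x y, ⟪M x, y⟫ = ⟪x, M y⟫)
    (h0 : ∀ x, 0 ≤ ⟪x, M x⟫) (h1 : ∀ x, ⟪x, M x⟫ ≤ γ * ‖x‖ ^ 2) (x : E) :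
    ‖M x‖ ^ 2 ≤ γ * ⟪x, M x⟫ := by
  have k := h0 (γ • x - M x)
  have e : ⟪γ • x - M x, M (γ • x - M x)⟫
      = γ ^ 2 * ⟪x, M x⟫ - 2 * γ * ‖M x‖ ^ 2 + ⟪M x, M (M x)⟫ := by
    simp only [map_sub, map_smul, inner_sub_left, inner_sub_right, inner_smul_left,
      inner_smul_right, conj_trivial, real_inner_self_eq_norm_sq, ← hs x (M x)]
    ring
  rw [e] at k
  have k2 := h1 (M x)
  have k3 : 0 ≤ γ * (γ * ⟪x, M x⟫ - ‖M x‖ ^ 2) := by linarith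
  have := nonneg_of_mul_nonneg_right k3 hγ
  linarith

namespace Network

variable (N : Network n)

/-- The averaging operator. -/
noncomputable def opJ (n : ℕ) (F : Type*) [NormedAddCommGroup F] [InnerProductSpace ℝ F] :
    NetVec n F →L[ℝ] NetVec n F := mixOp (avg n)

/-- The operator `(γ/2)(1 - W)`. -/
noncomputable def opM (F : Type*) [NormedAddCommGroup F] [InnerProductSpace ℝ F] (γ : ℝ) :
    NetVec n F →L[ℝ] NetVec n F := mixOp ((γ / 2) • (1 - N.W))

/-- The pseudo-inverse of `opM` on vectors of zero mean. -/
noncomputable def opB (F : Type*) [NormedAddCommGroup F] [InnerProductSpace ℝ F] (γ : ℝ) :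
    NetVec n F →L[ℝ] NetVec n F := mixOp ((γ / 2) • (1 - N.W) + avg n)⁻¹

theorem laplacian_isSymm (γ : ℝ) : ((γ / 2) • (1 - N.W)).IsSymm :=
  (isSymm_one.sub N.symm).smul _

/-- On a kernel vector the two nonnegative forms of the sum both vanish, and then the spectral gap
forces the vector to be zero. -/
theorem isUnit_det {γ : ℝ} (hn : 2 ≤ n) (hγ : 0 < γ) :
    IsUnit ((γ / 2) • (1 - N.W) + avg n).det := by
  rw [isUnit_iff_ne_zero, ne_eq, ← Matrix.exists_mulVec_eq_zero_iff]
  rintro ⟨x, hx0, hx⟩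
  apply hx0
  have g : 0 ≤ x ⬝ᵥ ((1 - N.W) - (1 - N.lambda2 hn) • (1 - avg n)) *ᵥ x := by
    simpa using (N.posSemidef_gap hn).dotProduct_mulVec_nonneg x
  have l := N.dotProduct_mulVec_le x
  have lt := N.lambda2_lt_one hn
  have a0 : 0 ≤ x ⬝ᵥ avg n *ᵥ x := by
    have e : avg n *ᵥ x = (1 / (n : ℝ) * (x ⬝ᵥ 1)) • 1 := by ext i; rw [avg_mulVec]; simp
    rw [e, dotProduct_smul, smul_eq_mul, mul_assoc]
    exact mul_nonneg (by positivity) (mul_self_nonneg _)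
  have t : x ⬝ᵥ ((γ / 2) • (1 - N.W) + avg n) *ᵥ x = 0 := by rw [hx, dotProduct_zero]
  simp only [add_mulVec, sub_mulVec, smul_mulVec, one_mulVec, dotProduct_sub, dotProduct_smul,
    dotProduct_add, smul_eq_mul] at g t
  have s0 : 0 ≤ γ / 2 * (x ⬝ᵥ x - x ⬝ᵥ N.W *ᵥ x) := mul_nonneg (by linarith) (by linarith)
  have a1 : x ⬝ᵥ avg n *ᵥ x = 0 := by linarith
  have s1 : γ / 2 * (x ⬝ᵥ x - x ⬝ᵥ N.W *ᵥ x) = 0 := by linarith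
  have s2 := (mul_eq_zero.1 s1).resolve_left (by linarith)
  rw [a1, s2] at g
  have xx : x ⬝ᵥ x ≤ 0 := by
    by_contra hc
    push Not at hc
    have := mul_pos (show 0 < 1 - N.lambda2 hn by linarith) hc
    linarith
  have xx0 : 0 ≤ x ⬝ᵥ x := Finset.sum_nonneg fun i _ => mul_self_nonneg _
  exact dotProduct_self_eq_zero.1 (le_antisymm xx xx0)

/-- With `A = (γ/2)(1 - W)`, `J` the averaging matrix and `T = A + J`: from `T J = J = J T` follows
`T⁻¹ A = A T⁻¹ = 1 - J`, so `T⁻¹` is a symmetric pseudo-inverse. The upper bound `A ≤ γ` is the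
positivity of `1 + W`, the lower bound is the spectral gap. -/
theorem mixingOps {γ : ℝ} (hn : 2 ≤ n) (hγ : 0 < γ) :
    MixingOps (opJ n F) (N.opM F γ) (N.opB F γ) (γ / 2 * (1 - N.lambda2 hn)) γ := by
  have hn0 : n ≠ 0 := by omega
  set A := (γ / 2) • (1 - N.W) with hA
  have hu := N.isUnit_det hn hγ
  rw [← hA] at hu
  have JA : avg n * A = 0 := by
    rw [hA, mul_smul_comm, mul_sub, mul_one, N.avg_mul_W, sub_self, smul_zero]
  have AJ : A * avg n = 0 := by
    rw [hA, smul_mul_assoc, sub_mul, one_mul, N.W_mul_avg, sub_self, smul_zero]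
  have JJ := avg_mul_avg hn0
  set T := A + avg n with hT
  have TJ : T * avg n = avg n := by rw [hT, add_mul, AJ, JJ, zero_add]
  have JT : avg n * T = avg n := by rw [hT, mul_add, JA, JJ, zero_add]
  have iJ : T⁻¹ * avg n = avg n := by
    conv_lhs => rw [← TJ]
    rw [← mul_assoc, nonsing_inv_mul _ hu, one_mul]
  have Ji : avg n * T⁻¹ = avg n := by
    conv_lhs => rw [← JT]
    rw [mul_assoc, mul_nonsing_inv _ hu, mul_one]
  have iA : T⁻¹ * A = 1 - avg n := by
    have : A = T - avg n := by rw [hT]; abel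
    rw [this, mul_sub, nonsing_inv_mul _ hu, iJ]
  have Ai : A * T⁻¹ = 1 - avg n := by
    have : A = T - avg n := by rw [hT]; abel
    rw [this, sub_mul, mul_nonsing_inv _ hu, Ji]
  have sA : A.IsSymm := N.laplacian_isSymm γ
  have sT : T.IsSymm := sA.add avg_isSymm
  have sI : (T⁻¹).IsSymm := by rw [IsSymm, transpose_nonsing_inv, sT.eq]
  have M_symm : ∀ x y : NetVec n F, ⟪N.opM F γ x, y⟫ = ⟪x, N.opM F γ y⟫ :=
    fun x y => inner_mixOp_symm sA x y
  have J_symm : ∀ x y : NetVec n F, ⟪opJ n F x, y⟫ = ⟪x, opJ n F y⟫ :=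
    fun x y => inner_mixOp_symm avg_isSymm x y
  have J_idem : ∀ x : NetVec n F, opJ n F (opJ n F x) = opJ n F x := fun x => by
    rw [opJ, ← mixOp_mul, JJ]
  have M_le : ∀ x : NetVec n F, ⟪x, N.opM F γ x⟫ ≤ γ * ‖x‖ ^ 2 := fun x => by
    have h := inner_mixOp_nonneg N.posSemidef_one_add x
    rw [mixOp_add, mixOp_one, inner_add_right, real_inner_self_eq_norm_sq] at h
    rw [opM, mixOp_smul, mixOp_sub, mixOp_one, inner_smul_right, inner_sub_right,
      real_inner_self_eq_norm_sq]
    have := mul_nonneg hγ.le h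
    linarith
  have gap : ∀ x : NetVec n F, γ / 2 * (1 - N.lambda2 hn) * ‖x - opJ n F x‖ ^ 2
      ≤ ⟪x, N.opM F γ x⟫ := fun x => by
    have h := inner_mixOp_nonneg (N.posSemidef_gap hn) x
    have e : ‖x - opJ n F x‖ ^ 2 = ⟪x, mixOp (1 - avg n) x⟫ := by
      rw [mixOp_sub, mixOp_one, inner_sub_right, real_inner_self_eq_norm_sq, norm_sub_sq_real,
        ← real_inner_self_eq_norm_sq (opJ n F x), J_symm, J_idem]
      show _ = ‖x‖ ^ 2 - ⟪x, opJ n F x⟫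
      ring
    rw [mixOp_sub, mixOp_smul, inner_sub_right, inner_smul_right, ← e] at h
    rw [opM, mixOp_smul, inner_smul_right]
    have := mul_nonneg (show 0 ≤ γ / 2 by linarith) h
    linarith
  refine ⟨J_symm, J_idem, M_symm, fun x y => inner_mixOp_symm sI x y, fun x => ?_, fun x => ?_,
    fun x => ?_, fun x => ?_, gap, ?_, M_le⟩
  · rw [opJ, opM, ← mixOp_mul, JA, mixOp_zero]
  · rw [opJ, opM, ← mixOp_mul, AJ, mixOp_zero]
  · rw [opB, opM, opJ, ← mixOp_mul, iA, mixOp_sub, mixOp_one]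
  · rw [opB, opM, opJ, ← mixOp_mul, Ai, mixOp_sub, mixOp_one]
  · refine norm_sq_le_of_bounds hγ M_symm (fun x => le_trans ?_ (gap x)) M_le
    have := N.lambda2_lt_one hn
    have : 0 ≤ γ / 2 * (1 - N.lambda2 hn) := mul_nonneg (by linarith) (by linarith)
    positivity

end Network

end Ops

/-! ### Independence of the past and the fresh randomness -/

/-- The finite family indexed by `T`, completed by constants, is independent of a member outside
of `T`. -/
theorem indepFun_of_notMem {Ω : Type*} [MeasurableSpace Ω] {P : Measure Ω} {ι : Type*} [DecidableEq ι] {β : ι → Type*}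
    [∀ i, MeasurableSpace (β i)] {f : ∀ i, Ω → β i} (hf : iIndepFun f P)
    (hm : ∀ i, Measurable (f i)) (T : Finset ι) {a : ι} (ha : a ∉ T) (w₀ : ∀ i, β i) :
    IndepFun (fun ω i => if i ∈ T then f i ω else w₀ i) (f a) P := by
  have h := hf.indepFun_finset T {a} (by simpa using ha) hm
  have hφ : Measurable fun (b : ∀ i : T, β i) (i : ι) =>
      if hi : i ∈ T then b ⟨i, hi⟩ else w₀ i := by
    rw [measurable_pi_iff]
    intro i
    by_cases hi : i ∈ T
    · simp only [hi, dite_true]; exact measurable_pi_apply _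
    · simp only [hi, dite_false]; exact measurable_const
  have hψ : Measurable fun b : ∀ i : ({a} : Finset ι), β i => b ⟨a, Finset.mem_singleton_self a⟩ :=
    measurable_pi_apply _
  have h2 := h.comp hφ hψ
  have e : (fun ω i => if i ∈ T then f i ω else w₀ i) =
      (fun (b : ∀ i : T, β i) (i : ι) => if hi : i ∈ T then b ⟨i, hi⟩ else w₀ i) ∘
        (fun ω (i : T) => f i ω) := by
    ext ω i
    by_cases hi : i ∈ T <;> simp [hi]
  rw [e]
  exact h2

section Independence

variable {Ω α β γ : Type*} [MeasurableSpace Ω] [MeasurableSpace α] [MeasurableSpace β]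
  [MeasurableSpace γ] {P : Measure Ω} [IsProbabilityMeasure P]

/-- The joint law of `f`, `g`, `h` is a product of three laws, and its factors can be rearranged.
This adjoins one whole source of randomness (`h`) to the known part (`f`) of the other. -/
theorem indepFun_prodMk_of_indepFun {f : Ω → α} {g : Ω → β} {h : Ω → γ} (hf : Measurable f)
    (hg : Measurable g) (hh : Measurable h) (hfg : IndepFun f g P)
    (hfgh : IndepFun (fun ω => (f ω, g ω)) h P) : IndepFun (fun ω => (f ω, h ω)) g P := by
  have hfh : IndepFun f h P := hfgh.comp measurable_fst measurable_id
  have : IsProbabilityMeasure (P.map f) := Measure.isProbabilityMeasure_map hf.aemeasurable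
  have : IsProbabilityMeasure (P.map g) := Measure.isProbabilityMeasure_map hg.aemeasurable
  have : IsProbabilityMeasure (P.map h) := Measure.isProbabilityMeasure_map hh.aemeasurable
  have e1 := (indepFun_iff_map_prod_eq_prod_map_map hf.aemeasurable hg.aemeasurable).1 hfg
  have e2 := (indepFun_iff_map_prod_eq_prod_map_map (hf.prodMk hg).aemeasurable
    hh.aemeasurable).1 hfgh
  have e3 := (indepFun_iff_map_prod_eq_prod_map_map hf.aemeasurable hh.aemeasurable).1 hfh
  rw [indepFun_iff_map_prod_eq_prod_map_map (hf.prodMk hh).aemeasurable hg.aemeasurable, e3]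
  rw [e1] at e2
  have mp := ((measurePreserving_prodAssoc (P.map f) (P.map h) (P.map g)).symm).comp
    (((MeasurePreserving.id (P.map f)).prod
      (Measure.measurePreserving_swap (μ := P.map g) (ν := P.map h))).comp
      (measurePreserving_prodAssoc (P.map f) (P.map g) (P.map h)))
  rw [← mp.map_eq, ← e2, Measure.map_map mp.measurable ((hf.prodMk hg).prodMk hh)]
  rfl

/-- Fubini for the product law of the past `A` and the fresh variable `B`; it replaces conditional
expectations throughout. -/
theorem integral_inner_eq_zero_of_indepFun {V : Type*} [NormedAddCommGroup V]
    [InnerProductSpace ℝ V] [CompleteSpace V] [MeasurableSpace V] [BorelSpace V]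
    [SecondCountableTopology V]
    {A : Ω → α} {B : Ω → β} (hA : Measurable A) (hB : Measurable B) (hAB : IndepFun A B P)
    {F : α → β → V} (hF : Measurable (Function.uncurry F)) {ψ : α → V} (hψ : Measurable ψ)
    (hint : ∀ a, Integrable (F a) (P.map B)) (hmean : ∀ a, ∫ b, F a b ∂(P.map B) = 0)
    (hprod : Integrable (fun ω => inner ℝ (F (A ω) (B ω)) (ψ (A ω))) P) :
    ∫ ω, inner ℝ (F (A ω) (B ω)) (ψ (A ω)) ∂P = 0 := by
  have : IsProbabilityMeasure (P.map A) := Measure.isProbabilityMeasure_map hA.aemeasurable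
  have : IsProbabilityMeasure (P.map B) := Measure.isProbabilityMeasure_map hB.aemeasurable
  have e := (indepFun_iff_map_prod_eq_prod_map_map hA.aemeasurable hB.aemeasurable).1 hAB
  set φ : α × β → ℝ := fun z => inner ℝ (F z.1 z.2) (ψ z.1) with hφ
  have hφm : Measurable φ := hF.inner (hψ.comp measurable_fst)
  have h1 : ∫ ω, inner ℝ (F (A ω) (B ω)) (ψ (A ω)) ∂P
      = ∫ z, φ z ∂(P.map fun ω => (A ω, B ω)) := by
    rw [integral_map (hA.prodMk hB).aemeasurable hφm.aestronglyMeasurable]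
  have h2 : Integrable φ ((P.map A).prod (P.map B)) := by
    rw [← e, integrable_map_measure hφm.aestronglyMeasurable (hA.prodMk hB).aemeasurable]
    exact hprod
  rw [h1, e, integral_prod _ h2]
  have h3 : ∀ a, ∫ b, φ (a, b) ∂(P.map B) = 0 := fun a => by
    simp only [hφ]
    have h4 := integral_inner (𝕜 := ℝ) (hint a) (ψ a)
    rw [hmean a, inner_zero_right] at h4
    rw [← h4]
    exact integral_congr_ae (Filter.Eventually.of_forall fun b => real_inner_comm _ _)
  simp [h3]

theorem lintegral_le_of_indepFun {A : Ω → α} {B : Ω → β} (hA : Measurable A) (hB : Measurable B)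
    (hAB : IndepFun A B P) {F : α → β → ℝ≥0∞} (hF : Measurable (Function.uncurry F))
    {φ : α → ℝ≥0∞} (hφ : Measurable φ) (h : ∀ a, ∫⁻ b, F a b ∂(P.map B) ≤ φ a) :
    ∫⁻ ω, F (A ω) (B ω) ∂P ≤ ∫⁻ ω, φ (A ω) ∂P := by
  have : IsProbabilityMeasure (P.map A) := Measure.isProbabilityMeasure_map hA.aemeasurable
  have : IsProbabilityMeasure (P.map B) := Measure.isProbabilityMeasure_map hB.aemeasurable
  have e := (indepFun_iff_map_prod_eq_prod_map_map hA.aemeasurable hB.aemeasurable).1 hAB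
  calc ∫⁻ ω, F (A ω) (B ω) ∂P = ∫⁻ z, Function.uncurry F z ∂(P.map fun ω => (A ω, B ω)) := by
        rw [lintegral_map hF (hA.prodMk hB)]; rfl
    _ = ∫⁻ a, ∫⁻ b, F a b ∂(P.map B) ∂(P.map A) := by
        rw [e, lintegral_prod _ hF.aemeasurable]; rfl
    _ ≤ ∫⁻ a, φ a ∂(P.map A) := lintegral_mono h
    _ = ∫⁻ ω, φ (A ω) ∂P := lintegral_map hφ hA

end Independence

/-! ### The induced compressor -/

theorem lintegral_enorm_sq_ne_top_integrable {Ω V : Type*} [MeasurableSpace Ω] {P : Measure Ω}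
    [IsFiniteMeasure P] [NormedAddCommGroup V] {f : Ω → V} (hf : AEStronglyMeasurable f P)
    (h : ∫⁻ ω, ‖f ω‖ₑ ^ 2 ∂P < ∞) : MemLp f 2 P := by
  refine ⟨hf, ?_⟩
  rw [eLpNorm_lt_top_iff_lintegral_rpow_enorm_lt_top (by norm_num) (by norm_num)]
  simpa using h

theorem Compressor.measurable_map_left {p : ℕ} (𝒞 : Compressor.{u} p) (x : Vec p) :
    Measurable fun s => 𝒞.map s x :=
  𝒞.measurable_map.comp (measurable_id.prodMk measurable_const)

/-- The error at `x` is the error of `𝒞₂` at the residual `x - 𝒞₁(x)`. Integrating first over the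
seed of `𝒞₂` gives mean zero and the factor `C`; the residual then gives `1 - δ`. -/
theorem Compressor.IsBiased.induced_isUnbiased {p : ℕ} {𝒞₁ 𝒞₂ : Compressor.{u} p} {δ C : ℝ}
    (h₁ : 𝒞₁.IsBiased δ) (h₂ : 𝒞₂.IsUnbiased C) (hC : 0 < C * (1 - δ)) :
    (𝒞₁.induced 𝒞₂).IsUnbiased (C * (1 - δ)) := by
  have meas : ∀ x, Measurable fun s : 𝒞₁.Seed × 𝒞₂.Seed => (𝒞₁.induced 𝒞₂).map s x :=
    fun x => (𝒞₁.induced 𝒞₂).measurable_map_left x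
  have var : ∀ x, ∫⁻ s, ‖(𝒞₁.induced 𝒞₂).map s x - x‖ₑ ^ 2 ∂(𝒞₁.law.prod 𝒞₂.law)
      ≤ ENNReal.ofReal (C * (1 - δ) * ‖x‖ ^ 2) := fun x => by
    have hm : Measurable fun s : 𝒞₁.Seed × 𝒞₂.Seed => ‖(𝒞₁.induced 𝒞₂).map s x - x‖ₑ ^ 2 :=
      ((meas x).sub_const x).enorm.pow_const 2
    rw [lintegral_prod _ hm.aemeasurable]
    calc ∫⁻ s₁, ∫⁻ s₂, ‖(𝒞₁.induced 𝒞₂).map (s₁, s₂) x - x‖ₑ ^ 2 ∂𝒞₂.law ∂𝒞₁.law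
        ≤ ∫⁻ s₁, ENNReal.ofReal C * ‖𝒞₁.map s₁ x - x‖ₑ ^ 2 ∂𝒞₁.law := by
          refine lintegral_mono fun s₁ => ?_
          have h := h₂.variance (x - 𝒞₁.map s₁ x)
          have e : ∀ s₂, (𝒞₁.induced 𝒞₂).map (s₁, s₂) x - x
              = 𝒞₂.map s₂ (x - 𝒞₁.map s₁ x) - (x - 𝒞₁.map s₁ x) := fun s₂ => by
            show 𝒞₁.map s₁ x + 𝒞₂.map s₂ (x - 𝒞₁.map s₁ x) - x = _
            abel
          simp only [e]
          refine h.trans ?_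
          rw [ENNReal.ofReal_mul h₂.pos.le, ENNReal.ofReal_pow (norm_nonneg _), ofReal_norm,
            ← enorm_neg, neg_sub]
      _ = ENNReal.ofReal C * ∫⁻ s₁, ‖𝒞₁.map s₁ x - x‖ₑ ^ 2 ∂𝒞₁.law := by
          rw [lintegral_const_mul']; exact ENNReal.ofReal_ne_top
      _ ≤ ENNReal.ofReal C * ENNReal.ofReal ((1 - δ) * ‖x‖ ^ 2) := by gcongr; exact h₁.error x
      _ = ENNReal.ofReal (C * (1 - δ) * ‖x‖ ^ 2) := by
          rw [← ENNReal.ofReal_mul h₂.pos.le, mul_assoc]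
  have int : ∀ x, Integrable (fun s => (𝒞₁.induced 𝒞₂).map s x) (𝒞₁.law.prod 𝒞₂.law) := fun x => by
    have h := lintegral_enorm_sq_ne_top_integrable ((meas x).sub_const x).aestronglyMeasurable
      ((var x).trans_lt ENNReal.ofReal_lt_top)
    have h2 := (h.integrable one_le_two).add (integrable_const x)
    exact h2.congr (Filter.Eventually.of_forall fun s => by simp)
  refine ⟨hC, int, fun x => ?_, var⟩
  have h1 : Integrable (fun s => 𝒞₁.map s x) 𝒞₁.law := by
    have h := lintegral_enorm_sq_ne_top_integrable
      ((𝒞₁.measurable_map_left x).sub_const x).aestronglyMeasurable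
      ((h₁.error x).trans_lt ENNReal.ofReal_lt_top)
    have h2 := (h.integrable one_le_two).add (integrable_const x)
    exact h2.congr (Filter.Eventually.of_forall fun s => by simp)
  show ∫ s, (𝒞₁.induced 𝒞₂).map s x ∂(𝒞₁.law.prod 𝒞₂.law) = x
  rw [integral_prod _ (int x)]
  have e : ∀ s₁, ∫ s₂, (𝒞₁.induced 𝒞₂).map (s₁, s₂) x ∂𝒞₂.law = x := fun s₁ => by
    show ∫ s₂, (𝒞₁.map s₁ x + 𝒞₂.map s₂ (x - 𝒞₁.map s₁ x)) ∂𝒞₂.law = x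
    rw [integral_add (integrable_const _) (h₂.integrable _), h₂.mean]
    simp
  simp [e]

/-! ### The stochastic model -/

/-- The data of the algorithm together with the assumptions on its randomness. -/
structure Model (n p : ℕ) {Ω : Type u} (Ξ : Type u) [MeasurableSpace Ω] [MeasurableSpace Ξ]
    (P : Measure Ω) where
  W : Matrix (Fin n) (Fin n) ℝ
  γ : ℝ
  α : ℝ
  η : ℤ → ℝ
  f : Fin n → Vec p → ℝ
  grad : Fin n → Vec p → Ξ → Vec p
  𝒞 : Compressor.{u} p
  xm : Fin n → Vec p
  ξ : Fin n → ℕ → Ω → Ξ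
  s : Fin n → ℕ → Ω → 𝒞.Seed
  L : ℝ
  σ : ℝ
  c : ℝ
  lip : ∀ i x x', ‖gradient (f i) x - gradient (f i) x'‖ ≤ L * ‖x - x'‖
  sg : StochasticGradient P f grad ξ σ
  fs : FreshSeeds P 𝒞 s
  unb : 𝒞.IsUnbiased c
  indep : IndepFun (fun ω (a : Fin n × ℕ) => ξ a.1 a.2 ω) (fun ω (a : Fin n × ℕ) => s a.1 a.2 ω) P

namespace Model

variable {n p : ℕ} {Ω Ξ : Type u} [MeasurableSpace Ω] [MeasurableSpace Ξ] {P : Measure Ω}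
  (S : Model n p Ξ P)

/-- Realizations of all samples and seeds. -/
abbrev Path : Type u := (Fin n × ℕ → Ξ) × (Fin n × ℕ → S.𝒞.Seed)

/-- The state at time `k` along a realization. -/
noncomputable def path (w : S.Path) (k : ℕ) : State n p :=
  run S.W S.γ S.α S.η S.grad S.𝒞 S.xm S.xm (fun i t => w.1 (i, t)) (fun i t => w.2 (i, t)) k

/-- Sampled gradients. -/
noncomputable def g (k : ℕ) (i : Fin n) (w : S.Path) : Vec p :=
  S.grad i ((S.path w k).x i) (w.1 (i, k + 1))

/-- Exact gradients. -/
noncomputable def G (k : ℕ) (i : Fin n) (w : S.Path) : Vec p := gradient (S.f i) ((S.path w k).x i)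

/-- Gradient noise. -/
noncomputable def ε (k : ℕ) (i : Fin n) (w : S.Path) : Vec p := S.g k i w - S.G k i w

/-- The vectors to be communicated. -/
noncomputable def y (k : ℕ) (i : Fin n) (w : S.Path) : Vec p :=
  (S.path w k).x i - S.η k • S.g k i w - (S.path w k).d i

/-- The vectors to be compressed. -/
noncomputable def r (k : ℕ) (i : Fin n) (w : S.Path) : Vec p := S.y k i w - (S.path w k).h i

/-- Compression errors. -/
noncomputable def e (k : ℕ) (i : Fin n) (w : S.Path) : Vec p :=
  S.𝒞.map (w.2 (i, k)) (S.r k i w) - S.r k i w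

theorem path_zero_x (w : S.Path) (i : Fin n) :
    (S.path w 0).x i = S.xm i - S.η (-1) • S.grad i (S.xm i) (w.1 (i, 0)) := rfl

theorem path_zero_d (w : S.Path) (i : Fin n) : (S.path w 0).d i = 0 := rfl

/-- The locally maintained `hw` is always `W h`. Therefore the communicated difference is `(1 - W)(y
+ e)` and the dual step is an application of `M`. -/
theorem hw_eq (w : S.Path) (k : ℕ) (i : Fin n) :
    (S.path w k).hw i = ∑ j, S.W i j • (S.path w k).h j := by
  induction k with
  | zero => rfl
  | succ k ih =>
    show (1 - S.α) • (S.path w k).hw i + S.α • ((S.path w k).hw i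
        + ∑ j, S.W i j • S.𝒞.map (w.2 (j, k)) (S.r k j w))
      = ∑ j, S.W i j • ((1 - S.α) • (S.path w k).h j
        + S.α • ((S.path w k).h j + S.𝒞.map (w.2 (j, k)) (S.r k j w)))
    rw [ih]
    simp only [smul_add, Finset.sum_add_distrib, Finset.smul_sum, smul_comm (S.W i _)]

theorem path_succ_d (w : S.Path) (k : ℕ) (i : Fin n) :
    (S.path w (k + 1)).d i = (S.path w k).d i
      + (S.γ / 2) • ((S.y k i w + S.e k i w) - ∑ j, S.W i j • (S.y k j w + S.e k j w)) := by
  show (S.path w k).d i + (S.γ / 2) • (((S.path w k).h i + S.𝒞.map (w.2 (i, k)) (S.r k i w))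
    - ((S.path w k).hw i + ∑ j, S.W i j • S.𝒞.map (w.2 (j, k)) (S.r k j w))) = _
  have e1 : ∀ j, S.y k j w + S.e k j w
      = (S.path w k).h j + S.𝒞.map (w.2 (j, k)) (S.r k j w) := fun j => by
    simp only [e, r]; abel
  simp only [e1, S.hw_eq, smul_add, Finset.sum_add_distrib]

theorem path_succ_x (w : S.Path) (k : ℕ) (i : Fin n) :
    (S.path w (k + 1)).x i = S.y k i w
      - (S.γ / 2) • ((S.y k i w + S.e k i w) - ∑ j, S.W i j • (S.y k j w + S.e k j w)) := by
  have : (S.path w (k + 1)).x i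
      = (S.path w k).x i - S.η k • S.g k i w - (S.path w (k + 1)).d i := rfl
  rw [this, path_succ_d]
  nth_rw 2 [y]
  abel

theorem path_succ_h (w : S.Path) (k : ℕ) (i : Fin n) :
    (S.path w (k + 1)).h i = (S.path w k).h i + S.α • (S.r k i w + S.e k i w) := by
  show (1 - S.α) • (S.path w k).h i
    + S.α • ((S.path w k).h i + S.𝒞.map (w.2 (i, k)) (S.r k i w)) = _
  simp only [e, sub_smul, one_smul, smul_add, add_sub_cancel]
  abel

/-- Causality. Sample indices run one ahead of iterations, so the state at time `k` uses samples up
to index `k` but seeds strictly before `k`. -/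
theorem path_congr {w w' : S.Path} {k : ℕ} (h1 : ∀ i t, t ≤ k → w.1 (i, t) = w'.1 (i, t))
    (h2 : ∀ i t, t < k → w.2 (i, t) = w'.2 (i, t)) : S.path w k = S.path w' k := by
  induction k with
  | zero =>
    show init _ _ _ _ _ = init _ _ _ _ _
    simp only [h1 _ 0 le_rfl]
  | succ k ih =>
    have ih' := ih (fun i t ht => h1 i t (by omega)) (fun i t ht => h2 i t (by omega))
    show step _ _ _ _ _ _ (S.path w k) = step _ _ _ _ _ _ (S.path w' k)
    rw [ih']
    have e1 : ∀ i, w.1 (i, k + 1) = w'.1 (i, k + 1) := fun i => h1 i _ le_rfl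
    have e2 : ∀ i, w.2 (i, k) = w'.2 (i, k) := fun i => h2 i _ (by omega)
    simp only [e1, e2]
    congr 1
    funext i
    exact congrArg (fun Z : State n p => S.grad i (Z.x i) (w'.1 (i, k + 1))) ih'

/-! #### Measurability -/

theorem measurable_gradient (i : Fin n) : Measurable (gradient (S.f i)) := by
  apply Continuous.measurable
  have : LipschitzWith (Real.toNNReal S.L) (gradient (S.f i)) :=
    LipschitzWith.of_dist_le_mul fun x y => by
      rw [dist_eq_norm, dist_eq_norm]
      refine (S.lip i x y).trans ?_
      gcongr
      exact Real.le_coe_toNNReal _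
  exact this.continuous

theorem measurable_sample_coord (a : Fin n × ℕ) : Measurable fun w : S.Path => w.1 a :=
  (measurable_pi_apply a).comp measurable_fst

theorem measurable_seed_coord (a : Fin n × ℕ) : Measurable fun w : S.Path => w.2 a :=
  (measurable_pi_apply a).comp measurable_snd

theorem measurable_g_of (k : ℕ) (i : Fin n) (hx : Measurable fun w => (S.path w k).x i) :
    Measurable (S.g k i) :=
  (S.sg.measurable_grad i).comp (hx.prodMk (S.measurable_sample_coord _))

theorem measurable_y_of (k : ℕ) (i : Fin n) (hx : Measurable fun w => (S.path w k).x i)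
    (hd : Measurable fun w => (S.path w k).d i) : Measurable (S.y k i) := by
  have hg := S.measurable_g_of k i hx
  have : S.y k i = fun w => (S.path w k).x i - S.η k • S.g k i w - (S.path w k).d i := rfl
  rw [this]
  exact (hx.sub (hg.const_smul (S.η k))).sub hd

theorem measurable_r_of (k : ℕ) (i : Fin n) (hy : Measurable (S.y k i))
    (hh : Measurable fun w => (S.path w k).h i) : Measurable (S.r k i) := hy.sub hh

theorem measurable_e_of (k : ℕ) (i : Fin n) (hr : Measurable (S.r k i)) :
    Measurable (S.e k i) :=
  (S.𝒞.measurable_map.comp ((S.measurable_seed_coord (i, k)).prodMk hr)).sub hr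

theorem measurable_path (k : ℕ) (i : Fin n) : (Measurable fun w => (S.path w k).x i) ∧
    (Measurable fun w => (S.path w k).d i) ∧ (Measurable fun w => (S.path w k).h i) := by
  induction k generalizing i with
  | zero =>
    refine ⟨?_, measurable_const, measurable_const⟩
    simp only [path_zero_x]
    have h : Measurable fun w : S.Path => S.grad i (S.xm i) (w.1 (i, 0)) :=
      (S.sg.measurable_grad i).comp (measurable_const.prodMk (S.measurable_sample_coord _))
    fun_prop
  | succ k ih =>
    have hy := fun j => S.measurable_y_of k j (ih j).1 (ih j).2.1
    have hr := fun j => S.measurable_r_of k j (hy j) (ih j).2.2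
    have he := fun j => S.measurable_e_of k j (hr j)
    have hd := (ih i).2.1
    have hh := (ih i).2.2
    refine ⟨?_, ?_, ?_⟩
    · simp only [path_succ_x]; fun_prop
    · simp only [path_succ_d]; fun_prop
    · simp only [path_succ_h]; fun_prop

theorem measurable_x (k : ℕ) (i : Fin n) : Measurable fun w => (S.path w k).x i :=
  (S.measurable_path k i).1

theorem measurable_d (k : ℕ) (i : Fin n) : Measurable fun w => (S.path w k).d i :=
  (S.measurable_path k i).2.1

theorem measurable_h (k : ℕ) (i : Fin n) : Measurable fun w => (S.path w k).h i :=
  (S.measurable_path k i).2.2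

theorem measurable_g (k : ℕ) (i : Fin n) : Measurable (S.g k i) :=
  S.measurable_g_of k i (S.measurable_x k i)

theorem measurable_G (k : ℕ) (i : Fin n) : Measurable (S.G k i) :=
  (S.measurable_gradient i).comp (S.measurable_x k i)

theorem measurable_ε (k : ℕ) (i : Fin n) : Measurable (S.ε k i) :=
  (S.measurable_g k i).sub (S.measurable_G k i)

theorem measurable_y (k : ℕ) (i : Fin n) : Measurable (S.y k i) :=
  S.measurable_y_of k i (S.measurable_x k i) (S.measurable_d k i)

theorem measurable_r (k : ℕ) (i : Fin n) : Measurable (S.r k i) :=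
  S.measurable_r_of k i (S.measurable_y k i) (S.measurable_h k i)

theorem measurable_e (k : ℕ) (i : Fin n) : Measurable (S.e k i) :=
  S.measurable_e_of k i (S.measurable_r k i)

/-- The realization at a point of the probability space. -/
def sample (ω : Ω) : S.Path := (fun a => S.ξ a.1 a.2 ω, fun a => S.s a.1 a.2 ω)

theorem measurable_sample : Measurable S.sample :=
  (measurable_pi_iff.2 fun a : Fin n × ℕ => S.sg.measurable_sample a.1 a.2).prodMk
    (measurable_pi_iff.2 fun a : Fin n × ℕ => S.fs.measurable a.1 a.2)

/-! #### Fresh randomness -/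

/-- The sample of agent `i` at iteration `k` and all later samples are replaced by constants. -/
noncomputable def cutSample (k : ℕ) (i : Fin n) (w₀ w : S.Path) : S.Path :=
  (fun a => if a ∈ (Finset.univ ×ˢ Finset.range (k + 2)).erase (i, k + 1) then w.1 a else w₀.1 a,
    w.2)

/-- The seeds from iteration `k` on are replaced by constants. -/
def cutSeed (k : ℕ) (w₀ w : S.Path) : S.Path :=
  (w.1, fun a => if a.2 < k then w.2 a else w₀.2 a)

theorem path_cutSample (k : ℕ) (i : Fin n) (w₀ w : S.Path) :
    S.path (S.cutSample k i w₀ w) k = S.path w k := by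
  refine S.path_congr (fun j t ht => ?_) (fun j t ht => rfl)
  have : (j, t) ∈ (Finset.univ ×ˢ Finset.range (k + 2)).erase (i, k + 1) := by
    simp; omega
  simp only [cutSample, if_pos this]

theorem path_cutSeed (k : ℕ) (w₀ w : S.Path) : S.path (S.cutSeed k w₀ w) k = S.path w k := by
  refine S.path_congr (fun j t ht => rfl) (fun j t ht => ?_)
  simp only [cutSeed, if_pos ht]

/-- The cut removes the fresh sample of agent `i` only, so the noise of any other agent in the same
iteration counts as known. This yields the orthogonality of noises across agents. -/
theorem ε_cutSample (k : ℕ) {i j : Fin n} (hij : j ≠ i) (w₀ w : S.Path) :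
    S.ε k j (S.cutSample k i w₀ w) = S.ε k j w := by
  have : (j, k + 1) ∈ (Finset.univ ×ˢ Finset.range (k + 2)).erase (i, k + 1) := by
    simp [hij]
  have h2 : (S.cutSample k i w₀ w).1 (j, k + 1) = w.1 (j, k + 1) := by
    simp only [cutSample, if_pos this]
  simp only [ε, g, G, S.path_cutSample, h2]

theorem y_cutSeed (k : ℕ) (i : Fin n) (w₀ w : S.Path) :
    S.y k i (S.cutSeed k w₀ w) = S.y k i w := by
  have h2 : (S.cutSeed k w₀ w).1 = w.1 := rfl
  simp only [y, g, S.path_cutSeed, h2]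

theorem r_cutSeed (k : ℕ) (i : Fin n) (w₀ w : S.Path) :
    S.r k i (S.cutSeed k w₀ w) = S.r k i w := by
  simp only [r, S.y_cutSeed, S.path_cutSeed]

theorem measurable_cutSample (k : ℕ) (i : Fin n) (w₀ : S.Path) :
    Measurable (S.cutSample k i w₀) := by
  refine Measurable.prodMk (measurable_pi_iff.2 fun a => ?_) measurable_snd
  by_cases h : a ∈ (Finset.univ ×ˢ Finset.range (k + 2)).erase (i, k + 1)
  · simp only [if_pos h]; exact S.measurable_sample_coord a
  · simp only [if_neg h]; exact measurable_const

theorem measurable_cutSeed (k : ℕ) (w₀ : S.Path) : Measurable (S.cutSeed k w₀) := by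
  refine Measurable.prodMk measurable_fst (measurable_pi_iff.2 fun a => ?_)
  by_cases h : a.2 < k
  · simp only [if_pos h]; exact S.measurable_seed_coord a
  · simp only [if_neg h]; exact measurable_const

variable [IsProbabilityMeasure P]

/-- The fresh sample is independent of the finitely many other samples that are kept, and all
samples are jointly independent of the seeds. -/
theorem indepFun_cutSample (k : ℕ) (i : Fin n) (w₀ : S.Path) :
    IndepFun (fun ω => S.cutSample k i w₀ (S.sample ω)) (S.ξ i (k + 1)) P := by
  set T := (Finset.univ ×ˢ Finset.range (k + 2)).erase (i, k + 1) with hT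
  have hm : ∀ a : Fin n × ℕ, Measurable (S.ξ a.1 a.2) := fun a => S.sg.measurable_sample a.1 a.2
  have h1 := indepFun_of_notMem S.sg.indep hm T (a := (i, k + 1)) (by simp [hT]) w₀.1
  have cm : Measurable fun (b : Fin n × ℕ → Ξ) (a : Fin n × ℕ) => if a ∈ T then b a else w₀.1 a := by
    refine measurable_pi_iff.2 fun a => ?_
    by_cases h : a ∈ T
    · simp only [if_pos h]; exact measurable_pi_apply a
    · simp only [if_neg h]; exact measurable_const
  have h2 := S.indep.comp (cm.prodMk (measurable_pi_apply (i, k + 1))) measurable_id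
  exact indepFun_prodMk_of_indepFun (cm.comp (measurable_pi_iff.2 hm)) (hm (i, k + 1))
    (measurable_pi_iff.2 fun a : Fin n × ℕ => S.fs.measurable a.1 a.2) h1 h2

/-- Seeds are grouped by iteration and all agents' seeds from time `k` on are removed, since those
of one iteration may depend on each other. All samples may be kept. -/
theorem indepFun_cutSeed (k : ℕ) (i : Fin n) (w₀ : S.Path) :
    IndepFun (fun ω => S.cutSeed k w₀ (S.sample ω)) (S.s i k) P := by
  have hm : ∀ a : Fin n × ℕ, Measurable (S.s a.1 a.2) := fun a => S.fs.measurable a.1 a.2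
  have h0 := indepFun_of_notMem S.fs.indep (fun t => measurable_pi_iff.2 fun i => S.fs.measurable i t)
    (Finset.range k) (a := k) (by simp) (fun t i => w₀.2 (i, t))
  have hφ : Measurable fun (b : ℕ → Fin n → S.𝒞.Seed) (a : Fin n × ℕ) => b a.2 a.1 :=
    measurable_pi_iff.2 fun a => (measurable_pi_apply a.1).comp (measurable_pi_apply a.2)
  have h1 := h0.comp hφ (measurable_pi_apply i)
  have cm : Measurable fun (b : Fin n × ℕ → S.𝒞.Seed) (a : Fin n × ℕ) =>
      if a.2 < k then b a else w₀.2 a := by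
    refine measurable_pi_iff.2 fun a => ?_
    by_cases h : a.2 < k
    · simp only [if_pos h]; exact measurable_pi_apply a
    · simp only [if_neg h]; exact measurable_const
  have e1 : ((fun (b : ℕ → Fin n → S.𝒞.Seed) (a : Fin n × ℕ) => b a.2 a.1) ∘
      fun ω t => if t ∈ Finset.range k then (fun i => S.s i t ω) else fun i => w₀.2 (i, t))
      = fun ω (a : Fin n × ℕ) => if a.2 < k then S.s a.1 a.2 ω else w₀.2 a := by
    funext ω a
    by_cases h : a.2 < k <;> simp [h]
  have h3 : IndepFun (fun ω (a : Fin n × ℕ) => if a.2 < k then S.s a.1 a.2 ω else w₀.2 a)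
      (S.s i k) P := by
    rw [← e1]; exact h1
  have h2 := S.indep.symm.comp (cm.prodMk (measurable_pi_apply (i, k))) measurable_id
  have h4 := indepFun_prodMk_of_indepFun (cm.comp (measurable_pi_iff.2 hm)) (hm (i, k))
    (h := fun ω (a : Fin n × ℕ) => S.ξ a.1 a.2 ω)
    (measurable_pi_iff.2 fun a : Fin n × ℕ => S.sg.measurable_sample a.1 a.2) h3 h2
  exact h4.comp measurable_swap measurable_id

theorem noise_integral_inner (k : ℕ) (i : Fin n) {ψ : S.Path → Vec p} (hψ : Measurable ψ)
    (hcut : ∀ w₀ w, ψ (S.cutSample k i w₀ w) = ψ w)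
    (hint : Integrable (fun ω => inner ℝ (S.ε k i (S.sample ω)) (ψ (S.sample ω))) P) :
    ∫ ω, inner ℝ (S.ε k i (S.sample ω)) (ψ (S.sample ω)) ∂P = 0 := by
  -- The constants that fill the cut coordinates are taken from a point of the probability space, as
  -- the sample and seed spaces have no distinguished element.
  obtain ⟨ω₀⟩ : Nonempty Ω := P.nonempty_of_neZero
  set w₀ := S.sample ω₀
  set F : S.Path → Ξ → Vec p := fun w z =>
    S.grad i ((S.path w k).x i) z - gradient (S.f i) ((S.path w k).x i) with hF
  have hFm : Measurable (Function.uncurry F) :=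
    ((S.sg.measurable_grad i).comp (((S.measurable_x k i).comp measurable_fst).prodMk
      measurable_snd)).sub ((S.measurable_G k i).comp measurable_fst)
  have eF : ∀ ω, S.ε k i (S.sample ω)
      = F (S.cutSample k i w₀ (S.sample ω)) (S.ξ i (k + 1) ω) := fun ω => by
    simp only [hF, ε, g, G, S.path_cutSample]; rfl
  have hξ := S.sg.measurable_sample i (k + 1)
  have gm : ∀ x, Measurable fun z => S.grad i x z := fun x =>
    (S.sg.measurable_grad i).comp (measurable_const.prodMk measurable_id)
  have gint : ∀ x, Integrable (fun z => S.grad i x z) (P.map (S.ξ i (k + 1))) := fun x => by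
    rw [integrable_map_measure (gm x).aestronglyMeasurable hξ.aemeasurable]
    exact S.sg.integrable i (k + 1) x
  have : IsProbabilityMeasure (P.map (S.ξ i (k + 1))) :=
    Measure.isProbabilityMeasure_map hξ.aemeasurable
  have key := integral_inner_eq_zero_of_indepFun
    ((S.measurable_cutSample k i w₀).comp S.measurable_sample) hξ
    (S.indepFun_cutSample k i w₀) hFm hψ
    (fun w => (gint _).sub (integrable_const _))
    (fun w => by
      rw [integral_sub (gint _) (integrable_const _), integral_map hξ.aemeasurable
        (gm _).aestronglyMeasurable, S.sg.mean]
      simp) ?_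
  · simpa only [Function.comp_apply, ← eF, hcut] using key
  · simpa only [Function.comp_apply, ← eF, hcut] using hint

theorem noise_lintegral_le (k : ℕ) (i : Fin n) :
    ∫⁻ ω, ‖S.ε k i (S.sample ω)‖ₑ ^ 2 ∂P ≤ ENNReal.ofReal (S.σ ^ 2) := by
  obtain ⟨ω₀⟩ : Nonempty Ω := P.nonempty_of_neZero
  set w₀ := S.sample ω₀
  set F : S.Path → Ξ → Vec p := fun w z =>
    S.grad i ((S.path w k).x i) z - gradient (S.f i) ((S.path w k).x i) with hF
  have hFm : Measurable (Function.uncurry F) :=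
    ((S.sg.measurable_grad i).comp (((S.measurable_x k i).comp measurable_fst).prodMk
      measurable_snd)).sub ((S.measurable_G k i).comp measurable_fst)
  have eF : ∀ ω, S.ε k i (S.sample ω)
      = F (S.cutSample k i w₀ (S.sample ω)) (S.ξ i (k + 1) ω) := fun ω => by
    simp only [hF, ε, g, G, S.path_cutSample]; rfl
  have hξ := S.sg.measurable_sample i (k + 1)
  have key := lintegral_le_of_indepFun
    ((S.measurable_cutSample k i w₀).comp S.measurable_sample) hξ
    (S.indepFun_cutSample k i w₀) (F := fun w z => ‖F w z‖ₑ ^ 2) (hFm.enorm.pow_const 2)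
    (φ := fun _ => ENNReal.ofReal (S.σ ^ 2)) measurable_const (fun w => by
      have hm : Measurable fun z => ‖F w z‖ₑ ^ 2 :=
        ((hFm.comp (measurable_const.prodMk measurable_id)).enorm.pow_const 2)
      rw [lintegral_map hm hξ]
      exact S.sg.variance i (k + 1) _)
  simpa only [Function.comp_apply, ← eF, lintegral_const, measure_univ, mul_one] using key

theorem compression_integral_inner (k : ℕ) (i : Fin n) {ψ : S.Path → Vec p} (hψ : Measurable ψ)
    (hcut : ∀ w₀ w, ψ (S.cutSeed k w₀ w) = ψ w)
    (hint : Integrable (fun ω => inner ℝ (S.e k i (S.sample ω)) (ψ (S.sample ω))) P) :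
    ∫ ω, inner ℝ (S.e k i (S.sample ω)) (ψ (S.sample ω)) ∂P = 0 := by
  obtain ⟨ω₀⟩ : Nonempty Ω := P.nonempty_of_neZero
  set w₀ := S.sample ω₀
  set F : S.Path → S.𝒞.Seed → Vec p := fun w z => S.𝒞.map z (S.r k i w) - S.r k i w with hF
  have hFm : Measurable (Function.uncurry F) :=
    (S.𝒞.measurable_map.comp (measurable_snd.prodMk
      ((S.measurable_r k i).comp measurable_fst))).sub ((S.measurable_r k i).comp measurable_fst)
  have eF : ∀ ω, S.e k i (S.sample ω)
      = F (S.cutSeed k w₀ (S.sample ω)) (S.s i k ω) := fun ω => by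
    simp only [hF, e, S.r_cutSeed]; rfl
  have key := integral_inner_eq_zero_of_indepFun
    ((S.measurable_cutSeed k w₀).comp S.measurable_sample) (S.fs.measurable i k)
    (S.indepFun_cutSeed k i w₀) hFm hψ
    (fun w => by
      rw [S.fs.law_eq]
      exact (S.unb.integrable _).sub (integrable_const _))
    (fun w => by
      rw [S.fs.law_eq, integral_sub (S.unb.integrable _) (integrable_const _), S.unb.mean]
      simp) ?_
  · simpa only [Function.comp_apply, ← eF, hcut] using key
  · simpa only [Function.comp_apply, ← eF, hcut] using hint

theorem compression_lintegral_le (k : ℕ) (i : Fin n) :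
    ∫⁻ ω, ‖S.e k i (S.sample ω)‖ₑ ^ 2 ∂P
      ≤ ENNReal.ofReal S.c * ∫⁻ ω, ‖S.r k i (S.sample ω)‖ₑ ^ 2 ∂P := by
  obtain ⟨ω₀⟩ : Nonempty Ω := P.nonempty_of_neZero
  set w₀ := S.sample ω₀
  set F : S.Path → S.𝒞.Seed → Vec p := fun w z => S.𝒞.map z (S.r k i w) - S.r k i w with hF
  have hFm : Measurable (Function.uncurry F) :=
    (S.𝒞.measurable_map.comp (measurable_snd.prodMk
      ((S.measurable_r k i).comp measurable_fst))).sub ((S.measurable_r k i).comp measurable_fst)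
  have eF : ∀ ω, S.e k i (S.sample ω)
      = F (S.cutSeed k w₀ (S.sample ω)) (S.s i k ω) := fun ω => by
    simp only [hF, e, S.r_cutSeed]; rfl
  have hm : Measurable fun w => ENNReal.ofReal S.c * ‖S.r k i w‖ₑ ^ 2 :=
    ((S.measurable_r k i).enorm.pow_const 2).const_mul _
  have key := lintegral_le_of_indepFun
    ((S.measurable_cutSeed k w₀).comp S.measurable_sample) (S.fs.measurable i k)
    (S.indepFun_cutSeed k i w₀) (F := fun w z => ‖F w z‖ₑ ^ 2) (hFm.enorm.pow_const 2)
    (φ := fun w => ENNReal.ofReal S.c * ‖S.r k i w‖ₑ ^ 2) hm (fun w => by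
      rw [S.fs.law_eq]
      refine (S.unb.variance _).trans (le_of_eq ?_)
      rw [ENNReal.ofReal_mul S.unb.pos.le, ENNReal.ofReal_pow (norm_nonneg _), ofReal_norm])
  simp only [Function.comp_apply, ← eF, S.r_cutSeed] at key
  rwa [lintegral_const_mul' _ _ ENNReal.ofReal_ne_top] at key

end Model

/-! ### Square integrable network states -/

section Lift

set_option linter.unusedSectionVars false

variable {Ω : Type*} [MeasurableSpace Ω] {P : Measure Ω} {V : Type*} [NormedAddCommGroup V]
  [InnerProductSpace ℝ V]

open Classical in
/-- The class in `L²` of a random vector, `0` if it is not square integrable. -/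
noncomputable def toL2 (P : Measure Ω) (f : Ω → V) : Lp V 2 P :=
  if h : MemLp f 2 P then h.toLp f else 0

theorem toL2_eq {f : Ω → V} (h : MemLp f 2 P) : toL2 P f = h.toLp f := dif_pos h

theorem coeFn_toL2 {f : Ω → V} (h : MemLp f 2 P) : toL2 P f =ᵐ[P] f := by
  rw [toL2_eq h]; exact h.coeFn_toLp

theorem inner_toL2 {f g : Ω → V} (hf : MemLp f 2 P) (hg : MemLp g 2 P) :
    inner ℝ (toL2 P f) (toL2 P g) = ∫ ω, inner ℝ (f ω) (g ω) ∂P := by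
  rw [L2.inner_def]
  refine integral_congr_ae ?_
  filter_upwards [coeFn_toL2 hf, coeFn_toL2 hg] with ω h1 h2
  rw [h1, h2]

theorem integrable_inner_of_memLp {f g : Ω → V} (hf : MemLp f 2 P) (hg : MemLp g 2 P) :
    Integrable (fun ω => inner ℝ (f ω) (g ω)) P := by
  refine (L2.integrable_inner (𝕜 := ℝ) (toL2 P f) (toL2 P g)).congr ?_
  filter_upwards [coeFn_toL2 hf, coeFn_toL2 hg] with ω h1 h2
  rw [h1, h2]

theorem ofReal_norm_toL2_sq {f : Ω → V} (hf : MemLp f 2 P) :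
    ENNReal.ofReal (‖toL2 P f‖ ^ 2) = ∫⁻ ω, ‖f ω‖ₑ ^ 2 ∂P := by
  rw [toL2_eq hf, Lp.norm_toLp, ENNReal.ofReal_pow ENNReal.toReal_nonneg,
    ENNReal.ofReal_toReal hf.eLpNorm_ne_top,
    eLpNorm_eq_lintegral_rpow_enorm_toReal (by norm_num) (by norm_num)]
  simp only [ENNReal.toReal_ofNat, ENNReal.rpow_ofNat, one_div]
  rw [← ENNReal.rpow_natCast, ← ENNReal.rpow_mul]
  norm_num

theorem norm_toL2_sq_le {f : Ω → V} (hf : MemLp f 2 P) {a : ℝ} (ha : 0 ≤ a)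
    (h : ∫⁻ ω, ‖f ω‖ₑ ^ 2 ∂P ≤ ENNReal.ofReal a) : ‖toL2 P f‖ ^ 2 ≤ a := by
  rwa [← ofReal_norm_toL2_sq hf, ENNReal.ofReal_le_ofReal_iff ha] at h

variable {n : ℕ}

/-- All components are square integrable. -/
def SqInt (P : Measure Ω) (v : Fin n → Ω → V) : Prop := ∀ i, MemLp (v i) 2 P

/-- The network state in `L²` of a family of random vectors. -/
noncomputable def lift (P : Measure Ω) (v : Fin n → Ω → V) : NetVec n (Lp V 2 P) :=
  WithLp.toLp 2 fun i => toL2 P (v i)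

theorem lift_apply (v : Fin n → Ω → V) (i : Fin n) : lift P v i = toL2 P (v i) := rfl

namespace SqInt

variable {u v : Fin n → Ω → V}

theorem add (hu : SqInt P u) (hv : SqInt P v) : SqInt P fun i ω => u i ω + v i ω :=
  fun i => (hu i).add (hv i)

theorem sub (hu : SqInt P u) (hv : SqInt P v) : SqInt P fun i ω => u i ω - v i ω :=
  fun i => (hu i).sub (hv i)

theorem smul (hu : SqInt P u) (a : ℝ) : SqInt P fun i ω => a • u i ω :=
  fun i => (hu i).const_smul a

theorem mix (hu : SqInt P u) (A : Matrix (Fin n) (Fin n) ℝ) :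
    SqInt P fun i ω => ∑ j, A i j • u j ω :=
  fun i => memLp_finsetSum _ fun j _ => (hu j).const_smul (A i j)

theorem const [IsFiniteMeasure P] (a : Fin n → V) : SqInt P fun i _ => a i :=
  fun _ => memLp_const _

end SqInt

variable {u v : Fin n → Ω → V}

theorem toL2_add {f g : Ω → V} (hf : MemLp f 2 P) (hg : MemLp g 2 P) :
    toL2 P (fun ω => f ω + g ω) = toL2 P f + toL2 P g := by
  rw [toL2_eq hf, toL2_eq hg]
  exact (toL2_eq (hf.add hg)).trans (MemLp.toLp_add _ _)

theorem toL2_sub {f g : Ω → V} (hf : MemLp f 2 P) (hg : MemLp g 2 P) :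
    toL2 P (fun ω => f ω - g ω) = toL2 P f - toL2 P g := by
  rw [toL2_eq hf, toL2_eq hg]
  exact (toL2_eq (hf.sub hg)).trans (MemLp.toLp_sub _ _)

theorem toL2_smul {f : Ω → V} (hf : MemLp f 2 P) (a : ℝ) :
    toL2 P (fun ω => a • f ω) = a • toL2 P f := by
  rw [toL2_eq hf]
  exact (toL2_eq (hf.const_smul a)).trans (MemLp.toLp_const_smul _ _)

theorem toL2_sum {ι : Type*} (s : Finset ι) {f : ι → Ω → V} (hf : ∀ j, MemLp (f j) 2 P) :
    toL2 P (fun ω => ∑ j ∈ s, f j ω) = ∑ j ∈ s, toL2 P (f j) := by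
  classical
  induction s using Finset.induction_on with
  | empty =>
    simp only [Finset.sum_empty]
    have h0 : MemLp (fun _ : Ω => (0 : V)) 2 P := MemLp.zero'
    have h := toL2_smul h0 0
    simpa only [zero_smul] using h
  | insert a s ha ih =>
    have hs : MemLp (fun ω => ∑ j ∈ s, f j ω) 2 P := memLp_finsetSum s fun j _ => hf j
    rw [Finset.sum_insert ha, ← ih, ← toL2_add (hf a) hs]
    simp only [Finset.sum_insert ha]

theorem lift_add (hu : SqInt P u) (hv : SqInt P v) :
    lift P (fun i ω => u i ω + v i ω) = lift P u + lift P v := by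
  ext1 i
  exact toL2_add (hu i) (hv i)

theorem lift_sub (hu : SqInt P u) (hv : SqInt P v) :
    lift P (fun i ω => u i ω - v i ω) = lift P u - lift P v := by
  ext1 i
  exact toL2_sub (hu i) (hv i)

theorem lift_smul (hu : SqInt P u) (a : ℝ) : lift P (fun i ω => a • u i ω) = a • lift P u := by
  ext1 i
  exact toL2_smul (hu i) a

theorem mixOp_lift (hu : SqInt P u) (A : Matrix (Fin n) (Fin n) ℝ) :
    mixOp A (lift P u) = lift P fun i ω => ∑ j, A i j • u j ω := by
  ext1 i
  have h : ∀ j, MemLp (fun ω => A i j • u j ω) 2 P := fun j => (hu j).const_smul (A i j)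
  rw [mixOp_apply, lift_apply, toL2_sum _ h]
  exact Finset.sum_congr rfl fun j _ => (toL2_smul (hu j) _).symm

theorem inner_lift (hu : SqInt P u) (hv : SqInt P v) :
    inner ℝ (lift P u) (lift P v) = ∑ i, ∫ ω, inner ℝ (u i ω) (v i ω) ∂P := by
  rw [PiLp.inner_apply]
  exact Finset.sum_congr rfl fun i _ => inner_toL2 (hu i) (hv i)

theorem norm_lift_sq (v : Fin n → Ω → V) : ‖lift P v‖ ^ 2 = ∑ i, ‖toL2 P (v i)‖ ^ 2 :=
  PiLp.norm_sq_eq_of_L2 _ _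

theorem norm_lift_le (hu : SqInt P u) (hv : SqInt P v) {a : ℝ} (ha : 0 ≤ a)
    (h : ∀ i ω, ‖u i ω‖ ≤ a * ‖v i ω‖) : ‖lift P u‖ ≤ a * ‖lift P v‖ := by
  refine le_of_sq_le_sq ?_ (by positivity)
  rw [mul_pow, norm_lift_sq, norm_lift_sq, Finset.mul_sum]
  refine Finset.sum_le_sum fun i _ => ?_
  rw [← mul_pow]
  refine pow_le_pow_left₀ (norm_nonneg _) (Lp.norm_le_mul_norm_of_ae_le_mul ?_) 2
  filter_upwards [coeFn_toL2 (hu i), coeFn_toL2 (hv i)] with ω h1 h2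
  rw [h1, h2]
  exact h i ω

theorem le_inner_lift (hu : SqInt P u) (hv : SqInt P v) {a : ℝ}
    (h : ∀ i ω, a * ‖v i ω‖ ^ 2 ≤ inner ℝ (u i ω) (v i ω)) :
    a * ‖lift P v‖ ^ 2 ≤ inner ℝ (lift P u) (lift P v) := by
  rw [← real_inner_self_eq_norm_sq, inner_lift hu hv, inner_lift hv hv, Finset.mul_sum]
  refine Finset.sum_le_sum fun i _ => ?_
  rw [← integral_const_mul]
  refine integral_mono ((integrable_inner_of_memLp (hv i) (hv i)).const_mul a)
    (integrable_inner_of_memLp (hu i) (hv i)) fun ω => ?_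
  simp only [real_inner_self_eq_norm_sq]
  exact h i ω

theorem norm_lift_const_sq [IsProbabilityMeasure P] (a : Fin n → V) :
    ‖lift P (fun i _ => a i)‖ ^ 2 = ∑ i, ‖a i‖ ^ 2 := by
  rw [norm_lift_sq]
  refine Finset.sum_congr rfl fun i _ => ?_
  rw [← real_inner_self_eq_norm_sq, inner_toL2 (memLp_const _) (memLp_const _)]
  simp

end Lift

/-! ### Gradients of the average -/

section Average

variable {n p : ℕ} {f : Fin n → Vec p → ℝ}

theorem gradient_average (hf : ∀ i, Differentiable ℝ (f i)) (x : Vec p) :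
    gradient (average f) x = (1 / (n : ℝ)) • ∑ i, gradient (f i) x := by
  have h : HasGradientAt (average f) ((1 / (n : ℝ)) • ∑ i, gradient (f i) x) x := by
    have h1 : HasFDerivAt (average f) ((1 / (n : ℝ)) • ∑ i, fderiv ℝ (f i) x) x :=
      (HasFDerivAt.fun_sum fun i _ => (hf i x).hasFDerivAt).const_mul _
    rw [hasGradientAt_iff_hasFDerivAt]
    have e : InnerProductSpace.toDual ℝ (Vec p) ((1 / (n : ℝ)) • ∑ i, gradient (f i) x)
        = (1 / (n : ℝ)) • ∑ i, fderiv ℝ (f i) x := by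
      simp only [map_smul, map_sum, gradient, LinearIsometryEquiv.apply_symm_apply]
    rw [e]
    exact h1
  exact h.gradient

theorem gradient_average_eq_zero {xstar : Vec p} (h : ∀ x, average f xstar ≤ average f x) :
    gradient (average f) xstar = 0 := by
  have : IsLocalMin (average f) xstar := Filter.Eventually.of_forall h
  simp [gradient, this.fderiv_eq_zero]

end Average

/-! ### The algorithm as a process of square integrable network states -/

namespace Model

variable {n p : ℕ} {Ω Ξ : Type u} [MeasurableSpace Ω] [MeasurableSpace Ξ] {P : Measure Ω}
  (S : Model n p Ξ P)

/-- Square integrability along the sampled realization. -/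
def SqInt (v : Fin n → S.Path → Vec p) : Prop := CEDAS.SqInt P fun i ω => v i (S.sample ω)

/-- The network state in `L²` of functions of the realization. -/
noncomputable def lift (v : Fin n → S.Path → Vec p) : NetVec n (Lp (Vec p) 2 P) :=
  CEDAS.lift P fun i ω => v i (S.sample ω)

/-- The average of the agents. -/
noncomputable def xbar (k : ℕ) (w : S.Path) : Vec p := ∑ j, (1 / (n : ℝ)) • (S.path w k).x j

variable [IsProbabilityMeasure P]

theorem memLp_of_lintegral_le {v : S.Path → Vec p} (hv : Measurable v) {a : ℝ}
    (h : ∫⁻ ω, ‖v (S.sample ω)‖ₑ ^ 2 ∂P ≤ ENNReal.ofReal a) :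
    MemLp (fun ω => v (S.sample ω)) 2 P :=
  lintegral_enorm_sq_ne_top_integrable (hv.comp S.measurable_sample).aestronglyMeasurable
    (h.trans_lt ENNReal.ofReal_lt_top)

theorem memLp_gradient {v : S.Path → Vec p} (i : Fin n)
    (h : MemLp (fun ω => v (S.sample ω)) 2 P) :
    MemLp (fun ω => gradient (S.f i) (v (S.sample ω))) 2 P := by
  have h1 : MemLp (fun ω => gradient (S.f i) (v (S.sample ω)) - gradient (S.f i) 0) 2 P := by
    refine MemLp.of_le_mul (c := S.L) h ?_ (Filter.Eventually.of_forall fun ω => ?_)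
    · exact ((S.measurable_gradient i).comp_aemeasurable
        h.aestronglyMeasurable.aemeasurable).aestronglyMeasurable.sub aestronglyMeasurable_const
    · simpa using S.lip i (v (S.sample ω)) 0
  have h2 := h1.add (memLp_const (gradient (S.f i) 0))
  refine h2.ae_eq (Filter.Eventually.of_forall fun ω => ?_)
  simp

theorem sqInt_ε (k : ℕ) : S.SqInt (S.ε k) := fun i =>
  S.memLp_of_lintegral_le (S.measurable_ε k i) (S.noise_lintegral_le k i)

theorem sqInt_y_of {k : ℕ} (hx : S.SqInt fun i w => (S.path w k).x i)
    (hd : S.SqInt fun i w => (S.path w k).d i) : S.SqInt (S.y k) := by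
  have hG : S.SqInt (S.G k) := fun i => S.memLp_gradient (v := fun w => (S.path w k).x i) i (hx i)
  intro i
  have h := (((hx i).sub (((hG i).add (S.sqInt_ε k i)).const_smul (S.η k))).sub (hd i))
  refine h.ae_eq (Filter.Eventually.of_forall fun ω => ?_)
  simp [y, ε, -smul_add]

theorem sqInt_e_of {k : ℕ} (hr : S.SqInt (S.r k)) : S.SqInt (S.e k) := fun i =>
  lintegral_enorm_sq_ne_top_integrable
    ((S.measurable_e k i).comp S.measurable_sample).aestronglyMeasurable
    ((S.compression_lintegral_le k i).trans_lt (by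
      rw [← ofReal_norm_toL2_sq (hr i)]
      exact ENNReal.mul_lt_top ENNReal.ofReal_lt_top ENNReal.ofReal_lt_top))

theorem sqInt_initial_noise : S.SqInt fun i w =>
    S.grad i (S.xm i) (w.1 (i, 0)) - gradient (S.f i) (S.xm i) := fun i => by
  refine S.memLp_of_lintegral_le (v := fun w =>
    S.grad i (S.xm i) (w.1 (i, 0)) - gradient (S.f i) (S.xm i)) ?_ (S.sg.variance i 0 (S.xm i))
  exact ((S.sg.measurable_grad i).comp
    (measurable_const.prodMk (S.measurable_sample_coord (i, 0)))).sub measurable_const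

/-- Square integrability propagates because gradients grow linearly and both noise bounds hold
before any moment of the new iterate is known. The `L²` classes thus never fall back on the default
value `0`. -/
theorem sqInt_path (k : ℕ) : (S.SqInt fun i w => (S.path w k).x i) ∧
    (S.SqInt fun i w => (S.path w k).d i) ∧ (S.SqInt fun i w => (S.path w k).h i) := by
  induction k with
  | zero =>
    refine ⟨?_, SqInt.const fun _ => 0, SqInt.const S.xm⟩
    have h := (SqInt.const (P := P) S.xm).sub ((S.sqInt_initial_noise.add
      (SqInt.const fun i => gradient (S.f i) (S.xm i))).smul (S.η (-1)))
    simp only [sub_add_cancel] at h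
    exact h
  | succ k ih =>
    have hy := S.sqInt_y_of ih.1 ih.2.1
    have hr : S.SqInt (S.r k) := hy.sub ih.2.2
    have he := S.sqInt_e_of hr
    have hM : S.SqInt fun i w => (S.γ / 2) • ((S.y k i w + S.e k i w)
        - ∑ j, S.W i j • (S.y k j w + S.e k j w)) :=
      (((hy.add he).sub ((hy.add he).mix S.W)).smul (S.γ / 2))
    refine ⟨?_, ?_, ?_⟩
    · simp only [path_succ_x]; exact hy.sub hM
    · simp only [path_succ_d]; exact ih.2.1.add hM
    · simp only [path_succ_h]; exact ih.2.2.add ((hr.add he).smul S.α)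

theorem sqInt_x (k : ℕ) : S.SqInt fun i w => (S.path w k).x i := (S.sqInt_path k).1

theorem sqInt_d (k : ℕ) : S.SqInt fun i w => (S.path w k).d i := (S.sqInt_path k).2.1

theorem sqInt_h (k : ℕ) : S.SqInt fun i w => (S.path w k).h i := (S.sqInt_path k).2.2

theorem sqInt_G (k : ℕ) : S.SqInt (S.G k) := fun i =>
  S.memLp_gradient (v := fun w => (S.path w k).x i) i (S.sqInt_x k i)

theorem sqInt_y (k : ℕ) : S.SqInt (S.y k) := S.sqInt_y_of (S.sqInt_x k) (S.sqInt_d k)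

theorem sqInt_r (k : ℕ) : S.SqInt (S.r k) := (S.sqInt_y k).sub (S.sqInt_h k)

theorem sqInt_e (k : ℕ) : S.SqInt (S.e k) := S.sqInt_e_of (S.sqInt_r k)

theorem sqInt_const (a : Fin n → Vec p) : S.SqInt fun i _ => a i := SqInt.const a

theorem inner_lift_ε (k : ℕ) {v : Fin n → S.Path → Vec p} (hv : S.SqInt v)
    (hm : ∀ i, Measurable (v i)) (hcut : ∀ i w w', S.path w k = S.path w' k → v i w = v i w') :
    inner ℝ (S.lift (S.ε k)) (S.lift v) = 0 := by
  rw [lift, lift, inner_lift (S.sqInt_ε k) hv]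
  exact Finset.sum_eq_zero fun i _ => S.noise_integral_inner k i (hm i)
    (fun w₀ w => hcut i _ _ (S.path_cutSample k i w₀ w))
    (integrable_inner_of_memLp (S.sqInt_ε k i) (hv i))

theorem inner_lift_e (k : ℕ) {v : Fin n → S.Path → Vec p} (hv : S.SqInt v)
    (hm : ∀ i, Measurable (v i)) (hcut : ∀ i w₀ w, v i (S.cutSeed k w₀ w) = v i w) :
    inner ℝ (S.lift (S.e k)) (S.lift v) = 0 := by
  rw [lift, lift, inner_lift (S.sqInt_e k) hv]
  exact Finset.sum_eq_zero fun i _ => S.compression_integral_inner k i (hm i) (hcut i)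
    (integrable_inner_of_memLp (S.sqInt_e k i) (hv i))

theorem norm_lift_ε_sq_le (k : ℕ) : ‖S.lift (S.ε k)‖ ^ 2 ≤ n * S.σ ^ 2 := by
  rw [lift, norm_lift_sq]
  refine (Finset.sum_le_card_nsmul _ _ (S.σ ^ 2) fun i _ => ?_).trans (by simp)
  exact norm_toL2_sq_le (S.sqInt_ε k i) (sq_nonneg _) (S.noise_lintegral_le k i)

/-- The noises of different agents are orthogonal, so averaging keeps only the `1/n` part of the
total `n σ²`. This gain is the linear speedup. -/
theorem norm_opJ_lift_ε_sq_le (hn : n ≠ 0) (k : ℕ) :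
    ‖Network.opJ n _ (S.lift (S.ε k))‖ ^ 2 ≤ S.σ ^ 2 := by
  have hε := S.sqInt_ε k
  have e0 : ‖Network.opJ n _ (S.lift (S.ε k))‖ ^ 2
      = inner ℝ (S.lift (S.ε k)) (Network.opJ n _ (S.lift (S.ε k))) := by
    rw [← real_inner_self_eq_norm_sq, Network.opJ, inner_mixOp_symm Network.avg_isSymm, ← mixOp_mul,
      Network.avg_mul_avg hn]
  have orth : ∀ i j, j ≠ i → inner ℝ (S.lift (S.ε k) i) (S.lift (S.ε k) j) = 0 :=
    fun i j hij => by
      show inner ℝ (toL2 P fun ω => S.ε k i (S.sample ω)) (toL2 P fun ω => S.ε k j (S.sample ω)) = 0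
      rw [inner_toL2 (hε i) (hε j)]
      exact S.noise_integral_inner k i (S.measurable_ε k j) (fun w₀ w => S.ε_cutSample k hij w₀ w)
        (integrable_inner_of_memLp (hε i) (hε j))
  have e1 : ∀ i, inner ℝ (S.lift (S.ε k) i) (Network.opJ n _ (S.lift (S.ε k)) i)
      = 1 / (n : ℝ) * ‖S.lift (S.ε k) i‖ ^ 2 := fun i => by
    rw [Network.opJ, mixOp_apply, inner_sum, Finset.sum_eq_single i]
    · rw [inner_smul_right, real_inner_self_eq_norm_sq]; simp [Network.avg]
    · intro j _ hj
      rw [inner_smul_right, orth i j hj, mul_zero]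
    · simp
  rw [e0, PiLp.inner_apply, Finset.sum_congr rfl fun i _ => e1 i, ← Finset.mul_sum,
    ← PiLp.norm_sq_eq_of_L2]
  have h := S.norm_lift_ε_sq_le k
  have hn' : (0 : ℝ) < n := by exact_mod_cast Nat.pos_of_ne_zero hn
  rw [one_div, inv_mul_le_iff₀ hn']
  exact h

theorem norm_lift_e_sq_le (k : ℕ) : ‖S.lift (S.e k)‖ ^ 2 ≤ S.c * ‖S.lift (S.r k)‖ ^ 2 := by
  rw [lift, lift, norm_lift_sq, norm_lift_sq, Finset.mul_sum]
  refine Finset.sum_le_sum fun i _ => ?_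
  refine norm_toL2_sq_le (S.sqInt_e k i) (mul_nonneg S.unb.pos.le (sq_nonneg _)) ?_
  rw [ENNReal.ofReal_mul S.unb.pos.le, ofReal_norm_toL2_sq (S.sqInt_r k i)]
  exact S.compression_lintegral_le k i

theorem sqInt_xbar (k : ℕ) : S.SqInt fun _ w => S.xbar k w := fun _ =>
  memLp_finsetSum _ fun j _ => (S.sqInt_x k j).const_smul (1 / (n : ℝ))

theorem opJ_lift_x (k : ℕ) :
    Network.opJ n _ (S.lift fun i w => (S.path w k).x i) = S.lift fun _ w => S.xbar k w :=
  mixOp_lift (S.sqInt_x k) _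

theorem opJ_lift_gradient_xbar (hf : ∀ i, Differentiable ℝ (S.f i)) (k : ℕ) :
    Network.opJ n _ (S.lift fun i w => gradient (S.f i) (S.xbar k w))
      = S.lift fun _ w => gradient (average S.f) (S.xbar k w) := by
  have h := mixOp_lift (P := P) (u := fun i ω => gradient (S.f i) (S.xbar k (S.sample ω)))
    (fun i => S.memLp_gradient i (S.sqInt_xbar k i)) (Network.avg n)
  refine h.trans ?_
  simp only [lift, gradient_average hf, Finset.smul_sum]
  rfl

/-- The relations of `Iteration` are pointwise identities and inequalities carried to `L²`, and the
orthogonality relations come from `inner_lift_ε` and `inner_lift_e`. The mean of the gradients at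
the minimizer vanishes, which gives `J Gs = 0`. -/
theorem process (N : Network n) {μ : ℝ} (hn : 2 ≤ n) (hW : S.W = N.W)
    (hf : SmoothStronglyConvex S.f μ S.L) {xstar : Vec p}
    (hmin : ∀ x, average S.f xstar ≤ average S.f x) (hL : 0 ≤ S.L) :
    Iteration (Network.opJ n (Lp (Vec p) 2 P)) (N.opM (Lp (Vec p) 2 P) S.γ) S.α S.c S.L μ S.σ n
      (fun k => S.η k) (fun k => S.lift fun i w => (S.path w k).x i)
      (fun k => S.lift fun i w => (S.path w k).d i) (fun k => S.lift fun i w => (S.path w k).h i)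
      (fun k => S.lift (S.G k)) (fun k => S.lift fun i w => gradient (S.f i) (S.xbar k w))
      (fun k => S.lift (S.ε k)) (fun k => S.lift (S.e k)) (S.lift fun _ _ => xstar)
      (S.lift fun i _ => gradient (S.f i) xstar) := by
  have hn0 : n ≠ 0 := by omega
  have hn' : (n : ℝ) ≠ 0 := by exact_mod_cast hn0
  have grad_zero := gradient_average_eq_zero hmin
  have cs := S.sqInt_const fun _ => xstar
  have cG := S.sqInt_const fun i => gradient (S.f i) xstar
  have target_eq : ∀ k, target (fun k => S.lift fun i w => (S.path w k).x i)
      (fun k => S.lift fun i w => (S.path w k).d i) (fun k => S.lift (S.G k))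
      (fun k => S.lift (S.ε k)) (fun k => S.η k) k = S.lift (S.y k) := fun k => by
    have s1 := (S.sqInt_G k).add (S.sqInt_ε k)
    rw [target, lift, lift, lift, lift, ← lift_add (S.sqInt_G k) (S.sqInt_ε k), ← lift_smul s1,
      ← lift_sub (S.sqInt_x k) (s1.smul _), ← lift_sub ((S.sqInt_x k).sub (s1.smul _))
      (S.sqInt_d k)]
    simp only [lift, y, ε, add_sub_cancel]
  have J_xs : Network.opJ n _ (S.lift fun _ _ => xstar) = S.lift fun _ _ => xstar := by
    refine (mixOp_lift cs _).trans ?_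
    have : ∀ i : Fin n, ∑ j, Network.avg n i j • xstar = xstar := fun i => by
      rw [← Finset.sum_smul]
      simp [Network.avg, hn']
    simp only [this]
    rfl
  have J_Gs : Network.opJ n _ (S.lift fun i _ => gradient (S.f i) xstar) = 0 := by
    refine (mixOp_lift cG _).trans ?_
    have : ∀ i : Fin n, ∑ j, Network.avg n i j • gradient (S.f j) xstar = 0 := fun i => by
      rw [← grad_zero, gradient_average hf.differentiable, Finset.smul_sum]
      rfl
    simp only [this]
    have := lift_smul (P := P) (SqInt.const (n := n) fun _ => (0 : Vec p)) 0
    simpa using this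
  have JX_sub : ∀ k, Network.opJ n _ (S.lift fun i w => (S.path w k).x i) - S.lift (fun _ _ => xstar)
      = S.lift fun _ w => S.xbar k w - xstar := fun k => by
    rw [S.opJ_lift_x]; exact (lift_sub (S.sqInt_xbar k) cs).symm
  have X_sub : ∀ k, (S.lift fun i w => (S.path w k).x i) - S.lift (fun _ _ => xstar)
      = S.lift fun i w => (S.path w k).x i - xstar := fun k => (lift_sub (S.sqInt_x k) cs).symm
  have G_sub : ∀ k, S.lift (S.G k) - (S.lift fun i _ => gradient (S.f i) xstar)
      = S.lift fun i w => S.G k i w - gradient (S.f i) xstar :=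
    fun k => (lift_sub (S.sqInt_G k) cG).symm
  have sX : ∀ k, S.SqInt fun i w => (S.path w k).x i - xstar := fun k => (S.sqInt_x k).sub cs
  have sG : ∀ k, S.SqInt fun i w => S.G k i w - gradient (S.f i) xstar :=
    fun k => (S.sqInt_G k).sub cG
  have sGb : ∀ k, S.SqInt fun i w => gradient (S.f i) (S.xbar k w) :=
    fun k i => S.memLp_gradient i (S.sqInt_xbar k i)
  have sAv : ∀ k, S.SqInt fun _ w => gradient (average S.f) (S.xbar k w) := fun k => by
    have h := (sGb k).mix (Network.avg n)
    simp only [gradient_average hf.differentiable, Finset.smul_sum]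
    exact h
  have M_lift : ∀ v : Fin n → S.Path → Vec p, S.SqInt v → N.opM _ S.γ (S.lift v)
      = S.lift fun i w => (S.γ / 2) • (v i w - ∑ j, S.W i j • v j w) := fun v hv => by
    rw [Network.opM, mixOp_smul, mixOp_sub, mixOp_one, ← hW, lift, mixOp_lift hv,
      ← lift_sub hv (hv.mix _), ← lift_smul (hv.sub (hv.mix _))]
    rfl
  have sM : ∀ v : Fin n → S.Path → Vec p, S.SqInt v →
      S.SqInt fun i w => (S.γ / 2) • (v i w - ∑ j, S.W i j • v j w) :=
    fun v hv => (hv.sub (hv.mix _)).smul _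
  have ye : ∀ k, S.lift (S.y k) + S.lift (S.e k) = S.lift fun i w => S.y k i w + S.e k i w :=
    fun k => (lift_add (S.sqInt_y k) (S.sqInt_e k)).symm
  have sye : ∀ k, S.SqInt fun i w => S.y k i w + S.e k i w :=
    fun k => (S.sqInt_y k).add (S.sqInt_e k)
  have yh : ∀ k, S.lift (S.y k) - S.lift (fun i w => (S.path w k).h i) = S.lift (S.r k) :=
    fun k => (lift_sub (S.sqInt_y k) (S.sqInt_h k)).symm
  have J_lift : ∀ v : Fin n → S.Path → Vec p, S.SqInt v → Network.opJ n _ (S.lift v)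
      = S.lift fun _ w => ∑ j, (1 / (n : ℝ)) • v j w := fun v hv => mixOp_lift hv _
  have sJ : ∀ v : Fin n → S.Path → Vec p, S.SqInt v →
      S.SqInt fun _ w => ∑ j, (1 / (n : ℝ)) • v j w := fun v hv => hv.mix (Network.avg n)
  have mX : ∀ k i, Measurable fun w => (S.path w k).x i - xstar :=
    fun k i => (S.measurable_x k i).sub measurable_const
  have mG : ∀ k i, Measurable fun w => S.G k i w - gradient (S.f i) xstar :=
    fun k i => (S.measurable_G k i).sub measurable_const
  constructor
  · intro k
    rw [target_eq, ye, M_lift _ (sye k), lift, lift, lift, ← lift_sub (S.sqInt_y k) (sM _ (sye k))]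
    simp only [path_succ_x]
  · intro k
    rw [target_eq, ye, M_lift _ (sye k), lift, lift, lift, ← lift_add (S.sqInt_d k) (sM _ (sye k))]
    simp only [path_succ_d]
  · intro k
    rw [target_eq, yh, lift, lift, lift, lift, ← lift_add (S.sqInt_r k) (S.sqInt_e k),
      ← lift_smul ((S.sqInt_r k).add (S.sqInt_e k)),
      ← lift_add (S.sqInt_h k) (((S.sqInt_r k).add (S.sqInt_e k)).smul _)]
    simp only [path_succ_h]
  · have := lift_smul (P := P) (SqInt.const (n := n) fun _ => (0 : Vec p)) 0
    simpa [lift, path_zero_d] using this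
  · exact J_xs
  · exact J_Gs
  · intro k
    rw [X_sub, G_sub]
    exact norm_lift_le (sG k) (sX k) hL fun i ω => S.lip i _ _
  · intro k
    have h1 : S.lift (S.G k) - (S.lift fun i w => gradient (S.f i) (S.xbar k w))
        = S.lift fun i w => S.G k i w - gradient (S.f i) (S.xbar k w) :=
      (lift_sub (S.sqInt_G k) (sGb k)).symm
    have h2 : (S.lift fun i w => (S.path w k).x i) - (S.lift fun _ w => S.xbar k w)
        = S.lift fun i w => (S.path w k).x i - S.xbar k w :=
      (lift_sub (S.sqInt_x k) (S.sqInt_xbar k)).symm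
    rw [S.opJ_lift_x, h1, h2]
    exact norm_lift_le ((S.sqInt_G k).sub (sGb k)) ((S.sqInt_x k).sub (S.sqInt_xbar k)) hL
      fun i ω => S.lip i _ _
  · intro k
    rw [JX_sub, S.opJ_lift_gradient_xbar hf.differentiable]
    refine norm_lift_le (sAv k) ((S.sqInt_xbar k).sub cs) hL fun i ω => ?_
    -- Subtracting the vanishing average gradient at `xstar` makes the average Lipschitz bound
    -- follow from those of the `f_j`.
    have h1 : gradient (average S.f) (S.xbar k (S.sample ω)) = (1 / (n : ℝ)) •
        ∑ j, (gradient (S.f j) (S.xbar k (S.sample ω)) - gradient (S.f j) xstar) := by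
      rw [Finset.sum_sub_distrib, smul_sub, ← gradient_average hf.differentiable,
        ← gradient_average hf.differentiable, grad_zero, sub_zero]
    show ‖gradient (average S.f) (S.xbar k (S.sample ω))‖ ≤ S.L * ‖S.xbar k (S.sample ω) - xstar‖
    rw [h1, norm_smul, Real.norm_of_nonneg (by positivity), one_div,
      inv_mul_le_iff₀ (by positivity)]
    refine (norm_sum_le _ _).trans ((Finset.sum_le_card_nsmul _ _ _ fun j _ =>
      S.lip j _ _).trans (by simp))
  · intro k
    rw [JX_sub, S.opJ_lift_gradient_xbar hf.differentiable]
    refine le_inner_lift (sAv k) ((S.sqInt_xbar k).sub cs) fun i ω => ?_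
    have h := hf.strongly_convex (S.xbar k (S.sample ω)) xstar
    rwa [grad_zero, sub_zero] at h
  · exact S.norm_lift_ε_sq_le
  · exact S.norm_opJ_lift_ε_sq_le hn0
  · intro k
    rw [target_eq, yh]
    exact S.norm_lift_e_sq_le k
  · intro k
    rw [X_sub]
    exact S.inner_lift_ε k (sX k) (mX k) fun i w w' h => by rw [h]
  · intro k
    rw [X_sub, J_lift _ (sX k)]
    refine S.inner_lift_ε k (sJ _ (sX k)) (fun i => ?_) fun i w w' h => by rw [h]
    have := mX k
    fun_prop
  · intro k
    rw [G_sub]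
    exact S.inner_lift_ε k (sG k) (mG k) fun i w w' h => by simp only [G, h]
  · intro k
    rw [G_sub, J_lift _ (sG k)]
    refine S.inner_lift_ε k (sJ _ (sG k)) (fun i => ?_) fun i w w' h => by simp only [G, h]
    have := mG k
    fun_prop
  · intro k
    exact S.inner_lift_e k (S.sqInt_d k) (S.measurable_d k) fun i w₀ w => by rw [S.path_cutSeed]
  · intro k
    exact S.inner_lift_e k cG (fun i => measurable_const) fun i w₀ w => rfl
  · intro k
    have s1 : S.SqInt fun i w => S.y k i w - xstar := (S.sqInt_y k).sub cs
    have h1 : S.lift (S.y k) - S.lift (fun _ _ => xstar) = S.lift fun i w => S.y k i w - xstar :=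
      (lift_sub (S.sqInt_y k) cs).symm
    rw [target_eq, h1, M_lift _ s1, M_lift _ (sM _ s1)]
    refine S.inner_lift_e k (sM _ (sM _ s1)) (fun i => ?_) fun i w₀ w => by
      simp only [S.y_cutSeed]
    have := S.measurable_y k
    fun_prop
  · intro k
    rw [target_eq, yh]
    exact S.inner_lift_e k (S.sqInt_r k) (S.measurable_r k) fun i w₀ w => S.r_cutSeed k i w₀ w

theorem lift_x_zero : (S.lift fun i w => (S.path w 0).x i) = S.lift (fun i _ => S.xm i)
    - S.η (-1) • (S.lift (fun i _ => gradient (S.f i) (S.xm i))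
      + S.lift fun i w => S.grad i (S.xm i) (w.1 (i, 0)) - gradient (S.f i) (S.xm i)) := by
  have s1 := S.sqInt_const fun i => gradient (S.f i) (S.xm i)
  have s2 := s1.add S.sqInt_initial_noise
  rw [lift, lift, lift, lift, ← lift_add s1 S.sqInt_initial_noise, ← lift_smul s2,
    ← lift_sub (S.sqInt_const S.xm) (s2.smul _)]
  simp only [path_zero_x, add_sub_cancel]

theorem norm_lift_initial_noise_sq_le : ‖S.lift fun i w =>
    S.grad i (S.xm i) (w.1 (i, 0)) - gradient (S.f i) (S.xm i)‖ ^ 2 ≤ n * S.σ ^ 2 := by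
  rw [lift, norm_lift_sq]
  refine (Finset.sum_le_card_nsmul _ _ (S.σ ^ 2) fun i _ => ?_).trans (by simp)
  exact norm_toL2_sq_le (S.sqInt_initial_noise i) (sq_nonneg _) (S.sg.variance i 0 _)

theorem norm_lift_const_sq (a : Fin n → Vec p) : ‖S.lift fun i _ => a i‖ ^ 2 = ∑ i, ‖a i‖ ^ 2 :=
  CEDAS.norm_lift_const_sq a

theorem norm_lift_sub_const_sq (a b : Fin n → Vec p) :
    ‖S.lift (fun i _ => a i) - S.lift (fun i _ => b i)‖ ^ 2 = ∑ i, ‖a i - b i‖ ^ 2 := by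
  rw [lift, lift, ← lift_sub (S.sqInt_const a) (S.sqInt_const b)]
  exact CEDAS.norm_lift_const_sq fun i => a i - b i

theorem norm_lift_gradient_sub_le (hL : 0 ≤ S.L) (a b : Fin n → Vec p) :
    ‖S.lift (fun i _ => gradient (S.f i) (a i)) - S.lift (fun i _ => gradient (S.f i) (b i))‖
      ≤ S.L * ‖S.lift (fun i _ => a i) - S.lift (fun i _ => b i)‖ := by
  have s1 := S.sqInt_const fun i => gradient (S.f i) (a i)
  have s2 := S.sqInt_const fun i => gradient (S.f i) (b i)
  have s3 := S.sqInt_const a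
  have s4 := S.sqInt_const b
  rw [lift, lift, lift, lift, ← lift_sub s1 s2, ← lift_sub s3 s4]
  exact norm_lift_le (s1.sub s2) (s3.sub s4) hL fun i ω => S.lip i _ _

theorem meanSqError_eq (k : ℕ) (xstar : Vec p) :
    meanSqError P (fun ω => (S.path (S.sample ω) k).x) xstar = (n : ℝ≥0∞)⁻¹ *
      ENNReal.ofReal (‖(S.lift fun i w => (S.path w k).x i) - S.lift fun _ _ => xstar‖ ^ 2) := by
  have cs := S.sqInt_const fun _ => xstar
  have s1 := (S.sqInt_x k).sub cs
  rw [lift, lift, ← lift_sub (S.sqInt_x k) cs, norm_lift_sq,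
    ENNReal.ofReal_sum_of_nonneg fun i _ => sq_nonneg _, meanSqError]
  congr 1
  exact Finset.sum_congr rfl fun i _ => (ofReal_norm_toL2_sq (s1 i)).symm

end Model

/-! ### The parameters -/

section Parameters

variable {c α g γ θ μ L : ℝ}

/-- When `12cα = 1` and `g ≤ 2`, the third entry of the minimum is always the smallest, and it
equals `gα³/108`. -/
theorem gammaMax_eq (hα : 0 < α) (hα1 : α ≤ 1) (hc : 12 * c * α = 1) (hg : 0 < g) (hg2 : g ≤ 2) :
    gammaMax c α g = g * α ^ 3 / 108 := by
  have hc0 : 0 < c := by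
    by_contra h
    push Not at h
    nlinarith
  have h3 : α ^ 3 ≤ α := by nlinarith [mul_pos hα hα]
  have small : g * α ^ 3 / 108 ≤ α / 54 := by
    have := mul_le_mul hg2 h3 (by positivity) zero_le_two
    linarith
  have e : g * α ^ 2 / (1296 * c) = g * α ^ 3 / 108 := by
    rw [div_eq_div_iff (by positivity) (by norm_num)]
    linear_combination -(g * α ^ 2 * 108) * hc
  have h1 : α ≤ √α / (2 * √c) := by
    rw [le_div_iff₀ (by positivity)]
    refine Real.le_sqrt_of_sq_le ?_
    have : (α * (2 * √c)) ^ 2 = 4 * α * (c * α) := by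
      rw [mul_pow, mul_pow, Real.sq_sqrt hc0.le]; ring
    rw [this]
    nlinarith
  have h2 : α / 2 ≤ α / g := div_le_div_of_nonneg_left hα.le hg hg2
  rw [gammaMax, e, min_eq_left (a := g * α ^ 3 / 108) (by linarith), min_eq_right]
  exact le_min (by linarith) (by linarith)

/-- Three entries of the maximum are used, one for each bound: the first makes the contraction rate
at least `1/m`, the third makes `ηL ≤ 1`, the fourth gives `m ≥ 2θ`. -/
theorem shift_ge (hα : 0 < α) (hα1 : α ≤ 1) (hg : 0 < g) (hγ : 0 < γ) (hθ : 1 ≤ θ) (hμ : 0 < μ)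
    (hL : 0 < L) :
    1 ≤ γ / 2 * g * shift θ μ L γ α g ∧ θ * L ≤ μ * shift θ μ L γ α g ∧
      2 * θ ≤ shift θ μ L γ α g := by
  have h1 : 32 * θ / (γ * g) ≤ shift θ μ L γ α g := (le_max_left _ _).trans (le_max_left _ _)
  have h3 : 3 * θ * L * √6 / (2 * √α * μ) ≤ shift θ μ L γ α g :=
    (le_max_left _ _).trans (le_max_right _ _)
  have h4 : 8 * θ / α ≤ shift θ μ L γ α g := (le_max_right _ _).trans (le_max_right _ _)
  have hs : 0 < √α := Real.sqrt_pos.2 hα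
  have hs1 : √α ≤ 1 := Real.sqrt_le_one.2 hα1
  have h6 : 1 ≤ √6 := Real.one_le_sqrt.2 (by norm_num)
  refine ⟨?_, ?_, ?_⟩
  · rw [div_le_iff₀ (by positivity)] at h1
    linarith
  · refine le_trans ?_ (mul_le_mul_of_nonneg_left h3 hμ.le)
    have e : μ * (3 * θ * L * √6 / (2 * √α * μ)) = θ * L * (3 * √6 / (2 * √α)) := by
      field_simp
    rw [e]
    refine le_mul_of_one_le_right (by positivity) ?_
    rw [le_div_iff₀ (by positivity)]
    linarith
  · refine le_trans ?_ h4
    rw [le_div_iff₀ hα]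
    nlinarith

/-- All four denominators are at least of order `γg`, since `γg ≤ α ≤ √α`. -/
theorem shift_le (hα : 0 < α) (hα1 : α ≤ 1) (hg : 0 < g) (hγ : 0 < γ) (hγα : γ * g ≤ α)
    (hθ : 0 < θ) (hμ : 0 < μ) (hL : 0 < L) :
    shift θ μ L γ α g
      ≤ (32 * θ + 8 * √2 * L / μ + 3 * θ * L * √6 / (2 * μ)) * (1 / (γ * g)) := by
  have hγg : 0 < γ * g := mul_pos hγ hg
  have p1 : 0 < 8 * √2 * L / μ := by positivity
  have p2 : 0 < 3 * θ * L * √6 / (2 * μ) := by positivity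
  have hs : 0 < √α := Real.sqrt_pos.2 hα
  have hαs : α ≤ √α := Real.le_sqrt_of_sq_le (by nlinarith)
  have key : ∀ a, a ≤ 32 * θ + 8 * √2 * L / μ + 3 * θ * L * √6 / (2 * μ) → ∀ t, γ * g ≤ t →
      0 ≤ a → a * (1 / t) ≤ (32 * θ + 8 * √2 * L / μ + 3 * θ * L * √6 / (2 * μ)) * (1 / (γ * g)) :=
    fun a ha t ht ha0 => mul_le_mul ha (one_div_le_one_div_of_le hγg ht)
      (by have := hγg.trans_le ht; positivity) (ha0.trans ha)
  refine max_le (max_le ?_ ?_) (max_le ?_ ?_)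
  · have := key (32 * θ) (by linarith) (γ * g) le_rfl (by positivity)
    rwa [mul_one_div] at this
  · have := key (8 * √2 * L / μ) (by linarith) (γ * g) le_rfl (by positivity)
    rwa [mul_one_div, div_div, ← mul_assoc] at this
  · have := key (3 * θ * L * √6 / (2 * μ)) (by linarith) √α (hγα.trans hαs) (by positivity)
    rwa [mul_one_div, div_div, mul_right_comm 2 μ] at this
  · have := key (8 * θ) (by linarith) α hγα (by positivity)
    rwa [mul_one_div] at this

theorem one_div_stepsize_le {c₀ : ℝ} (hα : 0 < α) (hc : 12 * c * α = 1) (hc₀ : 0 < c₀) (hg : 0 < g)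
    (hγ : c₀ * (g * α ^ 3 / 108) ≤ γ) :
    1 / (γ * g) ≤ 186624 / c₀ * (c ^ 3 / g ^ 2) := by
  have h : c₀ * (g * α ^ 3 / 108) * g ≤ γ * g := mul_le_mul_of_nonneg_right hγ hg.le
  refine (one_div_le_one_div_of_le (by positivity) h).trans (le_of_eq ?_)
  -- The constant `186624` is `108 · 12³`.
  have e : α = 1 / (12 * c) := by
    have : c ≠ 0 := by rintro rfl; simp at hc
    field_simp
    linarith
  have : c ≠ 0 := by rintro rfl; simp at hc
  rw [e]
  field_simp
  norm_num

end Parameters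

/-! ### Assembly of the main theorem -/

theorem cube_div_sq_le {n : ℝ} {c g c₃ c₄ q r : ℝ} (hn : 0 < n) (hc : 0 ≤ c) (hg : 0 < g)
    (h₃ : 1 / g ≤ c₃ * n ^ q) (h₄ : c ≤ c₄ * n ^ r) :
    c ^ 3 / g ^ 2 ≤ c₄ ^ 3 * c₃ ^ 2 * n ^ (2 * q + 3 * r) := by
  have h1 := pow_le_pow_left₀ hc h₄ 3
  have h2 := pow_le_pow_left₀ (by positivity) h₃ 2
  have e : n ^ (2 * q + 3 * r) = (n ^ r) ^ 3 * (n ^ q) ^ 2 := by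
    rw [Real.rpow_add hn, mul_comm 2 q, mul_comm 3 r, Real.rpow_mul hn.le, Real.rpow_mul hn.le,
      Real.rpow_ofNat, Real.rpow_ofNat, mul_comm]
  calc c ^ 3 / g ^ 2 = c ^ 3 * (1 / g) ^ 2 := by rw [one_div_pow, mul_one_div]
    _ ≤ (c₄ * n ^ r) ^ 3 * (c₃ * n ^ q) ^ 2 :=
        mul_le_mul h1 h2 (by positivity) (h1.trans' (by positivity))
    _ = _ := by rw [e]; ring

/-- A bound `K / k` for the sum of the errors from time `t` on bounds the transient time. -/
theorem transientTime_le_of_forall {n : ℕ} (hn : n ≠ 0) {K t b : ℝ} {err : ℕ → ℝ≥0∞} {S : ℕ → ℝ}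
    (herr : ∀ k, err k = (n : ℝ≥0∞)⁻¹ * ENNReal.ofReal (S k)) (ht : 0 ≤ t)
    (h : ∀ k : ℕ, t ≤ k → S k ≤ K / k) (hb : t + 1 ≤ b) :
    transientTime n K err ≤ ENNReal.ofReal b := by
  have hn0 : (0 : ℝ) < n := by exact_mod_cast Nat.pos_of_ne_zero hn
  refine (iInf₂_le ⌈t⌉₊ fun k hk _ => ?_).trans ?_
  · have hk' : t ≤ k := (Nat.le_ceil t).trans (by exact_mod_cast hk)
    rw [herr, ← ENNReal.ofReal_natCast, ← ENNReal.ofReal_inv_of_pos hn0,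
      ← ENNReal.ofReal_mul (by positivity)]
    refine ENNReal.ofReal_le_ofReal ?_
    refine (mul_le_mul_of_nonneg_left (h k hk') (by positivity)).trans (le_of_eq ?_)
    rw [mul_comm (n : ℝ), ← div_div, inv_mul_eq_div]
  · rw [← ENNReal.ofReal_natCast]
    exact ENNReal.ofReal_le_ofReal ((Nat.ceil_lt_add_one ht).le.trans hb)

end CEDAS

set_option maxHeartbeats 2000000 in
theorem corollary2
    (μ L σ θ c₀ c₁ c₂ c₃ c₄ q r : ℝ) (hμ : 0 < μ) (hL : 0 < L) (hσ : 0 < σ) (hθ : 18 < θ)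
    (hc₀ : 0 < c₀) (hq : 0 < q) (hr : 0 ≤ r) (hqr : 2 * q + 3 * r ≤ 4 * θ / 3 - 1) :
    ∃ A K : ℝ, 0 < A ∧ 0 < K ∧
      ∀ (n p : ℕ) (hn : 2 ≤ n) (N : CEDAS.Network n)
        (f : Fin n → CEDAS.Vec p → ℝ) (_ : CEDAS.SmoothStronglyConvex f μ L)
        (xstar : CEDAS.Vec p) (_ : ∀ x, CEDAS.average f xstar ≤ CEDAS.average f x)
        (C δ : ℝ) (𝒞₁ 𝒞₂ : CEDAS.Compressor.{u} p)
        (_ : 𝒞₁.IsBiased δ) (_ : 𝒞₂.IsUnbiased C)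
        (α γ m : ℝ) (_ : α = 1 / (12 * (C * (1 - δ)))) (_ : 1 / 12 ≤ C * (1 - δ))
        (_ : c₀ * CEDAS.gammaMax (C * (1 - δ)) α (1 - N.lambda2 hn) ≤ γ)
        (_ : γ ≤ CEDAS.gammaMax (C * (1 - δ)) α (1 - N.lambda2 hn))
        (_ : m = CEDAS.shift θ μ L γ α (1 - N.lambda2 hn))
        (xm1 : Fin n → CEDAS.Vec p)
        (_ : ∑ i, ‖gradient (f i) xstar‖ ^ 2 ≤ c₁ * (n : ℝ) ^ 3)
        (_ : ∑ i, ‖xm1 i - xstar‖ ^ 2 ≤ c₂ * (n : ℝ) ^ 2)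
        (_ : 1 / (1 - N.lambda2 hn) ≤ c₃ * (n : ℝ) ^ q)
        (_ : C * (1 - δ) ≤ c₄ * (n : ℝ) ^ r)
        (Ω Ξ : Type u) (_ : MeasurableSpace Ω) (_ : MeasurableSpace Ξ)
        (P : MeasureTheory.Measure Ω) (_ : MeasureTheory.IsProbabilityMeasure P)
        (grad : Fin n → CEDAS.Vec p → Ξ → CEDAS.Vec p) (ξ : Fin n → ℕ → Ω → Ξ)
        (_ : CEDAS.StochasticGradient P f grad ξ σ)
        (s : Fin n → ℕ → Ω → (𝒞₁.induced 𝒞₂).Seed)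
        (_ : CEDAS.FreshSeeds P (𝒞₁.induced 𝒞₂) s)
        (_ : ProbabilityTheory.IndepFun (fun ω (a : Fin n × ℕ) => ξ a.1 a.2 ω)
          (fun ω (a : Fin n × ℕ) => s a.1 a.2 ω) P),
        CEDAS.transientTime n K (fun k => CEDAS.meanSqError P
            (fun ω => (CEDAS.run N.W γ α (CEDAS.stepsize θ μ m) grad (𝒞₁.induced 𝒞₂) xm1 xm1
              (fun i t => ξ i t ω) (fun i t => s i t ω) k).x) xstar)
          ≤ ENNReal.ofReal (A * (n * C ^ 3 * (1 - δ) ^ 3 / (1 - N.lambda2 hn) ^ 2)) := by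
  obtain ⟨A, K, hA, hK, key⟩ := CEDAS.exists_process_bound.{u} μ L σ θ (2 * q + 3 * r) c₁ c₂
    ((32 * θ + 8 * √2 * L / μ + 3 * θ * L * √6 / (2 * μ)) * (186624 / c₀) * (c₄ ^ 3 * c₃ ^ 2))
    hμ hL hθ hqr
  have hθ0 : 0 < θ := by linarith
  refine ⟨(A + 1) * ((32 * θ + 8 * √2 * L / μ + 3 * θ * L * √6 / (2 * μ)) * (186624 / c₀)), K,
    by positivity, hK, ?_⟩
  intro n p hn N f hf xstar hmin C δ 𝒞₁ 𝒞₂ h𝒞₁ h𝒞₂ α γ m hα hc hγ_ge hγ_le hm xm1 hc₁ hc₂ hc₃ hc₄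
    Ω Ξ _ _ P _ grad ξ sg s fs indep
  have hg : 0 < 1 - N.lambda2 hn := by have := N.lambda2_lt_one hn; linarith
  have hg2 : 1 - N.lambda2 hn ≤ 2 := by have := N.neg_one_le_lambda2 hn; linarith
  have eb : (n : ℝ) * C ^ 3 * (1 - δ) ^ 3 / (1 - N.lambda2 hn) ^ 2
      = n * ((C * (1 - δ)) ^ 3 / (1 - N.lambda2 hn) ^ 2) := by ring
  have unb := h𝒞₁.induced_isUnbiased h𝒞₂ (by linarith)
  obtain ⟨M, hM⟩ : ∃ M, M = (32 * θ + 8 * √2 * L / μ + 3 * θ * L * √6 / (2 * μ)) * (186624 / c₀) :=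
    ⟨_, rfl⟩
  have hM0 : 0 < M := by rw [hM]; positivity
  rw [eb]
  rw [← hM] at key ⊢
  obtain ⟨g, hgdef⟩ : ∃ g, g = 1 - N.lambda2 hn := ⟨_, rfl⟩
  obtain ⟨c, hcdef⟩ : ∃ c, c = C * (1 - δ) := ⟨_, rfl⟩
  rw [← hcdef] at hα hc hc₄ hγ_ge hγ_le unb ⊢
  rw [← hgdef] at hg hg2 hc₃ hγ_ge hγ_le hm ⊢
  have hα0 : 0 < α := by rw [hα]; positivity
  have hcα : 12 * c * α = 1 := by rw [hα]; field_simp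
  have hα1 : α ≤ 1 := by nlinarith
  rw [CEDAS.gammaMax_eq hα0 hα1 hcα hg hg2] at hγ_ge hγ_le
  have hγ : 0 < γ := lt_of_lt_of_le (by positivity) hγ_ge
  have hα3 : α ^ 3 ≤ α := by nlinarith [mul_pos hα0 hα0]
  have hα3' : 0 < α ^ 3 := by positivity
  have gα : g * α ^ 3 ≤ 2 * α ^ 3 := mul_le_mul_of_nonneg_right hg2 hα3'.le
  have hγα : γ * g ≤ α := by nlinarith
  obtain ⟨m1, m2, m3⟩ := CEDAS.shift_ge (θ := θ) hα0 hα1 hg hγ (by linarith) hμ hL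
  have hm_le := CEDAS.shift_le hα0 hα1 hg hγ hγα hθ0 hμ hL
  rw [← hm] at m1 m2 m3 hm_le
  have hn1 : (1 : ℝ) ≤ n := by exact_mod_cast (by omega : 1 ≤ n)
  have hm_le2 : m ≤ M * (c ^ 3 / g ^ 2) := by
    refine hm_le.trans ?_
    rw [hM, mul_assoc _ (186624 / c₀)]
    exact mul_le_mul_of_nonneg_left (CEDAS.one_div_stepsize_le hα0 hcα hc₀ hg hγ_ge)
      (by positivity)
  -- The polynomial growth of `m` in `n` serves only to forget the initial error; the transient
  -- bound itself uses `hm_le2`.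
  have hm_le3 : m ≤ M * (c₄ ^ 3 * c₃ ^ 2) * (n : ℝ) ^ (2 * q + 3 * r) := by
    refine hm_le2.trans ?_
    rw [mul_assoc]
    exact mul_le_mul_of_nonneg_left
      (CEDAS.cube_div_sq_le (by linarith) (by linarith) hg hc₃ hc₄) hM0.le
  let S : CEDAS.Model n p Ξ P :=
    { W := N.W, γ := γ, α := α, η := CEDAS.stepsize θ μ m, f := f, grad := grad,
      𝒞 := 𝒞₁.induced 𝒞₂, xm := xm1, ξ := ξ, s := s, L := L, σ := σ, c := c, lip := hf.lipschitz,
      sg := sg, fs := fs, unb := unb, indep := indep }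
  have proc := S.process N hn rfl hf hmin hL.le
  have o := N.mixingOps (F := Lp (CEDAS.Vec p) 2 P) hn hγ
  rw [← hgdef] at o
  -- Here `lam = γg/2`, so the requirement `54γ² ≤ lam α³` reads `108γ ≤ gα³`, which is precisely `γ
  -- ≤ γ_max`.
  have bound := key _ _ _ _ _ _ _ _ _ m (S.η (-1)) _ _ _ _ _ _ _ _ _ _
    (S.lift fun i _ => S.xm i) (S.lift fun i _ => gradient (S.f i) (S.xm i))
    (S.lift fun i w => S.grad i (S.xm i) (w.1 (i, 0)) - gradient (S.f i) (S.xm i)) o proc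
    (by positivity) (by linarith) hα0 hα1 hγ hcα (by linarith) (by nlinarith) (by linarith) hn1
    (by linarith) m1 m2 (by linarith) hm_le3 (fun k => by
      show CEDAS.stepsize θ μ m (k : ℤ) = _
      simp [CEDAS.stepsize])
    (by
      show CEDAS.stepsize θ μ m (-1) = _
      rw [CEDAS.stepsize]; push_cast; ring_nf)
    (by
      have h := S.norm_lift_const_sq fun i => gradient (S.f i) xstar
      exact h.trans_le hc₁)
    (by rw [S.norm_lift_sub_const_sq]; exact hc₂)
    (S.norm_lift_gradient_sub_le hL.le _ _) S.norm_lift_initial_noise_sq_le S.lift_x_zero rfl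
  refine CEDAS.transientTime_le_of_forall (by omega) (fun k => S.meanSqError_eq k xstar)
    (by have : 0 < m := by linarith
        positivity) bound ?_
  -- Rounding the transient time up to an integer costs at most `1`, which is absorbed since `nm ≥
  -- 1`.
  have nm : 1 ≤ n * m := by nlinarith
  have : n * m ≤ n * (M * (c ^ 3 / g ^ 2)) := mul_le_mul_of_nonneg_left hm_le2 (by linarith)
  calc A * (n * m) + 1 ≤ (A + 1) * (n * m) := by linarith
    _ ≤ (A + 1) * (n * (M * (c ^ 3 / g ^ 2))) := mul_le_mul_of_nonneg_left this (by linarith)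
    _ = _ := by ring
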